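/- **Setting.** Let $\varepsilon,\mu:\mathbf R\to(0,\infty)$ be piecewise continuous, real-valued, $1$-periodic and inversion symmetric, $\varepsilon(x)=\varepsilon(1-x)$, $\mu(x)=\mu(1-x)$, and let $\mathcal L\psi=-\frac1\varepsilon\left(\frac1\mu\psi'\right)'$. (Solutions of $\mathcal L\psi=E\psi$ are understood to be continuous with continuous flux $\frac1\mu\psi'$.) For real $E$ let $\psi_{E,1},\psi_{E,2}$ be the solutions of $\mathcal L\psi=E\psi$ with $(\psi,\frac1\mu\psi')(0)=(1,0)$ and $(0,1)$ respectively, and let $D(E)=\psi_{E,1}(1)+\frac1\mu\psi_{E,2}'(1)$ be the trace of the monodromy matrix. *Bands.* For $k\in\mathbf R$ let $E_1(k)\le E_2(k)\le\cdots$ be the eigenvalues, counted with multiplicity, of $\mathcal L\psi=E\psi$, $\psi(x+1)=e^{ik}\psi(x)$; let $E_j^-=\min_{k\in[-\pi,\pi]}E_j(k)$ and $E_j^+=\max_{k\in[-\pi,\pi]}E_j(k)$. A pair $(k^*,E^*)$ is a Dirac point if for some $j\ge1$ and $\alpha>0$ one has $E_j(k)=E^*-\alpha|k-k^*|+O((k-k^*)^2)$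 and $E_{j+1}(k)=E^*+\alpha|k-k^*|+O((k-k^*)^2)$ near $k^*$, and the space of Bloch solutions for $(k^*,E^*)$ is two-dimensional. *Bloch modes and Zak phase.* Let $(u,v)_X=\int_0^1\varepsilon u\bar v\,dx$, with norm $\|\cdot\|_X$. For $k\in[0,\pi]$ and $E=E_j(k)$ put $\phi_{j,k}=\psi_{E,2}(1)\,\psi_{E,1}+(e^{ik}-\psi_{E,1}(1))\,\psi_{E,2}$, and $\varphi_{j,k}=\phi_{j,k}/\|\phi_{j,k}\|_X$ if $\phi_{j,k}\not\equiv0$, $\varphi_{j,k}=i\psi_{E,2}/\|\psi_{E,2}\|_X$ otherwise; for $-\pi<k<0$ put $\varphi_{j,k}(x)=\varphi_{j,-k}(-x)$. Let $u_{j,k}(x)=e^{-ikx}\varphi_{j,k}(x)$ and denote by $\varphi_{j,0^\pm},\varphi_{j,(-\pi)^+},\varphi_{j,\pi^-}$ the one-sided limits in $k$. The Zak phase of the $j$-th band is, modulo $2\pi$, $$\theta_j=i\int_{-\pi}^0(\partial_ku_{j,k},u_{j,k})_X\,dk+i\int_0^\pi(\partial_ku_{j,k},u_{j,k})_X\,dk-\Im\ln(\varphi_{j,0^+},\varphi_{j,0^-})_X-\Im\ln(\varphi_{j,(-\pi)^+},\varphi_{j,\pi^-})_X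 ,$$ where $\Im\ln 0:=0$ (a vanishing inner product occurs at Dirac points, where the formal contributions of the two touching bands cancel). The bulk topological index of the $j$-th band is $$\gamma_j=(-1)^{j+\ell-1}\exp\Big(i\sum_{m=1}^j\theta_m\Big),$$ where $\ell$ is the number of Dirac points $(k^*,E^*)$ with $k^*\in[0,\pi]$ below the $j$-th band, i.e. with $E^*\le E_j^-$. *Impedance functions.* For $E$ in an open gap $(E_j^+,E_{j+1}^-)$ one has $|D(E)|>2$; let $\lambda_{E,1},\lambda_{E,2}$ be the eigenvalues of the monodromy matrix, i.e. the roots of $\lambda^2-D(E)\lambda+1=0$, labelled so that $|\lambda_{E,1}|<1<|\lambda_{E,2}|$, and let $$\xi_R(E)=\frac{\psi_{E,2}(1)}{\lambda_{E,1}-\psi_{E,1}(1)},\qquad \xi_L(E)=\frac{\psi_{E,2}(1)}{\lambda_{E,2}-\psi_{E,1}(1)}.$$ **Theorem.** Let $\mathcal L_1,\mathcal L_2$ be two such operators, with coefficients $(\varepsilon_1,\mu_1)$ and $(\varepsilon_2,\mu_2)$; quantities associated with $\mathcal L_i$ carry the superscript $(i)$. Let $m_1,m_2\ge1$ be integers such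 that $$I:=\big(E^{(1),+}_{m_1},E^{(1),-}_{m_1+1}\big)\cap\big(E^{(2),+}_{m_2},E^{(2),-}_{m_2+1}\big)\neq\emptyset\quad\text{and}\quad \gamma^{(1)}_{m_1}\ne\gamma^{(2)}_{m_2}.$$ Let $\mathcal A$ be the joined operator, equal to $\mathcal L_1$ for $x<0$ and to $\mathcal L_2$ for $x>0$. An interface mode of energy $E\in\mathbf R$ is a nonzero $\psi\in L^2(\mathbf R)$ with $\mathcal A\psi=E\psi$ (with $\psi$ and its flux continuous also at $x=0$). Then $\mathcal A$ has an interface mode with energy in $I$. Moreover, an energy $E\in I$ carries an interface mode if and only if $$\xi_L^{(1)}(E)-\xi_R^{(2)}(E)=0 ,$$ in which case the interface mode of energy $E$ is unique up to a constant factor; so the number of interface modes (up to constant factors) with energy in $I$ equals the number of roots of this equation in $I$. -/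

import Mathlib

open Real Set Filter Topology MeasureTheory

noncomputable section

namespace Photonic

/-! ### Coefficients and the differential equation -/

/-- `f` has period one and is piecewise continuous: in a period it is continuous off a finite set,
and it has finite one-sided limits at every point. -/
structure IsPiecewiseContinuousPeriodic (f : ℝ → ℝ) : Prop where
  periodic : Function.Periodic f 1
  finite_jumps : ∃ S : Finset ℝ, ∀ x ∈ Icc (0 : ℝ) 1, x ∉ S → ContinuousAt f x
  left_limit : ∀ x, ∃ l, Tendsto f (𝓝[<] x) (𝓝 l)
  right_limit : ∀ x, ∃ l, Tendsto f (𝓝[>] x) (𝓝 l)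

/-- A permittivity or permeability of a periodic, time-reversal symmetric (real-valued) and
inversion-symmetric structure. -/
structure IsSymmetricCoefficient (f : ℝ → ℝ) : Prop extends IsPiecewiseContinuousPeriodic f where
  pos : ∀ x, 0 < f x
  inversion : ∀ x, f x = f (1 - x)

/-- `u` solves `-(1/ε) ((1/μ) u')' = E u` on the whole line and `p` is its flux `(1/μ) u'`.
As usual for Sturm-Liouville operators, `u` and the flux are continuous also where the coefficients
jump, and the first-order system `u' = μ p`, `p' = -E ε u` holds in integrated form. -/
structure IsSolution {F : Type*} [NormedAddCommGroup F] [NormedSpace ℝ F]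
    (ε μ : ℝ → ℝ) (E : ℝ) (u p : ℝ → F) : Prop where
  continuous_fst : Continuous u
  continuous_flux : Continuous p
  fst_eq : ∀ x, u x = u 0 + ∫ t in (0 : ℝ)..x, μ t • p t
  flux_eq : ∀ x, p x = p 0 - ∫ t in (0 : ℝ)..x, (E * ε t) • u t

/-- The unique real solution, together with its flux, with `u 0 = a` and `((1/μ) u') 0 = b`. -/
def cauchySolution (ε μ : ℝ → ℝ) (E a b : ℝ) : (ℝ → ℝ) × (ℝ → ℝ) :=
  Classical.epsilon fun q => IsSolution ε μ E q.1 q.2 ∧ q.1 0 = a ∧ q.2 0 = b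

/-- The fundamental solution `ψ_{E,1}`. -/
def psi1 (ε μ : ℝ → ℝ) (E : ℝ) : ℝ → ℝ := (cauchySolution ε μ E 1 0).1

/-- The fundamental solution `ψ_{E,2}`. -/
def psi2 (ε μ : ℝ → ℝ) (E : ℝ) : ℝ → ℝ := (cauchySolution ε μ E 0 1).1

/-- The flux `(1/μ) ψ_{E,2}'`. -/
def flux2 (ε μ : ℝ → ℝ) (E : ℝ) : ℝ → ℝ := (cauchySolution ε μ E 0 1).2

/-- The discriminant `D(E)`, the trace of the monodromy matrix. -/
def discriminant (ε μ : ℝ → ℝ) (E : ℝ) : ℝ := psi1 ε μ E 1 + flux2 ε μ E 1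

/-! ### Bands -/

/-- `u` is a solution of the Floquet-Bloch problem with wavenumber `k` and energy `E`
(the zero function included). -/
def IsBlochSolution (ε μ : ℝ → ℝ) (k E : ℝ) (u : ℝ → ℂ) : Prop :=
  (∃ p : ℝ → ℂ, IsSolution ε μ E u p) ∧ ∀ x, u (x + 1) = Complex.exp (Complex.I * k) * u x

/-- `E_j(k)`: the `j`-th eigenvalue, `j = 1, 2, …`, counted with multiplicity, of the Floquet-Bloch
problem, i.e. the least `E` such that the eigenfunctions with eigenvalues at most `E` span a space
of dimension at least `j`. -/
def bandEnergy (ε μ : ℝ → ℝ) (j : ℕ) (k : ℝ) : ℝ :=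
  sInf {E : ℝ | (j : Cardinal) ≤
    Module.rank ℂ (Submodule.span ℂ {u : ℝ → ℂ | ∃ E' ≤ E, IsBlochSolution ε μ k E' u})}

/-- The lower band edge `E_j^-`, the minimum of `E_j` over the Brillouin zone. -/
def bandMin (ε μ : ℝ → ℝ) (j : ℕ) : ℝ := sInf (bandEnergy ε μ j '' Icc (-π) π)

/-- The upper band edge `E_j^+`, the maximum of `E_j` over the Brillouin zone. -/
def bandMax (ε μ : ℝ → ℝ) (j : ℕ) : ℝ := sSup (bandEnergy ε μ j '' Icc (-π) π)

/-- The interval `(E_j^+, E_{j+1}^-)`. -/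
def bandGap (ε μ : ℝ → ℝ) (j : ℕ) : Set ℝ := Ioo (bandMax ε μ j) (bandMin ε μ (j + 1))

/-- `(k₀, E₀)` is a Dirac point: two consecutive bands touch there linearly, and the space of Bloch
modes is two-dimensional. -/
def IsDiracPoint (ε μ : ℝ → ℝ) (k₀ E₀ : ℝ) : Prop :=
  (∃ j : ℕ, 1 ≤ j ∧ bandEnergy ε μ j k₀ = E₀ ∧ bandEnergy ε μ (j + 1) k₀ = E₀ ∧
    ∃ α > 0, ∃ δ > 0, ∃ C : ℝ, ∀ k, |k - k₀| < δ →
      |bandEnergy ε μ j k - (E₀ - α * |k - k₀|)| ≤ C * (k - k₀) ^ 2 ∧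
      |bandEnergy ε μ (j + 1) k - (E₀ + α * |k - k₀|)| ≤ C * (k - k₀) ^ 2) ∧
  Module.rank ℂ (Submodule.span ℂ {u : ℝ → ℂ | IsBlochSolution ε μ k₀ E₀ u}) = 2

/-- The number of Dirac points below the `j`-th band (one at its lower edge counts), with
wavenumber in the reduced Brillouin zone `[0, π]`, so that `-π` and `π` are not counted twice. -/
def numDiracBelow (ε μ : ℝ → ℝ) (j : ℕ) : ℕ :=
  {q : ℝ × ℝ | q.1 ∈ Icc 0 π ∧ IsDiracPoint ε μ q.1 q.2 ∧ q.2 ≤ bandMin ε μ j}.ncard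

/-! ### Bloch modes, Zak phase and bulk index -/

/-- The inner product `∫₀¹ ε u v̄`. -/
def cellInner (ε : ℝ → ℝ) (u v : ℝ → ℂ) : ℂ :=
  ∫ x in (0 : ℝ)..1, (ε x : ℂ) * (u x * (starRingEnd ℂ) (v x))

/-- The norm of `cellInner`. -/
def cellNorm (ε : ℝ → ℝ) (u : ℝ → ℂ) : ℝ := √(cellInner ε u u).re

/-- `φ_{j,k} = ψ_{E,2}(1) ψ_{E,1} + (e^{ik} - ψ_{E,1}(1)) ψ_{E,2}` with `E = E_j(k)`. -/
def rawMode (ε μ : ℝ → ℝ) (j : ℕ) (k : ℝ) : ℝ → ℂ := fun x =>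
  (psi2 ε μ (bandEnergy ε μ j k) 1 : ℂ) * psi1 ε μ (bandEnergy ε μ j k) x +
    (Complex.exp (Complex.I * k) - psi1 ε μ (bandEnergy ε μ j k) 1) *
      psi2 ε μ (bandEnergy ε μ j k) x

open Classical in
/-- The normalized Bloch mode for `0 ≤ k ≤ π`. -/
def halfZoneMode (ε μ : ℝ → ℝ) (j : ℕ) (k : ℝ) : ℝ → ℂ :=
  if rawMode ε μ j k ≠ 0 then
    fun x => rawMode ε μ j k x / cellNorm ε (rawMode ε μ j k)
  else
    fun x => Complex.I * psi2 ε μ (bandEnergy ε μ j k) x /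
      cellNorm ε (fun y => (psi2 ε μ (bandEnergy ε μ j k) y : ℂ))

/-- The normalized Bloch mode `φ_{j,k}(x)` for `-π < k ≤ π`; the negative half of the zone is
obtained by inversion. -/
def blochMode (ε μ : ℝ → ℝ) (j : ℕ) (k x : ℝ) : ℂ :=
  if 0 ≤ k then halfZoneMode ε μ j k x else halfZoneMode ε μ j (-k) (-x)

/-- The periodic part `u_{j,k}(x) = e^{-ikx} φ_{j,k}(x)`. -/
def periodicPart (ε μ : ℝ → ℝ) (j : ℕ) (k x : ℝ) : ℂ :=
  blochMode ε μ j k x * Complex.exp (-(Complex.I * k * x))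

/-- The one-sided limit of `φ_{j,k}(x)` as `k` approaches a point through the filter `l`. -/
def edgeMode (ε μ : ℝ → ℝ) (j : ℕ) (l : Filter ℝ) (x : ℝ) : ℂ :=
  limUnder l fun k => blochMode ε μ j k x

/-- The phase `-Im ln z` of a jump. At a Dirac point the two one-sided limits of the Bloch mode
of each of the two touching bands are orthogonal (`z = 0`); the formal contributions
`-Im ln z` and `-Im ln z̄` of the two bands cancel, and each is given the value zero. -/
def jumpPhase (z : ℂ) : ℝ := if z = 0 then 0 else -(Complex.log z).im

/-- The Berry connection `(∂_k u_{j,k}, u_{j,k})`. -/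
def berryConnection (ε μ : ℝ → ℝ) (j : ℕ) (k : ℝ) : ℂ :=
  cellInner ε (fun x => deriv (fun κ => periodicPart ε μ j κ x) k) (periodicPart ε μ j k)

/-- The Zak phase `θ_j` (a representative of its class modulo `2π`). The jumps of the phase at
`k = 0` and between `k = π` and `k = -π` are those of the Bloch modes `φ_{j,k}`: it is `φ_{j,k}`, not
its periodic part, whose values at `k = π` and `k = -π` solve the same Floquet-Bloch problem. -/
def zakPhase (ε μ : ℝ → ℝ) (j : ℕ) : ℂ :=
  Complex.I * (∫ k in (-π)..0, berryConnection ε μ j k) +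
    Complex.I * (∫ k in (0 : ℝ)..π, berryConnection ε μ j k) +
    jumpPhase (cellInner ε (edgeMode ε μ j (𝓝[>] 0)) (edgeMode ε μ j (𝓝[<] 0))) +
    jumpPhase (cellInner ε (edgeMode ε μ j (𝓝[>] (-π))) (edgeMode ε μ j (𝓝[<] π)))

/-- The bulk topological index `γ_j = (-1)^{j+ℓ-1} exp (i (θ_1 + … + θ_j))`, where `ℓ` is the number
of Dirac points below the `j`-th band. -/
def bulkIndex (ε μ : ℝ → ℝ) (j : ℕ) : ℂ :=
  (-1) ^ (j + numDiracBelow ε μ j - 1) *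
    Complex.exp (Complex.I * ∑ m ∈ Finset.Icc 1 j, zakPhase ε μ m)

/-! ### Impedance functions in a gap -/

/-- In a gap, the eigenvalue `λ_{E,1}` of the monodromy matrix with `|λ_{E,1}| < 1`. -/
def lambda1 (ε μ : ℝ → ℝ) (E : ℝ) : ℝ :=
  if 0 < discriminant ε μ E then (discriminant ε μ E - √(discriminant ε μ E ^ 2 - 4)) / 2
  else (discriminant ε μ E + √(discriminant ε μ E ^ 2 - 4)) / 2

/-- In a gap, the eigenvalue `λ_{E,2}` of the monodromy matrix with `|λ_{E,2}| > 1`. -/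
def lambda2 (ε μ : ℝ → ℝ) (E : ℝ) : ℝ :=
  if 0 < discriminant ε μ E then (discriminant ε μ E + √(discriminant ε μ E ^ 2 - 4)) / 2
  else (discriminant ε μ E - √(discriminant ε μ E ^ 2 - 4)) / 2

/-- The impedance function `ξ_R`. -/
def xiR (ε μ : ℝ → ℝ) (E : ℝ) : ℝ := psi2 ε μ E 1 / (lambda1 ε μ E - psi1 ε μ E 1)

/-- The impedance function `ξ_L`. -/
def xiL (ε μ : ℝ → ℝ) (E : ℝ) : ℝ := psi2 ε μ E 1 / (lambda2 ε μ E - psi1 ε μ E 1)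

/-! ### The joined structure -/

/-- The coefficient equal to `f` on the left and to `g` on the right half-line. -/
def joined (f g : ℝ → ℝ) (x : ℝ) : ℝ := if x < 0 then f x else g x

/-- `u` is an interface mode with energy `E` of the joined structure: a nonzero `L²` solution. -/
def IsInterfaceMode (ε₁ μ₁ ε₂ μ₂ : ℝ → ℝ) (E : ℝ) (u : ℝ → ℂ) : Prop :=
  u ≠ 0 ∧ MemLp u 2 volume ∧
    ∃ p : ℝ → ℂ, IsSolution (joined ε₁ ε₂) (joined μ₁ μ₂) E u p

end Photonic

end

/-! Inversion symmetry makes the diagonal entries of the monodromy matrix equal (`flux2_one`), so it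
has rows (a, b) and (c, a) with a² - bc = 1 and D = 2a; here a, b, c are `monoA`, `monoB`, `monoC`.
Hence bc < 0 where |a| < 1, bc > 0 where |a| > 1, and bc = 0 at band edges. The formula a' = (c
∫εψ₂² - b ∫εψ₁²)/2 shows that a is strictly monotone in each band and that two bands touch exactly
where b = c = 0. They touch linearly there, so the Dirac points are the closed gaps
(`numDiracBelow_eq`). At an edge of an open gap exactly one of b, c vanishes, and the Bloch mode is
the even function ψ₁ if c = 0, the odd function ψ₂ if b = 0. The signs of b and c are known in the
bands, and neither vanishes in a gap; following them in from both sides shows that the two edges of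
an open gap have opposite parities (`edgeSign_mul_edgeSign`).

The Bloch mode is a positive multiple of bψ₁ + i sin k ψ₂ inside the half zone. Normalization makes
the Berry connection imaginary and inversion makes it real, so it vanishes
(`berryConnection_eq_zero`). Only the jumps at k = 0 and k = π contribute to the Zak phase. Each is
the phase of the overlap of a band-edge mode with its mirror image, 1 for an even and -1 for an odd
mode, so exp(iθ_j) is the product of the parities at the two edges of band j (`exp_zakPhase`). In
the product over j ≤ m every open gap gives -1, every closed gap 1, and the bottom of the spectrum,
E = 0, is even. The prefactor of the bulk index cancels these signs and leaves the parity at the top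
of band m (`bulkIndex_eq`).

In a gap the solutions that are square integrable at +∞ or -∞ are those whose ratio of value to flux
at 0 is ξ_R or ξ_L. An interface mode is a matching of the two ratios (`isInterfaceMode_iff`), which
gives the root criterion, uniqueness and the count. For existence, ξ_L = -ξ_R and ξ_R² = b/c, while
the sign of ξ_R is constant in the gap and fixed by the parity at its lower edge. If the indices
differ, ξ_L of the left medium and ξ_R of the right one have the same sign throughout I, so only
their squares have to meet. The function b₁c₂ - b₂c₁ has opposite signs at the two ends of I,
because each end is an edge of one of the gaps and one of the two products vanishes there
(`exists_xiR_eq_neg`).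

No asymptotics in E are needed to produce bands: the gap above band m is not empty, and this alone
forces the first m + 1 bands to exist (`exists_chain_of_gap`). -/

noncomputable section

namespace Photonic

/-! ### Coefficients that are bounded and continuous off a countable set -/

/-- `f` is bounded and continuous off a countable set. -/
structure IsTame (f : ℝ → ℝ) : Prop where
  bounded : ∃ C, ∀ x, |f x| ≤ C
  continuousAt : ∃ S : Set ℝ, S.Countable ∧ ∀ x ∉ S, ContinuousAt f x

section Tame

variable {F : Type*} [NormedAddCommGroup F] [NormedSpace ℝ F] {f g : ℝ → ℝ}

theorem IsTame.aestronglyMeasurable (hf : IsTame f) : AEStronglyMeasurable f volume := by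
  obtain ⟨S, hS, h⟩ := hf.continuousAt
  have hc : ContinuousOn f Sᶜ := fun x hx => (h x hx).continuousWithinAt
  have h1 := hc.aestronglyMeasurable (μ := volume) hS.measurableSet.compl
  have h2 : volume.restrict Sᶜ = (volume : Measure ℝ) := by
    apply Measure.restrict_eq_self_of_ae_mem
    exact (compl_mem_ae_iff.2 (hS.measure_zero volume))
  rwa [h2] at h1

theorem IsTame.intervalIntegrable_smul (hf : IsTame f) {u : ℝ → F} (hu : Continuous u) (a b : ℝ) :
    IntervalIntegrable (fun t => f t • u t) volume a b := by
  obtain ⟨C, hC⟩ := hf.bounded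
  have h := (hu.intervalIntegrable (μ := volume) a b)
  rw [intervalIntegrable_iff] at h ⊢
  exact h.bdd_smul C hf.aestronglyMeasurable.restrict (Eventually.of_forall hC)

theorem IsTame.intervalIntegrable_mul (hf : IsTame f) {u : ℝ → ℝ} (hu : Continuous u) (a b : ℝ) :
    IntervalIntegrable (fun t => f t * u t) volume a b :=
  hf.intervalIntegrable_smul hu a b

theorem IsTame.mul (hf : IsTame f) (hg : IsTame g) : IsTame fun x => f x * g x := by
  obtain ⟨C, hC⟩ := hf.bounded
  obtain ⟨C', hC'⟩ := hg.bounded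
  obtain ⟨S, hS, h⟩ := hf.continuousAt
  obtain ⟨S', hS', h'⟩ := hg.continuousAt
  refine ⟨⟨C * C', fun x => ?_⟩, S ∪ S', hS.union hS', fun x hx => ?_⟩
  · rw [abs_mul]
    exact mul_le_mul (hC x) (hC' x) (abs_nonneg _) ((abs_nonneg _).trans (hC x))
  · exact (h x fun hh => hx (Or.inl hh)).mul (h' x fun hh => hx (Or.inr hh))

theorem IsTame.const_mul (hf : IsTame f) (c : ℝ) : IsTame fun x => c * f x :=
  IsTame.mul ⟨⟨|c|, fun _ => le_rfl⟩, ∅, countable_empty, fun _ _ => continuousAt_const⟩ hf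

theorem IsTame.continuous_primitive (hf : IsTame f) {u : ℝ → F} (hu : Continuous u) :
    Continuous fun x => ∫ t in (0 : ℝ)..x, f t • u t :=
  intervalIntegral.continuous_primitive (hf.intervalIntegrable_smul hu) 0

theorem IsTame.hasDerivAt_primitive [CompleteSpace F] (hf : IsTame f) {u : ℝ → F}
    (hu : Continuous u) {x : ℝ} (hx : ContinuousAt f x) :
    HasDerivAt (fun x => ∫ t in (0 : ℝ)..x, f t • u t) (f x • u x) x := by
  refine intervalIntegral.integral_hasDerivAt_right (hf.intervalIntegrable_smul hu 0 x) ?_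
    (hx.smul hu.continuousAt)
  exact (hf.aestronglyMeasurable.smul hu.aestronglyMeasurable).stronglyMeasurableAtFilter

theorem IsTame.joined (hf : IsTame f) (hg : IsTame g) : IsTame (joined f g) := by
  obtain ⟨C, hC⟩ := hf.bounded
  obtain ⟨C', hC'⟩ := hg.bounded
  obtain ⟨S, hS, h⟩ := hf.continuousAt
  obtain ⟨S', hS', h'⟩ := hg.continuousAt
  refine ⟨⟨max C C', fun x => ?_⟩, insert 0 (S ∪ S'), (hS.union hS').insert 0, fun x hx => ?_⟩
  · unfold Photonic.joined
    split_ifs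
    exacts [(hC x).trans (le_max_left _ _), (hC' x).trans (le_max_right _ _)]
  · simp only [mem_insert_iff, mem_union, not_or] at hx
    rcases lt_or_gt_of_ne hx.1 with h0 | h0
    · refine (h x hx.2.1).congr ?_
      filter_upwards [Iio_mem_nhds h0] with y hy
      simp [Photonic.joined, show y < 0 from hy]
    · refine (h' x hx.2.2).congr ?_
      filter_upwards [Ioi_mem_nhds h0] with y hy
      simp [Photonic.joined, not_lt.2 (le_of_lt (show 0 < y from hy))]

/-- One-sided limits bound the function on a punctured neighbourhood of each point, the value at the
point is added by hand, and compactness makes the bound uniform. -/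
theorem exists_bound_Icc_of_one_sided_limits (hl : ∀ x, ∃ l, Tendsto f (𝓝[<] x) (𝓝 l))
    (hr : ∀ x, ∃ l, Tendsto f (𝓝[>] x) (𝓝 l)) (a b : ℝ) : ∃ C, ∀ x ∈ Icc a b, |f x| ≤ C := by
  refine isCompact_Icc.induction_on (p := fun s => ∃ C, ∀ x ∈ s, |f x| ≤ C) ⟨0, by simp⟩
    (fun s t hst ⟨C, hC⟩ => ⟨C, fun x hx => hC x (hst hx)⟩)
    (fun s t ⟨C, hC⟩ ⟨C', hC'⟩ => ⟨max C C', ?_⟩) fun x _ => ?_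
  · rintro x (hx | hx)
    exacts [(hC x hx).trans (le_max_left _ _), (hC' x hx).trans (le_max_right _ _)]
  · obtain ⟨l, hl⟩ := hl x
    obtain ⟨r, hr⟩ := hr x
    have h1 : ∀ᶠ y in 𝓝[<] x, |f y| ≤ |l| + 1 :=
      (hl.abs.eventually (gt_mem_nhds (lt_add_one _))).mono fun _ h => le_of_lt h
    have h2 : ∀ᶠ y in 𝓝[>] x, |f y| ≤ |r| + 1 :=
      (hr.abs.eventually (gt_mem_nhds (lt_add_one _))).mono fun _ h => le_of_lt h
    rw [eventually_nhdsWithin_iff] at h1 h2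
    refine ⟨_, mem_nhdsWithin_of_mem_nhds (h1.and h2),
      max (|f x|) (max (|l| + 1) (|r| + 1)), fun y hy => ?_⟩
    rcases lt_trichotomy y x with h | h | h
    · exact (hy.1 h).trans ((le_max_left _ _).trans (le_max_right _ _))
    · rw [h]; exact le_max_left _ _
    · exact (hy.2 h).trans ((le_max_right _ _).trans (le_max_right _ _))

/-- Boundedness and a countable set of jumps are all that the differential equation needs; unlike
periodicity they survive in the joined structure. -/
theorem IsPiecewiseContinuousPeriodic.isTame (hf : IsPiecewiseContinuousPeriodic f) :
    IsTame f := by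
  obtain ⟨C, hC⟩ := exists_bound_Icc_of_one_sided_limits hf.left_limit hf.right_limit 0 1
  obtain ⟨S, hS⟩ := hf.finite_jumps
  refine ⟨⟨C, fun x => ?_⟩, ⋃ n : ℤ, (fun y => y + n) '' (S : Set ℝ),
    countable_iUnion fun n => (S.finite_toSet.image _).countable, fun x hx => ?_⟩
  · have h := hf.periodic.sub_zsmul_eq ⌊x⌋ (x := x)
    rw [← h]
    refine hC _ ⟨?_, ?_⟩
    · simp
    · have := (Int.lt_floor_add_one x).le
      simp only [zsmul_eq_mul, mul_one]; linarith
  · have h : f = fun y => f (y - ⌊x⌋) := by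
      funext y
      have h := hf.periodic.sub_zsmul_eq ⌊x⌋ (x := y)
      simpa using h.symm
    have hx' : x - ⌊x⌋ ∉ S := by
      intro h
      exact hx (mem_iUnion.2 ⟨⌊x⌋, _, h, by simp⟩)
    have h3 := hS (x - ⌊x⌋) ⟨by linarith [Int.floor_le x], by linarith [Int.lt_floor_add_one x]⟩ hx'
    rw [h]
    exact ContinuousAt.comp (f := fun y => y - (⌊x⌋ : ℝ)) h3 (by fun_prop)

/-- A continuous function with derivative `f'` off a countable set is a primitive of `f'`. -/
theorem eq_add_integral_of_hasDerivAt_off_countable [CompleteSpace F] {u u' : ℝ → F}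
    {S : Set ℝ} (hS : S.Countable) (hu : Continuous u) (h : ∀ x ∉ S, HasDerivAt u (u' x) x)
    (hi : ∀ x, IntervalIntegrable u' volume 0 x) (x : ℝ) :
    u x = u 0 + ∫ t in (0 : ℝ)..x, u' t := by
  rw [integral_eq_of_hasDerivAt_off_countable u u' hS hu.continuousOn (fun y hy => h y hy.2) (hi x)]
  abel

/-- If the integral of a positive weight against a continuous function vanishes identically, so
does the function. -/
theorem eq_zero_of_primitive_eq_zero [CompleteSpace F] (hf : IsTame f) (hpos : ∀ x, 0 < f x)
    {u : ℝ → F} (hu : Continuous u) (h : ∀ x, ∫ t in (0 : ℝ)..x, f t • u t = 0) : u = 0 := by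
  obtain ⟨S, hS, hc⟩ := hf.continuousAt
  have hd : Dense Sᶜ := hS.dense_compl ℝ
  refine Continuous.ext_on hd hu continuous_const fun x hx => ?_
  have h1 := hf.hasDerivAt_primitive hu (hc x hx)
  simp only [h] at h1
  have h2 := h1.unique (hasDerivAt_const x (0 : F))
  exact (smul_eq_zero.1 h2).resolve_left (hpos x).ne'

end Tame

/-! ### Solutions in differential form -/

section Solution

variable {F : Type*} [NormedAddCommGroup F] [NormedSpace ℝ F] [CompleteSpace F]
  {ε μ : ℝ → ℝ} {E : ℝ} {u p v q : ℝ → F}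

/-- Off a countable set the integrated system becomes a pair of derivatives. Sums, translations and
reflections of solutions then reduce to rules of differentiation, and `IsSolution.of_hasDerivAt`
leads back. -/
theorem IsSolution.exists_hasDerivAt (hε : IsTame ε) (hμ : IsTame μ) (h : IsSolution ε μ E u p) :
    ∃ S : Set ℝ, S.Countable ∧
      ∀ x ∉ S, HasDerivAt u (μ x • p x) x ∧ HasDerivAt p (-((E * ε x) • u x)) x := by
  obtain ⟨S, hS, h1⟩ := hε.continuousAt
  obtain ⟨S', hS', h2⟩ := hμ.continuousAt
  refine ⟨S ∪ S', hS.union hS', fun x hx => ⟨?_, ?_⟩⟩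
  · rw [show u = fun x => u 0 + ∫ t in (0 : ℝ)..x, μ t • p t from funext h.fst_eq]
    exact (hμ.hasDerivAt_primitive h.continuous_flux (h2 x fun hh => hx (Or.inr hh))).const_add _
  · have h3 : HasDerivAt (fun x => p 0 - ∫ t in (0 : ℝ)..x, (E * ε t) • u t)
        (-((E * ε x) • u x)) x :=
      ((hε.const_mul E).hasDerivAt_primitive h.continuous_fst
        (continuousAt_const.mul (h1 x fun hh => hx (Or.inl hh)))).const_sub _
    rwa [← show p = fun x => p 0 - ∫ t in (0 : ℝ)..x, (E * ε t) • u t from funext h.flux_eq] at h3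

theorem IsSolution.of_hasDerivAt (hε : IsTame ε) (hμ : IsTame μ) (hu : Continuous u)
    (hp : Continuous p) {S : Set ℝ} (hS : S.Countable)
    (h : ∀ x ∉ S, HasDerivAt u (μ x • p x) x ∧ HasDerivAt p (-((E * ε x) • u x)) x) :
    IsSolution ε μ E u p where
  continuous_fst := hu
  continuous_flux := hp
  fst_eq := eq_add_integral_of_hasDerivAt_off_countable hS hu (fun x hx => (h x hx).1)
    (hμ.intervalIntegrable_smul hp 0)
  flux_eq x := by
    rw [eq_add_integral_of_hasDerivAt_off_countable hS hp (fun x hx => (h x hx).2)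
      (fun x => ((hε.const_mul E).intervalIntegrable_smul hu 0 x).neg) x,
      intervalIntegral.integral_neg, sub_eq_add_neg]

theorem IsSolution.add (hε : IsTame ε) (hμ : IsTame μ) (h : IsSolution ε μ E u p)
    (h' : IsSolution ε μ E v q) : IsSolution ε μ E (u + v) (p + q) := by
  obtain ⟨S, hS, h1⟩ := h.exists_hasDerivAt hε hμ
  obtain ⟨S', hS', h2⟩ := h'.exists_hasDerivAt hε hμ
  refine IsSolution.of_hasDerivAt hε hμ (h.continuous_fst.add h'.continuous_fst)
    (h.continuous_flux.add h'.continuous_flux) (hS.union hS') fun x hx => ?_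
  have h1 := h1 x fun hh => hx (Or.inl hh)
  have h2 := h2 x fun hh => hx (Or.inr hh)
  refine ⟨?_, ?_⟩
  · simpa [smul_add] using h1.1.add h2.1
  · have := h1.2.add h2.2
    rw [← neg_add, ← smul_add] at this
    exact this

theorem IsSolution.clm_comp {G : Type*} [NormedAddCommGroup G] [NormedSpace ℝ G] [CompleteSpace G]
    (hε : IsTame ε) (hμ : IsTame μ) (h : IsSolution ε μ E u p) (T : F →L[ℝ] G) :
    IsSolution ε μ E (fun x => T (u x)) (fun x => T (p x)) := by
  obtain ⟨S, hS, h1⟩ := h.exists_hasDerivAt hε hμ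
  refine IsSolution.of_hasDerivAt hε hμ (T.continuous.comp h.continuous_fst)
    (T.continuous.comp h.continuous_flux) hS fun x hx => ?_
  have h1 := h1 x hx
  refine ⟨?_, ?_⟩
  · simpa [Function.comp_def] using T.hasFDerivAt.comp_hasDerivAt x h1.1
  · simpa [Function.comp_def] using T.hasFDerivAt.comp_hasDerivAt x h1.2

theorem IsSolution.comp_add_one (hε : IsTame ε) (hμ : IsTame μ) (hε1 : Function.Periodic ε 1)
    (hμ1 : Function.Periodic μ 1) (h : IsSolution ε μ E u p) :
    IsSolution ε μ E (fun x => u (x + 1)) (fun x => p (x + 1)) := by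
  obtain ⟨S, hS, h1⟩ := h.exists_hasDerivAt hε hμ
  refine IsSolution.of_hasDerivAt hε hμ (h.continuous_fst.comp (by fun_prop))
    (h.continuous_flux.comp (by fun_prop)) (S := (fun x => x + 1) ⁻¹' S)
    (hS.preimage (add_left_injective 1)) fun x hx => ?_
  have h1 := h1 (x + 1) hx
  rw [hε1, hμ1] at h1
  exact ⟨h1.1.comp_add_const x 1, h1.2.comp_add_const x 1⟩

theorem IsSolution.comp_neg (hε : IsTame ε) (hμ : IsTame μ) (hε1 : ∀ x, ε (-x) = ε x)
    (hμ1 : ∀ x, μ (-x) = μ x) (h : IsSolution ε μ E u p) :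
    IsSolution ε μ E (fun x => u (-x)) (fun x => -p (-x)) := by
  obtain ⟨S, hS, h1⟩ := h.exists_hasDerivAt hε hμ
  refine IsSolution.of_hasDerivAt hε hμ (h.continuous_fst.comp (by fun_prop))
    (h.continuous_flux.comp (by fun_prop)).neg (S := (fun x => -x) ⁻¹' S)
    (hS.preimage neg_injective) fun x hx => ?_
  have h1 := h1 (-x) hx
  rw [hε1, hμ1] at h1
  refine ⟨?_, ?_⟩
  · simpa [Function.comp_def] using h1.1.scomp x (hasDerivAt_neg x)
  · simpa [Function.comp_def] using (h1.2.scomp x (hasDerivAt_neg x)).fun_neg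

/-- Lagrange's identity, integrated. -/
theorem IsSolution.wronskian_eq {𝕜 : Type*} [NormedRing 𝕜] [NormedAlgebra ℝ 𝕜] [CompleteSpace 𝕜]
    {u p v q : ℝ → 𝕜} {E' : ℝ} (hε : IsTame ε) (hμ : IsTame μ)
    (h : IsSolution ε μ E u p) (h' : IsSolution ε μ E' v q) (x : ℝ) :
    u x * q x - p x * v x = u 0 * q 0 - p 0 * v 0 +
      (E - E') • ∫ t in (0 : ℝ)..x, ε t • (u t * v t) := by
  obtain ⟨S, hS, h1⟩ := h.exists_hasDerivAt hε hμ
  obtain ⟨S', hS', h2⟩ := h'.exists_hasDerivAt hε hμ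
  have huv := h.continuous_fst.mul h'.continuous_fst
  have h3 := eq_add_integral_of_hasDerivAt_off_countable (hS.union hS')
    (u := fun x => u x * q x - p x * v x) (u' := fun t => (E - E') • (ε t • (u t * v t)))
    ((h.continuous_fst.mul h'.continuous_flux).sub (h.continuous_flux.mul h'.continuous_fst))
    (fun y hy => ?_) (fun x => (hε.intervalIntegrable_smul huv 0 x).smul (E - E')) x
  · rw [h3, intervalIntegral.integral_smul]
  · have h1 := h1 y fun hh => hy (Or.inl hh)
    have h2 := h2 y fun hh => hy (Or.inr hh)
    refine ((h1.1.fun_mul h2.2).fun_sub (h1.2.fun_mul h2.1)).congr_deriv ?_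
    simp only [smul_mul_assoc, mul_smul_comm, mul_neg, neg_mul, smul_smul]
    rw [sub_mul, sub_smul]
    abel

theorem IsSolution.flux_unique (hμ : IsTame μ) (hpos : ∀ x, 0 < μ x)
    {E' : ℝ} (h : IsSolution ε μ E u p) (h' : IsSolution ε μ E' u q) : p = q := by
  rw [← sub_eq_zero]
  refine eq_zero_of_primitive_eq_zero hμ hpos (h.continuous_flux.sub h'.continuous_flux)
    fun x => ?_
  simp only [Pi.sub_apply, smul_sub]
  rw [intervalIntegral.integral_sub (hμ.intervalIntegrable_smul h.continuous_flux 0 x)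
    (hμ.intervalIntegrable_smul h'.continuous_flux 0 x)]
  have h1 := h.fst_eq x
  rw [h'.fst_eq x] at h1
  exact sub_eq_zero.2 (add_left_cancel h1).symm

/-- A function that solves the equation for two energies vanishes. -/
theorem IsSolution.eq_zero_of_ne (hε : IsTame ε) (hμ : IsTame μ) (hεpos : ∀ x, 0 < ε x)
    (hμpos : ∀ x, 0 < μ x) {E' : ℝ} (hE : E ≠ E') (h : IsSolution ε μ E u p)
    (h' : IsSolution ε μ E' u q) : u = 0 := by
  obtain rfl := h.flux_unique hμ hμpos h'
  refine eq_zero_of_primitive_eq_zero hε hεpos h.continuous_fst fun x => ?_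
  have h1 := h.flux_eq x
  rw [h'.flux_eq x] at h1
  have h2 := (sub_right_inj.1 h1)
  simp only [mul_smul, intervalIntegral.integral_smul] at h2
  have h3 : (E' - E) • ∫ t in (0 : ℝ)..x, ε t • u t = 0 := by rw [sub_smul, h2, sub_self]
  exact (smul_eq_zero.1 h3).resolve_left (sub_ne_zero.2 hE.symm)

end Solution

/-! ### Existence of solutions: power series in the energy -/

/-- Measured against the weight exp(l|x|), integration gains a factor 1/l; a large l makes the
Picard iteration contract on the whole line. -/
theorem abs_integral_le_of_abs_le_exp {f : ℝ → ℝ} {K l : ℝ} (hl : 0 < l)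
    (h : ∀ s, |f s| ≤ K * exp (l * |s|)) (x : ℝ) :
    |∫ t in (0 : ℝ)..x, f t| ≤ K / l * exp (l * |x|) := by
  have hK : 0 ≤ K := by simpa using (abs_nonneg _).trans (h 0)
  have key : ∀ (g : ℝ → ℝ), (∀ s, |g s| ≤ K * exp (l * |s|)) → ∀ y, 0 ≤ y →
      |∫ t in (0 : ℝ)..y, g t| ≤ K / l * exp (l * y) := by
    intro g hg y hy
    have h1 : ∫ t in (0 : ℝ)..y, K * exp (l * t) = K / l * exp (l * y) - K / l := by
      have := integral_eq_of_hasDerivAt_off_countable (fun t => K / l * exp (l * t))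
        (fun t => K * exp (l * t)) (a := 0) (b := y) countable_empty (by fun_prop)
        (fun x _ => ?_) (Continuous.intervalIntegrable (by fun_prop) _ _)
      · simpa using this
      · have := ((hasDerivAt_id x).const_mul l).exp.const_mul (K / l)
        refine this.congr_deriv ?_
        simp
        field_simp
    have h2 : ‖∫ t in (0 : ℝ)..y, g t‖ ≤ ∫ t in (0 : ℝ)..y, K * exp (l * t) := by
      refine intervalIntegral.norm_integral_le_of_norm_le hy
        (Eventually.of_forall fun t ht => ?_) (Continuous.intervalIntegrable (by fun_prop) _ _)
      have := hg t
      rwa [abs_of_pos ht.1] at this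
    rw [h1] at h2
    have : 0 ≤ K / l := by positivity
    exact h2.trans (by linarith)
  rcases le_total 0 x with hx | hx
  · rw [abs_of_nonneg hx]
    exact key f h x hx
  · have h2 : ∫ t in (0 : ℝ)..x, f t = -∫ t in (0 : ℝ)..(-x), f (-t) := by
      rw [intervalIntegral.integral_comp_neg, neg_neg, neg_zero, intervalIntegral.integral_symm]
    rw [h2, abs_neg, abs_of_nonpos hx]
    exact key (fun t => f (-t)) (fun s => by simpa using h (-s)) (-x) (by linarith)

/-- The coefficients of the expansion in powers of `-E` of the solution, and of its flux, with
initial values `α` and `β`. -/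
def cauchyCoeff (ε μ : ℝ → ℝ) (α β : ℝ) : ℕ → (ℝ → ℝ) × (ℝ → ℝ)
  | 0 => (fun x => α + ∫ t in (0 : ℝ)..x, μ t * β, fun _ => β)
  | n + 1 =>
    (fun x => ∫ t in (0 : ℝ)..x, μ t *
      ∫ s in (0 : ℝ)..t, ε s * (cauchyCoeff ε μ α β n).1 s,
      fun x => ∫ s in (0 : ℝ)..x, ε s * (cauchyCoeff ε μ α β n).1 s)

section Series

variable {ε μ : ℝ → ℝ} (hε : IsTame ε) (hμ : IsTame μ) (α β : ℝ)
include hε hμ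

theorem continuous_cauchyCoeff (n : ℕ) :
    Continuous (cauchyCoeff ε μ α β n).1 ∧ Continuous (cauchyCoeff ε μ α β n).2 := by
  induction n with
  | zero =>
    exact ⟨continuous_const.add (hμ.continuous_primitive (u := fun _ => β) continuous_const),
      continuous_const⟩
  | succ n ih =>
    have h := hε.continuous_primitive ih.1
    exact ⟨hμ.continuous_primitive h, h⟩

/-- With l = C(1 + 2R) one integration against a coefficient costs the factor C/l ≤ 1, and R · C/l ≤
1/2. Every power of the energy thus gains a factor 1/2, uniformly for |E| ≤ R. -/
theorem exists_cauchyCoeff_bound (R : ℝ) (hR : 0 ≤ R) : ∃ l K : ℝ, 0 < l ∧ 0 ≤ K ∧ ∀ n x,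
    R ^ n * |(cauchyCoeff ε μ α β n).1 x| ≤ K * (1 / 2) ^ n * exp (l * |x|) ∧
    R ^ n * |(cauchyCoeff ε μ α β n).2 x| ≤ K * (1 / 2) ^ n * exp (l * |x|) := by
  obtain ⟨C1, hC1⟩ := hε.bounded
  obtain ⟨C2, hC2⟩ := hμ.bounded
  obtain ⟨C, hCpos, hεC, hμC⟩ : ∃ C : ℝ, 0 < C ∧ (∀ x, |ε x| ≤ C) ∧ ∀ x, |μ x| ≤ C :=
    ⟨max 1 (max C1 C2), lt_max_of_lt_left one_pos,
      fun x => (hC1 x).trans ((le_max_left _ _).trans (le_max_right _ _)),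
      fun x => (hC2 x).trans ((le_max_right _ _).trans (le_max_right _ _))⟩
  have hR1 : 0 < 1 + 2 * R := by linarith
  set l := C * (1 + 2 * R) with hl
  have hlpos : 0 < l := by positivity
  have hq : C / l = 1 / (1 + 2 * R) := by rw [hl]; field_simp
  have hq1 : C / l ≤ 1 := by rw [hq, div_le_one hR1]; linarith
  have hq2 : R * (C / l) ≤ 1 / 2 := by
    rw [hq, mul_one_div, div_le_iff₀ hR1]; linarith
  have step : ∀ (w f : ℝ → ℝ) (K : ℝ), (∀ x, |w x| ≤ C) → 0 ≤ K →
      (∀ s, |f s| ≤ K * exp (l * |s|)) → ∀ x, |∫ t in (0 : ℝ)..x, w t * f t| ≤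
        (C / l) * K * exp (l * |x|) := by
    intro w f K hw hK hf x
    have := abs_integral_le_of_abs_le_exp (f := fun t => w t * f t) (K := C * K) hlpos
      (fun s => ?_) x
    · rwa [mul_div_right_comm] at this
    · rw [abs_mul, mul_assoc]
      exact mul_le_mul (hw s) (hf s) (abs_nonneg _) hCpos.le
  refine ⟨l, |α| + |β|, hlpos, by positivity, fun n => ?_⟩
  have hexp : ∀ x : ℝ, 1 ≤ exp (l * |x|) := fun x => one_le_exp (by positivity)
  induction n with
  | zero =>
    intro x
    simp only [pow_zero, one_mul, mul_one]
    refine ⟨?_, ?_⟩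
    · have h1 := step μ (fun _ => β) |β| hμC (abs_nonneg _)
        (fun s => le_mul_of_one_le_right (abs_nonneg _) (hexp s)) x
      have h2 : C / l * |β| * exp (l * |x|) ≤ |β| * exp (l * |x|) := by
        gcongr
        exact mul_le_of_le_one_left (abs_nonneg _) hq1
      have h3 : |α| ≤ |α| * exp (l * |x|) := le_mul_of_one_le_right (abs_nonneg _) (hexp x)
      calc _ ≤ |α| + |∫ t in (0 : ℝ)..x, μ t * β| := abs_add_le _ _
        _ ≤ _ := by rw [add_mul]; linarith
    · have h3 : |β| ≤ |β| * exp (l * |x|) := le_mul_of_one_le_right (abs_nonneg _) (hexp x)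
      calc _ ≤ |β| := le_rfl
        _ ≤ _ := by rw [add_mul]; have : 0 ≤ |α| * exp (l * |x|) := by positivity
                    linarith
  | succ n ih =>
    set K := (|α| + |β|) * (1 / 2) ^ n with hK
    have hK0 : 0 ≤ K := by positivity
    have hhalf : (|α| + |β|) * (1 / 2) ^ (n + 1) = K / 2 := by rw [hK, pow_succ]; ring
    rw [hhalf]
    have h2 : ∀ x, R ^ (n + 1) * |(cauchyCoeff ε μ α β (n + 1)).2 x| ≤
        K / 2 * exp (l * |x|) := by
      intro x
      have h3 := step ε (fun s => R ^ n * (cauchyCoeff ε μ α β n).1 s) K hεC hK0 (fun s => by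
        rw [abs_mul, abs_of_nonneg (by positivity : (0 : ℝ) ≤ R ^ n)]
        exact (ih s).1) x
      have h4 : ∫ t in (0 : ℝ)..x, ε t * (R ^ n * (cauchyCoeff ε μ α β n).1 t) =
          R ^ n * (cauchyCoeff ε μ α β (n + 1)).2 x := by
        simp only [cauchyCoeff]
        rw [← intervalIntegral.integral_const_mul]
        congr 1; ext t; ring
      rw [h4, abs_mul, abs_of_nonneg (by positivity : (0 : ℝ) ≤ R ^ n)] at h3
      calc _ = R * (R ^ n * |(cauchyCoeff ε μ α β (n + 1)).2 x|) := by ring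
        _ ≤ R * (C / l * K * exp (l * |x|)) := by gcongr
        _ = (R * (C / l)) * (K * exp (l * |x|)) := by ring
        _ ≤ 1 / 2 * (K * exp (l * |x|)) := by gcongr
        _ = _ := by ring
    intro x
    refine ⟨?_, h2 x⟩
    have h3 := step μ (fun s => R ^ (n + 1) * (cauchyCoeff ε μ α β (n + 1)).2 s) (K / 2) hμC
      (by positivity) (fun s => by
        rw [abs_mul, abs_of_nonneg (by positivity : (0 : ℝ) ≤ R ^ (n + 1))]
        exact h2 s) x
    have h4 : ∫ t in (0 : ℝ)..x, μ t * (R ^ (n + 1) * (cauchyCoeff ε μ α β (n + 1)).2 t) =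
        R ^ (n + 1) * (cauchyCoeff ε μ α β (n + 1)).1 x := by
      simp only [cauchyCoeff]
      rw [← intervalIntegral.integral_const_mul]
      congr 1; ext t; ring
    rw [h4, abs_mul, abs_of_nonneg (by positivity : (0 : ℝ) ≤ R ^ (n + 1))] at h3
    calc _ ≤ _ := h3
      _ ≤ _ := by
        gcongr
        exact mul_le_of_le_one_left (by positivity) hq1

omit hε hμ in
theorem abs_neg_pow_mul_le {E R y B : ℝ} (hE : |E| ≤ R) {n : ℕ} (h : R ^ n * |y| ≤ B) :
    |(-E) ^ n * y| ≤ B := by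
  rw [abs_mul, abs_pow, abs_neg]
  refine le_trans ?_ h
  gcongr

theorem summable_cauchyCoeff (E x : ℝ) :
    Summable (fun n => (-E) ^ n * (cauchyCoeff ε μ α β n).1 x) ∧
    Summable (fun n => (-E) ^ n * (cauchyCoeff ε μ α β n).2 x) := by
  obtain ⟨l, K, hl, hK, h⟩ := exists_cauchyCoeff_bound hε hμ α β |E| (abs_nonneg _)
  have hs : Summable fun n : ℕ => K * (1 / 2 : ℝ) ^ n * exp (l * |x|) :=
    (summable_geometric_two.mul_left K).mul_right _
  exact ⟨Summable.of_norm_bounded hs fun n => abs_neg_pow_mul_le le_rfl (h n x).1,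
    Summable.of_norm_bounded hs fun n => abs_neg_pow_mul_le le_rfl (h n x).2⟩

/-- The sum of the series for the solution. -/
def cauchySeries (ε μ : ℝ → ℝ) (E α β : ℝ) : (ℝ → ℝ) × (ℝ → ℝ) :=
  (fun x => ∑' n, (-E) ^ n * (cauchyCoeff ε μ α β n).1 x,
   fun x => ∑' n, (-E) ^ n * (cauchyCoeff ε μ α β n).2 x)

theorem exists_cauchySeries_bound (R : ℝ) (hR : 0 ≤ R) : ∃ l K : ℝ, 0 < l ∧ 0 ≤ K ∧
    ∀ E, |E| ≤ R → ∀ x, |(cauchySeries ε μ E α β).1 x| ≤ K * exp (l * |x|) ∧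
      |(cauchySeries ε μ E α β).2 x| ≤ K * exp (l * |x|) := by
  obtain ⟨l, K, hl, hK, h⟩ := exists_cauchyCoeff_bound hε hμ α β R hR
  have hs : ∀ x : ℝ, HasSum (fun n : ℕ => K * (1 / 2 : ℝ) ^ n * exp (l * |x|))
    (K * 2 * exp (l * |x|)) := fun x => (hasSum_geometric_two.mul_left K).mul_right _
  refine ⟨l, K * 2, hl, by positivity, fun E hE x => ⟨?_, ?_⟩⟩
  · exact tsum_of_norm_bounded (f := fun n => (-E) ^ n * (cauchyCoeff ε μ α β n).1 x) (hs x)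
      fun n => abs_neg_pow_mul_le hE (h n x).1
  · exact tsum_of_norm_bounded (f := fun n => (-E) ^ n * (cauchyCoeff ε μ α β n).2 x) (hs x)
      fun n => abs_neg_pow_mul_le hE (h n x).2

theorem continuous_cauchySeries (E : ℝ) : Continuous (cauchySeries ε μ E α β).1 ∧
    Continuous (cauchySeries ε μ E α β).2 := by
  obtain ⟨l, K, hl, hK, h⟩ := exists_cauchyCoeff_bound hε hμ α β |E| (abs_nonneg _)
  have key : ∀ f : ℕ → ℝ → ℝ, (∀ n, Continuous (f n)) →
      (∀ n x, |E| ^ n * |f n x| ≤ K * (1 / 2) ^ n * exp (l * |x|)) →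
      Continuous fun x => ∑' n, (-E) ^ n * f n x := by
    intro f hf hb
    rw [continuous_iff_continuousAt]
    intro x
    have hs : Summable fun n : ℕ => K * (1 / 2 : ℝ) ^ n * exp (l * (|x| + 1)) :=
      (summable_geometric_two.mul_left K).mul_right _
    have hc : ContinuousOn (fun x => ∑' n, (-E) ^ n * f n x) (Icc (x - 1) (x + 1)) := by
      refine continuousOn_tsum (fun n => (continuous_const.mul (hf n)).continuousOn) hs ?_
      intro n y hy
      refine (abs_neg_pow_mul_le le_rfl (hb n y)).trans ?_
      gcongr
      have : |y - x| ≤ 1 := abs_le.2 ⟨by linarith [hy.1], by linarith [hy.2]⟩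
      linarith [abs_sub_abs_le_abs_sub y x]
    exact hc.continuousAt (Icc_mem_nhds (by linarith) (by linarith))
  exact ⟨key _ (fun n => (continuous_cauchyCoeff hε hμ α β n).1) fun n x => (h n x).1,
    key _ (fun n => (continuous_cauchyCoeff hε hμ α β n).2) fun n x => (h n x).2⟩

theorem hasSum_integral_cauchyCoeff {w : ℝ → ℝ} (hw : IsTame w) (E x : ℝ) :
    HasSum (fun n => ∫ t in (0 : ℝ)..x, w t * ((-E) ^ n * (cauchyCoeff ε μ α β n).1 t))
      (∫ t in (0 : ℝ)..x, w t * (cauchySeries ε μ E α β).1 t) ∧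
    HasSum (fun n => ∫ t in (0 : ℝ)..x, w t * ((-E) ^ n * (cauchyCoeff ε μ α β n).2 t))
      (∫ t in (0 : ℝ)..x, w t * (cauchySeries ε μ E α β).2 t) := by
  obtain ⟨l, K, hl, hK, h⟩ := exists_cauchyCoeff_bound hε hμ α β |E| (abs_nonneg _)
  obtain ⟨C, hC⟩ := hw.bounded
  have hC0 : 0 ≤ C := (abs_nonneg _).trans (hC 0)
  have hs : ∀ x : ℝ, HasSum (fun n : ℕ => C * (K * (1 / 2 : ℝ) ^ n * exp (l * |x|)))
    (C * (K * 2 * exp (l * |x|))) := fun x =>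
      ((hasSum_geometric_two.mul_left K).mul_right _).mul_left C
  have key : ∀ f : ℕ → ℝ → ℝ, (∀ n, Continuous (f n)) →
      (∀ n x, |E| ^ n * |f n x| ≤ K * (1 / 2) ^ n * exp (l * |x|)) →
      (∀ x, Summable fun n => (-E) ^ n * f n x) →
      HasSum (fun n => ∫ t in (0 : ℝ)..x, w t * ((-E) ^ n * f n t))
      (∫ t in (0 : ℝ)..x, w t * ∑' n, (-E) ^ n * f n t) := by
    intro f hf hb hsum
    refine intervalIntegral.hasSum_integral_of_dominated_convergence
      (fun (n : ℕ) t => C * (K * (1 / 2 : ℝ) ^ n * exp (l * |t|))) (fun n => ?_)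
      (fun n => Eventually.of_forall fun t _ => ?_) (Eventually.of_forall fun t _ => (hs t).summable)
      ?_ (Eventually.of_forall fun t _ => (hsum t).hasSum.mul_left _)
    · exact hw.aestronglyMeasurable.restrict.mul
        (continuous_const.mul (hf n)).aestronglyMeasurable
    · rw [norm_mul]
      exact mul_le_mul (hC t) (abs_neg_pow_mul_le le_rfl (hb n t)) (abs_nonneg _) hC0
    · simp only [(hs _).tsum_eq]
      exact Continuous.intervalIntegrable (by fun_prop) _ _
  exact ⟨key _ (fun n => (continuous_cauchyCoeff hε hμ α β n).1) (fun n x => (h n x).1)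
      fun x => (summable_cauchyCoeff hε hμ α β E x).1,
    key _ (fun n => (continuous_cauchyCoeff hε hμ α β n).2) (fun n x => (h n x).2)
      fun x => (summable_cauchyCoeff hε hμ α β E x).2⟩

omit hε hμ in
theorem cauchySeries_zero (E : ℝ) : (cauchySeries ε μ E α β).1 0 = α ∧
    (cauchySeries ε μ E α β).2 0 = β := by
  refine ⟨?_, ?_⟩
  · refine (tsum_eq_single 0 fun n hn => ?_).trans ?_
    · obtain ⟨m, rfl⟩ := Nat.exists_eq_succ_of_ne_zero hn
      simp [cauchyCoeff]
    · simp [cauchyCoeff]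
  · refine (tsum_eq_single 0 fun n hn => ?_).trans ?_
    · obtain ⟨m, rfl⟩ := Nat.exists_eq_succ_of_ne_zero hn
      simp [cauchyCoeff]
    · simp [cauchyCoeff]

theorem isSolution_cauchySeries (E : ℝ) :
    IsSolution ε μ E (cauchySeries ε μ E α β).1 (cauchySeries ε μ E α β).2 where
  continuous_fst := (continuous_cauchySeries hε hμ α β E).1
  continuous_flux := (continuous_cauchySeries hε hμ α β E).2
  fst_eq x := by
    rw [(cauchySeries_zero α β E).1]
    simp only [smul_eq_mul]
    have h1 := (hasSum_integral_cauchyCoeff hε hμ α β hμ E x).2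
    have h2 : HasSum _ ((cauchySeries ε μ E α β).1 x) := (summable_cauchyCoeff hε hμ α β E x).1.hasSum
    have h3 : (fun n => (-E) ^ n * (cauchyCoeff ε μ α β n).1 x) =
        fun n => (if n = 0 then α else 0) +
          ∫ t in (0 : ℝ)..x, μ t * ((-E) ^ n * (cauchyCoeff ε μ α β n).2 t) := by
      funext n
      cases n with
      | zero => simp [cauchyCoeff]
      | succ n =>
        simp only [cauchyCoeff, Nat.succ_ne_zero, if_false, zero_add]
        rw [← intervalIntegral.integral_const_mul]
        congr 1; ext t; ring
    rw [h3] at h2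
    exact h2.unique ((hasSum_ite_eq 0 α).add h1)
  flux_eq x := by
    rw [(cauchySeries_zero α β E).2]
    simp only [smul_eq_mul, mul_assoc, intervalIntegral.integral_const_mul]
    have h1 := ((hasSum_integral_cauchyCoeff hε hμ α β hε E x).1).mul_left (-E)
    have h2 : HasSum _ ((cauchySeries ε μ E α β).2 x) := (summable_cauchyCoeff hε hμ α β E x).2.hasSum
    have h4 : HasSum (fun n => (-E) ^ (n + 1) * (cauchyCoeff ε μ α β (n + 1)).2 x)
        (-E * ∫ t in (0 : ℝ)..x, ε t * (cauchySeries ε μ E α β).1 t) := by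
      refine h1.congr_fun fun n => ?_
      simp only [cauchyCoeff]
      rw [pow_succ', mul_assoc, ← intervalIntegral.integral_const_mul]
      congr 2; ext t; ring
    have h5 := (hasSum_nat_add_iff (f := fun n => (-E) ^ n * (cauchyCoeff ε μ α β n).2 x) 1).1 h4
    rw [h2.unique h5]
    simp [cauchyCoeff]
    ring

/-- The coefficients beat every geometric sequence, so the radius of convergence is infinite.
Analyticity, beyond continuity in E, is what later permits dividing b and c by a common zero. -/
theorem analyticAt_cauchySeries (x E : ℝ) :
    AnalyticAt ℝ (fun E => (cauchySeries ε μ E α β).1 x) E ∧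
    AnalyticAt ℝ (fun E => (cauchySeries ε μ E α β).2 x) E := by
  have key : ∀ f : ℕ → ℝ, (∀ R : ℝ, 0 ≤ R → Summable fun n => R ^ n * |f n|) →
      AnalyticAt ℝ (fun E => ∑' n, (-E) ^ n * f n) E := by
    intro f hf
    let P := FormalMultilinearSeries.ofScalars ℝ fun n => (-1) ^ n * f n
    have hrad : P.radius = ⊤ := by
      refine P.radius_eq_top_of_summable_norm fun r => ?_
      refine (hf r r.2).congr fun n => ?_
      rw [FormalMultilinearSeries.ofScalars_norm]
      simp [mul_comm]
    have h1 := P.hasFPowerSeriesOnBall (by rw [hrad]; exact ENNReal.coe_lt_top)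
    have h2 : (fun E => ∑' n, (-E) ^ n * f n) = P.sum := by
      funext E
      have : P.sum E = ∑' n, ((-1) ^ n * f n) • E ^ n :=
        FormalMultilinearSeries.ofScalars_sum_eq _ E
      rw [this]
      refine tsum_congr fun n => ?_
      rw [neg_pow, smul_eq_mul]; ring
    rw [h2]
    exact h1.analyticAt_of_mem (by rw [hrad]; simp)
  refine ⟨key _ fun R hR => ?_, key _ fun R hR => ?_⟩ <;>
  · obtain ⟨l, K, hl, hK, h⟩ := exists_cauchyCoeff_bound hε hμ α β R hR
    have hs : Summable fun n : ℕ => K * (1 / 2 : ℝ) ^ n * exp (l * |x|) :=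
      (summable_geometric_two.mul_left K).mul_right _
    refine Summable.of_nonneg_of_le (fun n => by positivity) (fun n => ?_) hs
    first | exact (h n x).1 | exact (h n x).2

end Series

/-! ### The fundamental system -/

/-- The flux `(1/μ) ψ_{E,1}'`. -/
def flux1 (ε μ : ℝ → ℝ) (E : ℝ) : ℝ → ℝ := (cauchySolution ε μ E 1 0).2

section Fundamental

variable {ε μ : ℝ → ℝ} (hε : IsTame ε) (hμ : IsTame μ)
include hε hμ

theorem cauchySolution_spec (E α β : ℝ) :
    IsSolution ε μ E (cauchySolution ε μ E α β).1 (cauchySolution ε μ E α β).2 ∧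
      (cauchySolution ε μ E α β).1 0 = α ∧ (cauchySolution ε μ E α β).2 0 = β :=
  Classical.epsilon_spec (p := fun q : (ℝ → ℝ) × (ℝ → ℝ) =>
    IsSolution ε μ E q.1 q.2 ∧ q.1 0 = α ∧ q.2 0 = β)
    ⟨cauchySeries ε μ E α β, isSolution_cauchySeries hε hμ α β E, cauchySeries_zero α β E⟩

theorem isSolution_psi1 (E : ℝ) : IsSolution ε μ E (psi1 ε μ E) (flux1 ε μ E) :=
  (cauchySolution_spec hε hμ E 1 0).1

theorem isSolution_psi2 (E : ℝ) : IsSolution ε μ E (psi2 ε μ E) (flux2 ε μ E) :=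
  (cauchySolution_spec hε hμ E 0 1).1

theorem psi1_zero (E : ℝ) : psi1 ε μ E 0 = 1 := (cauchySolution_spec hε hμ E 1 0).2.1
theorem flux1_zero (E : ℝ) : flux1 ε μ E 0 = 0 := (cauchySolution_spec hε hμ E 1 0).2.2
theorem psi2_zero (E : ℝ) : psi2 ε μ E 0 = 0 := (cauchySolution_spec hε hμ E 0 1).2.1
theorem flux2_zero (E : ℝ) : flux2 ε μ E 0 = 1 := (cauchySolution_spec hε hμ E 0 1).2.2

theorem continuous_psi1 (E : ℝ) : Continuous (psi1 ε μ E) :=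
  (isSolution_psi1 hε hμ E).continuous_fst

theorem continuous_psi2 (E : ℝ) : Continuous (psi2 ε μ E) :=
  (isSolution_psi2 hε hμ E).continuous_fst

theorem det_fundamental (E x : ℝ) :
    psi1 ε μ E x * flux2 ε μ E x - flux1 ε μ E x * psi2 ε μ E x = 1 := by
  have h := (isSolution_psi1 hε hμ E).wronskian_eq hε hμ (isSolution_psi2 hε hμ E) x
  rw [psi1_zero hε hμ, flux1_zero hε hμ, flux2_zero hε hμ] at h
  simpa using h

/-- Variation of constants. -/
theorem IsSolution.eq_fundamental {𝕜 : Type*} [NormedCommRing 𝕜] [NormedAlgebra ℝ 𝕜]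
    [CompleteSpace 𝕜] {E E' : ℝ} {u p : ℝ → 𝕜} (h : IsSolution ε μ E' u p) (x : ℝ) :
    u x = psi1 ε μ E x • u 0 + psi2 ε μ E x • p 0 + (E - E') •
      (psi2 ε μ E x • (∫ t in (0 : ℝ)..x, ε t • psi1 ε μ E t • u t) -
        psi1 ε μ E x • ∫ t in (0 : ℝ)..x, ε t • psi2 ε μ E t • u t) ∧
    p x = flux1 ε μ E x • u 0 + flux2 ε μ E x • p 0 + (E - E') •
      (flux2 ε μ E x • (∫ t in (0 : ℝ)..x, ε t • psi1 ε μ E t • u t) -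
        flux1 ε μ E x • ∫ t in (0 : ℝ)..x, ε t • psi2 ε μ E t • u t) := by
  -- Lagrange's identity against ψ₁ and against ψ₂ gives two linear equations for u(x) and p(x).
  -- Their determinant is the Wronskian 1, so Cramer's rule solves them.
  have h1 := ((isSolution_psi1 hε hμ E).clm_comp hε hμ (Algebra.linearMap ℝ 𝕜).toContinuousLinearMap
    ).wronskian_eq hε hμ h x
  have h2 := ((isSolution_psi2 hε hμ E).clm_comp hε hμ (Algebra.linearMap ℝ 𝕜).toContinuousLinearMap
    ).wronskian_eq hε hμ h x
  simp only [psi1_zero hε hμ, flux1_zero hε hμ, psi2_zero hε hμ, flux2_zero hε hμ,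
    LinearMap.coe_toContinuousLinearMap', Algebra.linearMap_apply, map_one, map_zero, one_mul,
    zero_mul, sub_zero, zero_sub, Algebra.smul_def, map_sub] at h1 h2 ⊢
  have h3 : algebraMap ℝ 𝕜 (psi1 ε μ E x) * algebraMap ℝ 𝕜 (flux2 ε μ E x) -
      algebraMap ℝ 𝕜 (flux1 ε μ E x) * algebraMap ℝ 𝕜 (psi2 ε μ E x) = 1 := by
    rw [← map_mul, ← map_mul, ← map_sub, det_fundamental hε hμ, map_one]
  refine ⟨?_, ?_⟩
  · linear_combination (-u x) * h3 + algebraMap ℝ 𝕜 (psi2 ε μ E x) * h1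
      - algebraMap ℝ 𝕜 (psi1 ε μ E x) * h2
  · linear_combination (-p x) * h3 + algebraMap ℝ 𝕜 (flux2 ε μ E x) * h1
      - algebraMap ℝ 𝕜 (flux1 ε μ E x) * h2

theorem IsSolution.eq_psi {𝕜 : Type*} [NormedCommRing 𝕜] [NormedAlgebra ℝ 𝕜]
    [CompleteSpace 𝕜] {E : ℝ} {u p : ℝ → 𝕜} (h : IsSolution ε μ E u p) (x : ℝ) :
    u x = psi1 ε μ E x • u 0 + psi2 ε μ E x • p 0 ∧
    p x = flux1 ε μ E x • u 0 + flux2 ε μ E x • p 0 := by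
  have := h.eq_fundamental (E := E) hε hμ x
  simpa using this

theorem isSolution_combination (E : ℝ) (α β : ℂ) :
    IsSolution ε μ E (fun x => α * psi1 ε μ E x + β * psi2 ε μ E x)
      (fun x => α * flux1 ε μ E x + β * flux2 ε μ E x) := by
  have h1 := (isSolution_psi1 hε hμ E).clm_comp hε hμ
    ((ContinuousLinearMap.toSpanSingleton ℝ α))
  have h2 := (isSolution_psi2 hε hμ E).clm_comp hε hμ
    ((ContinuousLinearMap.toSpanSingleton ℝ β))
  convert h1.add hε hμ h2 using 1
  · funext x
    simp [mul_comm]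
  · funext x
    simp [mul_comm]

theorem cauchySolution_eq_series (E α β : ℝ) :
    cauchySolution ε μ E α β = cauchySeries ε μ E α β := by
  obtain ⟨h1, h2, h3⟩ := cauchySolution_spec hε hμ E α β
  have h4 := isSolution_cauchySeries hε hμ α β E
  obtain ⟨h5, h6⟩ := cauchySeries_zero (ε := ε) (μ := μ) α β E
  refine Prod.ext (funext fun x => ?_) (funext fun x => ?_)
  · rw [(h1.eq_psi hε hμ x).1, (h4.eq_psi hε hμ x).1, h2, h3, h5, h6]
  · rw [(h1.eq_psi hε hμ x).2, (h4.eq_psi hε hμ x).2, h2, h3, h5, h6]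

theorem analyticAt_psi1 (x E : ℝ) : AnalyticAt ℝ (fun E => psi1 ε μ E x) E := by
  simp only [psi1, cauchySolution_eq_series hε hμ]
  exact (analyticAt_cauchySeries hε hμ 1 0 x E).1

theorem analyticAt_psi2 (x E : ℝ) : AnalyticAt ℝ (fun E => psi2 ε μ E x) E := by
  simp only [psi2, cauchySolution_eq_series hε hμ]
  exact (analyticAt_cauchySeries hε hμ 0 1 x E).1

theorem analyticAt_flux1 (x E : ℝ) : AnalyticAt ℝ (fun E => flux1 ε μ E x) E := by
  simp only [flux1, cauchySolution_eq_series hε hμ]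
  exact (analyticAt_cauchySeries hε hμ 1 0 x E).2

end Fundamental

/-! ### Families of functions depending on the energy -/

/-- A family of functions of `x`, depending on `E`, separately continuous and locally bounded. -/
structure IsRegularFamily (f : ℝ → ℝ → ℝ) : Prop where
  continuous_right : ∀ E, Continuous (f E)
  continuous_left : ∀ x, Continuous fun E => f E x
  bounded : ∀ R X : ℝ, ∃ K, ∀ E x, |E| ≤ R → |x| ≤ X → |f E x| ≤ K

theorem IsRegularFamily.mul {f g : ℝ → ℝ → ℝ} (hf : IsRegularFamily f) (hg : IsRegularFamily g) :
    IsRegularFamily fun E x => f E x * g E x where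
  continuous_right E := (hf.continuous_right E).mul (hg.continuous_right E)
  continuous_left x := (hf.continuous_left x).mul (hg.continuous_left x)
  bounded R X := by
    obtain ⟨K, hK⟩ := hf.bounded R X
    obtain ⟨K', hK'⟩ := hg.bounded R X
    refine ⟨K * K', fun E x hE hx => ?_⟩
    rw [abs_mul]
    exact mul_le_mul (hK E x hE hx) (hK' E x hE hx) (abs_nonneg _)
      ((abs_nonneg _).trans (hK E x hE hx))

theorem IsRegularFamily.sub {f g : ℝ → ℝ → ℝ} (hf : IsRegularFamily f) (hg : IsRegularFamily g) :
    IsRegularFamily fun E x => f E x - g E x where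
  continuous_right E := (hf.continuous_right E).sub (hg.continuous_right E)
  continuous_left x := (hf.continuous_left x).sub (hg.continuous_left x)
  bounded R X := by
    obtain ⟨K, hK⟩ := hf.bounded R X
    obtain ⟨K', hK'⟩ := hg.bounded R X
    exact ⟨K + K', fun E x hE hx => (abs_sub _ _).trans (add_le_add (hK E x hE hx) (hK' E x hE hx))⟩

theorem IsRegularFamily.add {f g : ℝ → ℝ → ℝ} (hf : IsRegularFamily f) (hg : IsRegularFamily g) :
    IsRegularFamily fun E x => f E x + g E x where
  continuous_right E := (hf.continuous_right E).add (hg.continuous_right E)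
  continuous_left x := (hf.continuous_left x).add (hg.continuous_left x)
  bounded R X := by
    obtain ⟨K, hK⟩ := hf.bounded R X
    obtain ⟨K', hK'⟩ := hg.bounded R X
    exact ⟨K + K', fun E x hE hx => (abs_add_le _ _).trans
      (add_le_add (hK E x hE hx) (hK' E x hE hx))⟩

theorem IsRegularFamily.of_right {f : ℝ → ℝ} (hf : Continuous f) :
    IsRegularFamily fun _ x => f x where
  continuous_right _ := hf
  continuous_left _ := continuous_const
  bounded R X := by
    obtain ⟨K, hK⟩ := (isCompact_Icc (a := -X) (b := X)).exists_bound_of_continuousOn hf.continuousOn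
    exact ⟨K, fun E x _ hx => hK x (abs_le.1 hx)⟩

theorem IsRegularFamily.primitive {f : ℝ → ℝ → ℝ} (hf : IsRegularFamily f) {w : ℝ → ℝ}
    (hw : IsTame w) : IsRegularFamily fun E x => ∫ t in (0 : ℝ)..x, w t * f E t where
  continuous_right E := hw.continuous_primitive (hf.continuous_right E)
  continuous_left x := by
    rw [continuous_iff_continuousAt]
    intro E
    obtain ⟨K, hK⟩ := hf.bounded (|E| + 1) |x|
    obtain ⟨C, hC⟩ := hw.bounded
    refine intervalIntegral.continuousAt_of_dominated_interval (bound := fun _ => C * K)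
      (Eventually.of_forall fun E' => ?_) ?_ (by simp) (Eventually.of_forall fun t _ => ?_)
    · exact hw.aestronglyMeasurable.restrict.mul
        (hf.continuous_right E').aestronglyMeasurable
    · have : ∀ᶠ E' in 𝓝 E, |E'| ≤ |E| + 1 :=
        (continuous_abs.tendsto E).eventually_le_const (lt_add_one _)
      filter_upwards [this] with E' hE'
      refine Eventually.of_forall fun t ht => ?_
      rw [norm_mul]
      refine mul_le_mul (hC t) (hK E' t hE' ?_) (abs_nonneg _) ((abs_nonneg _).trans (hC 0))
      have := uIoc_subset_uIcc ht
      rw [mem_uIcc] at this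
      rcases this with h | h
      · rw [abs_of_nonneg h.1, abs_of_nonneg (h.1.trans h.2)]; exact h.2
      · rw [abs_of_nonpos h.2, abs_of_nonpos (h.1.trans h.2)]; linarith
    · exact continuousAt_const.mul (hf.continuous_left t).continuousAt
  bounded R X := by
    obtain ⟨K, hK⟩ := hf.bounded R X
    obtain ⟨C, hC⟩ := hw.bounded
    refine ⟨C * K * X, fun E x hE hx => ?_⟩
    have hCK : 0 ≤ C * K := mul_nonneg ((abs_nonneg _).trans (hC 0))
      ((abs_nonneg _).trans (hK E x hE hx))
    have := intervalIntegral.norm_integral_le_of_norm_le_const (a := 0) (b := x)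
      (f := fun t => w t * f E t) (C := C * K) fun t ht => by
        rw [norm_mul]
        refine mul_le_mul (hC t) (hK E t hE ?_) (abs_nonneg _) ((abs_nonneg _).trans (hC 0))
        have := uIoc_subset_uIcc ht
        rw [mem_uIcc] at this
        refine le_trans ?_ hx
        rcases this with h | h
        · rw [abs_of_nonneg h.1, abs_of_nonneg (h.1.trans h.2)]; exact h.2
        · rw [abs_of_nonpos h.2, abs_of_nonpos (h.1.trans h.2)]; linarith
    rw [sub_zero] at this
    exact this.trans (mul_le_mul_of_nonneg_left hx hCK)

theorem IsRegularFamily.hasDerivAt_integral {f f' : ℝ → ℝ → ℝ} (hf : IsRegularFamily f)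
    (hf' : IsRegularFamily f') (hd : ∀ E x, HasDerivAt (fun E => f E x) (f' E x) E) {w : ℝ → ℝ}
    (hw : IsTame w) (E : ℝ) :
    HasDerivAt (fun E => ∫ t in (0 : ℝ)..1, w t * f E t) (∫ t in (0 : ℝ)..1, w t * f' E t) E := by
  obtain ⟨K, hK⟩ := hf'.bounded (|E| + 1) 1
  obtain ⟨C, hC⟩ := hw.bounded
  have hs : {E' : ℝ | |E'| ≤ |E| + 1} ∈ 𝓝 E :=
    (continuous_abs.tendsto E).eventually_le_const (lt_add_one _)
  refine (intervalIntegral.hasDerivAt_integral_of_dominated_loc_of_deriv_le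
    (bound := fun _ => C * K) hs (Eventually.of_forall fun E' => ?_)
    (hw.intervalIntegrable_mul (hf.continuous_right E) 0 1) ?_ (Eventually.of_forall ?_) (by simp)
    (Eventually.of_forall fun t _ E' _ => (hd E' t).const_mul _)).2
  · exact hw.aestronglyMeasurable.restrict.mul (hf.continuous_right E').aestronglyMeasurable
  · exact hw.aestronglyMeasurable.restrict.mul (hf'.continuous_right E).aestronglyMeasurable
  · intro t ht E' hE'
    rw [norm_mul]
    refine mul_le_mul (hC t) (hK E' t hE' ?_) (abs_nonneg _) ((abs_nonneg _).trans (hC 0))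
    rw [uIoc_of_le zero_le_one] at ht
    rw [abs_of_pos ht.1]; exact ht.2

/-! ### Derivatives of the fundamental solutions with respect to the energy -/

section Derivative

variable {ε μ : ℝ → ℝ} (hε : IsTame ε) (hμ : IsTame μ)
include hε hμ

theorem isRegularFamily_cauchySeries (α β : ℝ) :
    IsRegularFamily fun E => (cauchySeries ε μ E α β).1 where
  continuous_right E := (continuous_cauchySeries hε hμ α β E).1
  continuous_left x := continuous_iff_continuousAt.2 fun E =>
    (analyticAt_cauchySeries hε hμ α β x E).1.continuousAt
  bounded R X := by
    obtain ⟨l, K, hl, hK, h⟩ := exists_cauchySeries_bound hε hμ α β |R| (abs_nonneg _)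
    refine ⟨K * exp (l * X), fun E x hE hx => (h E (hE.trans (le_abs_self R)) x).1.trans ?_⟩
    gcongr

theorem isRegularFamily_psi1 : IsRegularFamily (psi1 ε μ) := by
  have := isRegularFamily_cauchySeries hε hμ 1 0
  simp only [← cauchySolution_eq_series hε hμ] at this
  exact this

theorem isRegularFamily_psi2 : IsRegularFamily (psi2 ε μ) := by
  have := isRegularFamily_cauchySeries hε hμ 0 1
  simp only [← cauchySolution_eq_series hε hμ] at this
  exact this

-- Variation of constants about a fixed energy E has this shape with G merely continuous, so
-- differentiability in the energy follows without differentiating under the integral.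
omit hε hμ in
theorem hasDerivAt_of_eq_add_sub_mul {g G : ℝ → ℝ} {g0 E : ℝ}
    (h : ∀ E', g E' = g0 + (E - E') * G E') (hG : ContinuousAt G E) :
    HasDerivAt g (-G E) E := by
  rw [hasDerivAt_iff_tendsto_slope]
  have h1 : Tendsto (fun E' => -G E') (𝓝[≠] E) (𝓝 (-G E)) :=
    (hG.neg).tendsto.mono_left nhdsWithin_le_nhds
  refine h1.congr' ?_
  filter_upwards [self_mem_nhdsWithin] with E' hE'
  have : E' - E ≠ 0 := sub_ne_zero.2 hE'
  rw [slope_def_field, h, h E]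
  field_simp
  ring

/-- The integral `∫₀ˣ ε ψ_{E,1}²`. -/
def gram11 (ε μ : ℝ → ℝ) (E x : ℝ) : ℝ := ∫ t in (0 : ℝ)..x, ε t * (psi1 ε μ E t * psi1 ε μ E t)
/-- The integral `∫₀ˣ ε ψ_{E,1} ψ_{E,2}`. -/
def gram12 (ε μ : ℝ → ℝ) (E x : ℝ) : ℝ := ∫ t in (0 : ℝ)..x, ε t * (psi1 ε μ E t * psi2 ε μ E t)
/-- The integral `∫₀ˣ ε ψ_{E,2}²`. -/
def gram22 (ε μ : ℝ → ℝ) (E x : ℝ) : ℝ := ∫ t in (0 : ℝ)..x, ε t * (psi2 ε μ E t * psi2 ε μ E t)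

theorem isRegularFamily_gram11 : IsRegularFamily (gram11 ε μ) :=
  ((isRegularFamily_psi1 hε hμ).mul (isRegularFamily_psi1 hε hμ)).primitive hε

theorem isRegularFamily_gram12 : IsRegularFamily (gram12 ε μ) :=
  ((isRegularFamily_psi1 hε hμ).mul (isRegularFamily_psi2 hε hμ)).primitive hε

theorem isRegularFamily_gram22 : IsRegularFamily (gram22 ε μ) :=
  ((isRegularFamily_psi2 hε hμ).mul (isRegularFamily_psi2 hε hμ)).primitive hε

theorem hasDerivAt_psi1 (E x : ℝ) : HasDerivAt (fun E => psi1 ε μ E x)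
    (psi1 ε μ E x * gram12 ε μ E x - psi2 ε μ E x * gram11 ε μ E x) E := by
  have h := hasDerivAt_of_eq_add_sub_mul (g := fun E => psi1 ε μ E x) (g0 := psi1 ε μ E x) (E := E)
    (G := fun E' => psi2 ε μ E x * (∫ t in (0 : ℝ)..x, ε t * (psi1 ε μ E t * psi1 ε μ E' t)) -
        psi1 ε μ E x * ∫ t in (0 : ℝ)..x, ε t * (psi2 ε μ E t * psi1 ε μ E' t)) (fun E' => by
      have := ((isSolution_psi1 hε hμ E').eq_fundamental (E := E) hε hμ x).1
      simpa [psi1_zero hε hμ, flux1_zero hε hμ] using this)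
    ((continuousAt_const.mul
      ((((IsRegularFamily.of_right (continuous_psi1 hε hμ E)).mul (isRegularFamily_psi1 hε hμ)
        ).primitive hε).continuous_left x).continuousAt).sub (continuousAt_const.mul
      ((((IsRegularFamily.of_right (continuous_psi2 hε hμ E)).mul (isRegularFamily_psi1 hε hμ)
        ).primitive hε).continuous_left x).continuousAt))
  refine h.congr_deriv ?_
  simp only [gram11, gram12, mul_comm (psi2 ε μ E _) (psi1 ε μ E _)]
  ring

theorem hasDerivAt_psi2 (E x : ℝ) : HasDerivAt (fun E => psi2 ε μ E x)
    (psi1 ε μ E x * gram22 ε μ E x - psi2 ε μ E x * gram12 ε μ E x) E := by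
  have h := hasDerivAt_of_eq_add_sub_mul (g := fun E => psi2 ε μ E x) (g0 := psi2 ε μ E x) (E := E)
    (G := fun E' => psi2 ε μ E x * (∫ t in (0 : ℝ)..x, ε t * (psi1 ε μ E t * psi2 ε μ E' t)) -
        psi1 ε μ E x * ∫ t in (0 : ℝ)..x, ε t * (psi2 ε μ E t * psi2 ε μ E' t)) (fun E' => by
      have := ((isSolution_psi2 hε hμ E').eq_fundamental (E := E) hε hμ x).1
      simpa [psi2_zero hε hμ, flux2_zero hε hμ] using this)
    ((continuousAt_const.mul
      ((((IsRegularFamily.of_right (continuous_psi1 hε hμ E)).mul (isRegularFamily_psi2 hε hμ)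
        ).primitive hε).continuous_left x).continuousAt).sub (continuousAt_const.mul
      ((((IsRegularFamily.of_right (continuous_psi2 hε hμ E)).mul (isRegularFamily_psi2 hε hμ)
        ).primitive hε).continuous_left x).continuousAt))
  refine h.congr_deriv ?_
  simp only [gram22, gram12]
  ring

theorem hasDerivAt_flux1 (E x : ℝ) : HasDerivAt (fun E => flux1 ε μ E x)
    (flux1 ε μ E x * gram12 ε μ E x - flux2 ε μ E x * gram11 ε μ E x) E := by
  have h := hasDerivAt_of_eq_add_sub_mul (g := fun E => flux1 ε μ E x) (g0 := flux1 ε μ E x)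
    (E := E)
    (G := fun E' => flux2 ε μ E x * (∫ t in (0 : ℝ)..x, ε t * (psi1 ε μ E t * psi1 ε μ E' t)) -
        flux1 ε μ E x * ∫ t in (0 : ℝ)..x, ε t * (psi2 ε μ E t * psi1 ε μ E' t)) (fun E' => by
      have := ((isSolution_psi1 hε hμ E').eq_fundamental (E := E) hε hμ x).2
      simpa [psi1_zero hε hμ, flux1_zero hε hμ] using this)
    ((continuousAt_const.mul
      ((((IsRegularFamily.of_right (continuous_psi1 hε hμ E)).mul (isRegularFamily_psi1 hε hμ)
        ).primitive hε).continuous_left x).continuousAt).sub (continuousAt_const.mul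
      ((((IsRegularFamily.of_right (continuous_psi2 hε hμ E)).mul (isRegularFamily_psi1 hε hμ)
        ).primitive hε).continuous_left x).continuousAt))
  refine h.congr_deriv ?_
  simp only [gram11, gram12, mul_comm (psi2 ε μ E _) (psi1 ε μ E _)]
  ring

theorem hasDerivAt_flux2 (E x : ℝ) : HasDerivAt (fun E => flux2 ε μ E x)
    (flux1 ε μ E x * gram22 ε μ E x - flux2 ε μ E x * gram12 ε μ E x) E := by
  have h := hasDerivAt_of_eq_add_sub_mul (g := fun E => flux2 ε μ E x) (g0 := flux2 ε μ E x)
    (E := E)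
    (G := fun E' => flux2 ε μ E x * (∫ t in (0 : ℝ)..x, ε t * (psi1 ε μ E t * psi2 ε μ E' t)) -
        flux1 ε μ E x * ∫ t in (0 : ℝ)..x, ε t * (psi2 ε μ E t * psi2 ε μ E' t)) (fun E' => by
      have := ((isSolution_psi2 hε hμ E').eq_fundamental (E := E) hε hμ x).2
      simpa [psi2_zero hε hμ, flux2_zero hε hμ] using this)
    ((continuousAt_const.mul
      ((((IsRegularFamily.of_right (continuous_psi1 hε hμ E)).mul (isRegularFamily_psi2 hε hμ)
        ).primitive hε).continuous_left x).continuousAt).sub (continuousAt_const.mul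
      ((((IsRegularFamily.of_right (continuous_psi2 hε hμ E)).mul (isRegularFamily_psi2 hε hμ)
        ).primitive hε).continuous_left x).continuousAt))
  refine h.congr_deriv ?_
  simp only [gram22, gram12]
  ring

end Derivative

/-! ### The monodromy matrix of an inversion-symmetric structure -/

/-- Both coefficients are periodic, positive and inversion symmetric. -/
structure IsSymmetricMedium (ε μ : ℝ → ℝ) : Prop where
  eps : IsSymmetricCoefficient ε
  mu : IsSymmetricCoefficient μ

theorem IsSymmetricCoefficient.isTame {f : ℝ → ℝ} (h : IsSymmetricCoefficient f) : IsTame f :=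
  h.toIsPiecewiseContinuousPeriodic.isTame

theorem IsSymmetricCoefficient.even {f : ℝ → ℝ} (h : IsSymmetricCoefficient f) (x : ℝ) :
    f (-x) = f x := by
  rw [h.inversion (-x), sub_neg_eq_add, add_comm, h.periodic]

/-- The diagonal entries of the monodromy matrix. -/
abbrev monoA (ε μ : ℝ → ℝ) (E : ℝ) : ℝ := psi1 ε μ E 1
/-- The upper right entry of the monodromy matrix. -/
abbrev monoB (ε μ : ℝ → ℝ) (E : ℝ) : ℝ := psi2 ε μ E 1
/-- The lower left entry of the monodromy matrix. -/
abbrev monoC (ε μ : ℝ → ℝ) (E : ℝ) : ℝ := flux1 ε μ E 1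

namespace IsSymmetricMedium

variable {ε μ : ℝ → ℝ} (h : IsSymmetricMedium ε μ)
include h

theorem psi_neg (E x : ℝ) : psi1 ε μ E (-x) = psi1 ε μ E x ∧ flux1 ε μ E (-x) = -flux1 ε μ E x ∧
    psi2 ε μ E (-x) = -psi2 ε μ E x ∧ flux2 ε μ E (-x) = flux2 ε μ E x := by
  have hε := h.eps.isTame
  have hμ := h.mu.isTame
  have h1 := ((isSolution_psi1 hε hμ E).comp_neg hε hμ h.eps.even h.mu.even).eq_psi hε hμ x
  have h2 := ((isSolution_psi2 hε hμ E).comp_neg hε hμ h.eps.even h.mu.even).eq_psi hε hμ x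
  simp only [neg_zero, psi1_zero hε hμ, flux1_zero hε hμ, psi2_zero hε hμ, flux2_zero hε hμ,
    smul_eq_mul, mul_one, mul_zero, add_zero, zero_add, mul_neg] at h1 h2
  exact ⟨h1.1, by linarith [h1.2], h2.1, by linarith [h2.2]⟩

theorem psi1_neg (E x : ℝ) : psi1 ε μ E (-x) = psi1 ε μ E x := (h.psi_neg E x).1
theorem psi2_neg (E x : ℝ) : psi2 ε μ E (-x) = -psi2 ε μ E x := (h.psi_neg E x).2.2.1

theorem continuous_psi1 (E : ℝ) : Continuous (psi1 ε μ E) :=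
  Photonic.continuous_psi1 h.eps.isTame h.mu.isTame E

theorem continuous_psi2 (E : ℝ) : Continuous (psi2 ε μ E) :=
  Photonic.continuous_psi2 h.eps.isTame h.mu.isTame E

theorem psi1_zero (E : ℝ) : psi1 ε μ E 0 = 1 := Photonic.psi1_zero h.eps.isTame h.mu.isTame E
theorem psi2_zero (E : ℝ) : psi2 ε μ E 0 = 0 := Photonic.psi2_zero h.eps.isTame h.mu.isTame E

theorem psi_add_one' (E x : ℝ) :
    psi1 ε μ E (x + 1) = psi1 ε μ E 1 * psi1 ε μ E x + flux1 ε μ E 1 * psi2 ε μ E x ∧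
    flux1 ε μ E (x + 1) = psi1 ε μ E 1 * flux1 ε μ E x + flux1 ε μ E 1 * flux2 ε μ E x ∧
    psi2 ε μ E (x + 1) = psi2 ε μ E 1 * psi1 ε μ E x + flux2 ε μ E 1 * psi2 ε μ E x ∧
    flux2 ε μ E (x + 1) = psi2 ε μ E 1 * flux1 ε μ E x + flux2 ε μ E 1 * flux2 ε μ E x := by
  have hε := h.eps.isTame
  have hμ := h.mu.isTame
  have h1 := ((isSolution_psi1 hε hμ E).comp_add_one hε hμ h.eps.periodic h.mu.periodic).eq_psi
    hε hμ x
  have h2 := ((isSolution_psi2 hε hμ E).comp_add_one hε hμ h.eps.periodic h.mu.periodic).eq_psi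
    hε hμ x
  simp only [zero_add, smul_eq_mul] at h1 h2
  exact ⟨by linarith [h1.1], by linarith [h1.2], by linarith [h2.1], by linarith [h2.2]⟩

/-- Let d be the lower right entry. Translating from -1 to 0 and using the parities of ψ₁ and ψ₂
gives a² - bc = 1 = d² - bc, and the determinant gives ad - bc = 1. Hence a(d - a) = d(d - a) = 0,
and a = d = 0 is impossible if d ≠ a. -/
theorem flux2_one (E : ℝ) : flux2 ε μ E 1 = monoA ε μ E := by
  have hε := h.eps.isTame
  have hμ := h.mu.isTame
  obtain ⟨h1, h2, h3, h4⟩ := h.psi_add_one' E (-1)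
  obtain ⟨h5, h6, h7, h8⟩ := h.psi_neg E 1
  have h9 := det_fundamental hε hμ E 1
  simp only [neg_add_cancel, h5, h6, h7, h8, Photonic.psi1_zero hε hμ, flux2_zero hε hμ]
    at h1 h4
  by_contra hne
  have hne' : flux2 ε μ E 1 - psi1 ε μ E 1 ≠ 0 := sub_ne_zero.2 hne
  have ha : psi1 ε μ E 1 = 0 := (mul_eq_zero.1 (show psi1 ε μ E 1 *
    (flux2 ε μ E 1 - psi1 ε μ E 1) = 0 by linear_combination h9 + h1)).resolve_right hne'
  have hd : flux2 ε μ E 1 = 0 := (mul_eq_zero.1 (show flux2 ε μ E 1 *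
    (flux2 ε μ E 1 - psi1 ε μ E 1) = 0 by linear_combination -h9 - h4)).resolve_right hne'
  exact hne (hd.trans ha.symm)

theorem psi1_add_one (E x : ℝ) :
    psi1 ε μ E (x + 1) = monoA ε μ E * psi1 ε μ E x + monoC ε μ E * psi2 ε μ E x :=
  (h.psi_add_one' E x).1

theorem psi2_add_one (E x : ℝ) :
    psi2 ε μ E (x + 1) = monoB ε μ E * psi1 ε μ E x + monoA ε μ E * psi2 ε μ E x := by
  rw [← h.flux2_one]
  exact (h.psi_add_one' E x).2.2.1

theorem psi1_one_sub (E x : ℝ) :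
    psi1 ε μ E (1 - x) = monoA ε μ E * psi1 ε μ E x - monoC ε μ E * psi2 ε μ E x := by
  rw [show 1 - x = -x + 1 by ring, h.psi1_add_one, h.psi1_neg, h.psi2_neg]
  ring

theorem psi2_one_sub (E x : ℝ) :
    psi2 ε μ E (1 - x) = monoB ε μ E * psi1 ε μ E x - monoA ε μ E * psi2 ε μ E x := by
  rw [show 1 - x = -x + 1 by ring, h.psi2_add_one, h.psi1_neg, h.psi2_neg]
  ring

theorem discriminant_eq (E : ℝ) : discriminant ε μ E = 2 * monoA ε μ E := by
  rw [discriminant, h.flux2_one]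
  ring

theorem monoA_sq (E : ℝ) : monoA ε μ E ^ 2 = 1 + monoB ε μ E * monoC ε μ E := by
  have := det_fundamental h.eps.isTame h.mu.isTame E 1
  rw [h.flux2_one] at this
  linear_combination this

/-- The two diagonal entries coincide for all energies, hence so do their derivatives. The relation
eliminates the mixed integral from a' and leaves a form whose sign can be read off from b and c. -/
theorem gram_relation (E : ℝ) : 2 * (monoA ε μ E * gram12 ε μ E 1) =
    monoB ε μ E * gram11 ε μ E 1 + monoC ε μ E * gram22 ε μ E 1 := by
  have h1 := hasDerivAt_psi1 h.eps.isTame h.mu.isTame E 1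
  have h2 := hasDerivAt_flux2 h.eps.isTame h.mu.isTame E 1
  simp only [h.flux2_one] at h2
  linear_combination h1.unique h2

theorem hasDerivAt_monoA (E : ℝ) : HasDerivAt (monoA ε μ)
    ((monoC ε μ E * gram22 ε μ E 1 - monoB ε μ E * gram11 ε μ E 1) / 2) E := by
  refine (hasDerivAt_psi1 h.eps.isTame h.mu.isTame E 1).congr_deriv ?_
  linear_combination (1 / 2) * h.gram_relation E

theorem hasDerivAt_monoB (E : ℝ) : HasDerivAt (monoB ε μ)
    (monoA ε μ E * gram22 ε μ E 1 - monoB ε μ E * gram12 ε μ E 1) E :=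
  hasDerivAt_psi2 h.eps.isTame h.mu.isTame E 1

theorem hasDerivAt_monoC (E : ℝ) : HasDerivAt (monoC ε μ)
    (monoC ε μ E * gram12 ε μ E 1 - monoA ε μ E * gram11 ε μ E 1) E := by
  rw [← h.flux2_one]
  exact hasDerivAt_flux1 h.eps.isTame h.mu.isTame E 1

theorem continuous_monoA : Continuous (monoA ε μ) :=
  continuous_iff_continuousAt.2 fun E => (h.hasDerivAt_monoA E).continuousAt
theorem continuous_monoB : Continuous (monoB ε μ) :=
  continuous_iff_continuousAt.2 fun E => (h.hasDerivAt_monoB E).continuousAt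
theorem continuous_monoC : Continuous (monoC ε μ) :=
  continuous_iff_continuousAt.2 fun E => (h.hasDerivAt_monoC E).continuousAt

omit h in
theorem integral_mul_pos {w f : ℝ → ℝ} (hw : IsTame w) (hpos : ∀ x, 0 < w x) (hf : Continuous f)
    (hf0 : ∀ x, 0 ≤ f x) (hx : ∃ x ∈ Ioo (0 : ℝ) 1, f x ≠ 0) :
    0 < ∫ t in (0 : ℝ)..1, w t * f t := by
  rw [intervalIntegral.integral_pos_iff_support_of_nonneg_ae
    (Eventually.of_forall fun x => mul_nonneg (hpos x).le (hf0 x))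
    (hw.intervalIntegrable_mul hf 0 1)]
  refine ⟨zero_lt_one, ?_⟩
  have hs : Function.support (fun t => w t * f t) = Function.support f := by
    ext t; simp [(hpos t).ne']
  rw [hs]
  have ho : IsOpen (Function.support f ∩ Ioo 0 1) := hf.isOpen_support.inter isOpen_Ioo
  obtain ⟨x, hx1, hx2⟩ := hx
  refine (ho.measure_pos volume ⟨x, hx2, hx1⟩).trans_le (measure_mono ?_)
  exact inter_subset_inter_right _ Ioo_subset_Ioc_self

omit h in
theorem exists_ne_zero_of_flux_ne_zero {E : ℝ} {u p : ℝ → ℝ} (hε : IsTame ε) (hμ : IsTame μ)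
    (hμpos : ∀ x, 0 < μ x) (hs : IsSolution ε μ E u p) (hne : ∀ x, u x = 0 → p x ≠ 0) :
    ∃ x ∈ Ioo (0 : ℝ) 1, u x ≠ 0 := by
  by_contra! hu
  obtain ⟨S, hS, hd⟩ := hs.exists_hasDerivAt hε hμ
  obtain ⟨x, hx1, hx2⟩ := (hS.dense_compl ℝ).exists_mem_open isOpen_Ioo (nonempty_Ioo.2 one_pos)
  have h1 := (hd x hx1).1
  have h2 : HasDerivAt u 0 x := by
    refine (hasDerivAt_const x (0 : ℝ)).congr_of_eventuallyEq ?_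
    filter_upwards [isOpen_Ioo.mem_nhds hx2] with y hy using hu y hy
  have h3 := h1.unique h2
  exact hne x (hu x hx2) ((mul_eq_zero.1 h3).resolve_left (hμpos x).ne')

theorem exists_psi1_ne_zero (E : ℝ) : ∃ x ∈ Ioo (0 : ℝ) 1, psi1 ε μ E x ≠ 0 :=
  exists_ne_zero_of_flux_ne_zero h.eps.isTame h.mu.isTame h.mu.pos
    (isSolution_psi1 h.eps.isTame h.mu.isTame E) fun x h0 h1 => by
      have := det_fundamental h.eps.isTame h.mu.isTame E x
      simp [h0, h1] at this

theorem exists_psi2_ne_zero (E : ℝ) : ∃ x ∈ Ioo (0 : ℝ) 1, psi2 ε μ E x ≠ 0 :=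
  exists_ne_zero_of_flux_ne_zero h.eps.isTame h.mu.isTame h.mu.pos
    (isSolution_psi2 h.eps.isTame h.mu.isTame E) fun x h0 h1 => by
      have := det_fundamental h.eps.isTame h.mu.isTame E x
      simp [h0, h1] at this

theorem gram11_pos (E : ℝ) : 0 < gram11 ε μ E 1 := by
  obtain ⟨x, hx, hx'⟩ := h.exists_psi1_ne_zero E
  exact integral_mul_pos h.eps.isTame h.eps.pos ((h.continuous_psi1 E).mul (h.continuous_psi1 E))
    (fun x => mul_self_nonneg _) ⟨x, hx, mul_self_ne_zero.2 hx'⟩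

theorem gram22_pos (E : ℝ) : 0 < gram22 ε μ E 1 := by
  obtain ⟨x, hx, hx'⟩ := h.exists_psi2_ne_zero E
  exact integral_mul_pos h.eps.isTame h.eps.pos ((h.continuous_psi2 E).mul (h.continuous_psi2 E))
    (fun x => mul_self_nonneg _) ⟨x, hx, mul_self_ne_zero.2 hx'⟩

/-! ### The discriminant at and below zero energy -/

theorem integral_mu_pos : 0 < ∫ t in (0 : ℝ)..1, μ t := by
  simpa using integral_mul_pos (f := fun _ => 1) h.mu.isTame h.mu.pos continuous_const
    (fun _ => zero_le_one) ⟨1 / 2, ⟨by norm_num, by norm_num⟩, one_ne_zero⟩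

theorem monoA_zero : monoA ε μ 0 = 1 := by
  have h1 := isSolution_psi1 h.eps.isTame h.mu.isTame 0
  have h2 : ∀ x, flux1 ε μ 0 x = 0 := fun x => by
    rw [h1.flux_eq, flux1_zero h.eps.isTame h.mu.isTame]; simp
  rw [monoA, h1.fst_eq, h.psi1_zero]
  simp [h2]

theorem monoC_zero : monoC ε μ 0 = 0 := by
  rw [monoC, (isSolution_psi1 h.eps.isTame h.mu.isTame 0).flux_eq,
    flux1_zero h.eps.isTame h.mu.isTame]
  simp

theorem monoB_zero_pos : 0 < monoB ε μ 0 := by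
  have h1 := isSolution_psi2 h.eps.isTame h.mu.isTame 0
  have h2 : ∀ x, flux2 ε μ 0 x = 1 := fun x => by
    rw [h1.flux_eq, flux2_zero h.eps.isTame h.mu.isTame]; simp
  rw [monoB, h1.fst_eq, h.psi2_zero]
  simpa [h2] using h.integral_mu_pos

theorem cauchyCoeff_nonneg (n : ℕ) : ∀ x, 0 ≤ x → 0 ≤ (cauchyCoeff ε μ 1 0 n).1 x ∧
    0 ≤ (cauchyCoeff ε μ 1 0 n).2 x := by
  induction n with
  | zero => intro x _; simp [cauchyCoeff]
  | succ n ih =>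
    have h2 : ∀ x, 0 ≤ x → 0 ≤ (cauchyCoeff ε μ 1 0 (n + 1)).2 x := fun x hx =>
      intervalIntegral.integral_nonneg hx fun t ht => mul_nonneg (h.eps.pos t).le (ih t ht.1).1
    refine fun x hx => ⟨?_, h2 x hx⟩
    exact intervalIntegral.integral_nonneg hx fun t ht => mul_nonneg (h.mu.pos t).le (h2 t ht.1)

/-- For E < 0 the series in powers of -E has non-negative terms; the zeroth is 1 and the first is
positive. Therefore no spectrum lies below zero. -/
theorem one_lt_monoA_of_neg {E : ℝ} (hE : E < 0) : 1 < monoA ε μ E := by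
  have hε := h.eps.isTame
  have hμ := h.mu.isTame
  have h1 : monoA ε μ E = ∑' n, (-E) ^ n * (cauchyCoeff ε μ 1 0 n).1 1 := by
    rw [monoA, psi1, cauchySolution_eq_series hε hμ]; rfl
  have h2 : 0 < (cauchyCoeff ε μ 1 0 1).1 1 := by
    refine intervalIntegral.intervalIntegral_pos_of_pos_on ?_ (fun t ht => ?_) one_pos
    · exact hμ.intervalIntegrable_mul (continuous_cauchyCoeff hε hμ 1 0 1).2 0 1
    · refine mul_pos (h.mu.pos t) ?_
      refine intervalIntegral.intervalIntegral_pos_of_pos_on ?_ (fun s _ => ?_) ht.1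
      · exact hε.intervalIntegrable_mul (continuous_cauchyCoeff hε hμ 1 0 0).1 0 t
      · simpa [cauchyCoeff] using h.eps.pos s
  have h3 := (summable_cauchyCoeff hε hμ 1 0 E 1).1.sum_le_tsum (Finset.range 2) fun n _ =>
    mul_nonneg (pow_nonneg (by linarith) n) (h.cauchyCoeff_nonneg n 1 zero_le_one).1
  rw [← h1, Finset.sum_range_succ, Finset.sum_range_one] at h3
  have h4 : (cauchyCoeff ε μ 1 0 0).1 1 = 1 := by simp [cauchyCoeff]
  have h5 : 0 < (-E) * (cauchyCoeff ε μ 1 0 1).1 1 := mul_pos (by linarith) h2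
  rw [h4, pow_zero, pow_one] at h3
  linarith

/-! ### Critical points of the discriminant -/

theorem mul_neg_of_abs_lt {E : ℝ} (hE : |monoA ε μ E| < 1) : monoB ε μ E * monoC ε μ E < 0 := by
  have h1 := h.monoA_sq E
  have h2 : monoA ε μ E ^ 2 < 1 := (sq_lt_one_iff_abs_lt_one _).2 hE
  linarith

/-- Here bc < 0 while both Gram integrals are positive, so the two terms of the derivative have the
same sign and cannot cancel. -/
theorem deriv_ne_zero_of_abs_lt {E : ℝ} (hE : |monoA ε μ E| < 1) :
    (monoC ε μ E * gram22 ε μ E 1 - monoB ε μ E * gram11 ε μ E 1) / 2 ≠ 0 := by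
  have h1 := h.mul_neg_of_abs_lt hE
  have hA := h.gram11_pos E
  have hB := h.gram22_pos E
  intro h0
  have h2 : monoC ε μ E * gram22 ε μ E 1 = monoB ε μ E * gram11 ε μ E 1 := by linarith
  have h3 : monoB ε μ E * monoC ε μ E * gram22 ε μ E 1 = monoB ε μ E ^ 2 * gram11 ε μ E 1 := by
    linear_combination monoB ε μ E * h2
  have h4 : monoB ε μ E * monoC ε μ E * gram22 ε μ E 1 < 0 := mul_neg_of_neg_of_pos h1 hB
  have h5 : 0 ≤ monoB ε μ E ^ 2 * gram11 ε μ E 1 := by positivity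
  linarith

/-- One of b, c vanishes, and then a' is a non-zero multiple of the other. -/
theorem eq_zero_of_deriv_eq_zero {E : ℝ} (hE : monoB ε μ E * monoC ε μ E = 0)
    (h0 : (monoC ε μ E * gram22 ε μ E 1 - monoB ε μ E * gram11 ε μ E 1) / 2 = 0) :
    monoB ε μ E = 0 ∧ monoC ε μ E = 0 := by
  have hA := (h.gram11_pos E).ne'
  have hB := (h.gram22_pos E).ne'
  rcases mul_eq_zero.1 hE with h1 | h1
  · refine ⟨h1, ?_⟩
    rw [h1] at h0
    simpa [hB] using h0
  · refine ⟨?_, h1⟩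
    rw [h1] at h0
    simpa [hA] using h0

/-- At a common zero a² = 1, and b and c have the derivatives a∫εψ₂² and -a∫εψ₁², of opposite signs.
Their product is negative to second order, so band energies lie on both sides and the gap is closed.
-/
theorem eventually_mul_neg {E : ℝ} (hb : monoB ε μ E = 0) (hc : monoC ε μ E = 0) :
    ∀ᶠ E' in 𝓝[≠] E, monoB ε μ E' * monoC ε μ E' < 0 := by
  have h1 := (hasDerivAt_iff_tendsto_slope.1 (h.hasDerivAt_monoB E)).mul
    (hasDerivAt_iff_tendsto_slope.1 (h.hasDerivAt_monoC E))
  have ha := h.monoA_sq E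
  rw [hb, hc] at h1
  rw [hb, zero_mul, add_zero] at ha
  have h2 : (monoA ε μ E * gram22 ε μ E 1 - 0 * gram12 ε μ E 1) *
      (0 * gram12 ε μ E 1 - monoA ε μ E * gram11 ε μ E 1) < 0 := by
    have : 0 < gram11 ε μ E 1 * gram22 ε μ E 1 := mul_pos (h.gram11_pos E) (h.gram22_pos E)
    calc _ = -(monoA ε μ E ^ 2 * (gram11 ε μ E 1 * gram22 ε μ E 1)) := by ring
      _ < 0 := by rw [ha]; linarith
  filter_upwards [h1.eventually (gt_mem_nhds h2), self_mem_nhdsWithin] with E' h3 h4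
  rw [slope_def_field, slope_def_field, hb, hc, sub_zero, sub_zero, div_mul_div_comm] at h3
  have h5 : 0 < (E' - E) * (E' - E) := mul_self_pos.2 (sub_ne_zero.2 h4)
  by_contra! h6
  exact absurd h3 (not_lt.2 (div_nonneg h6 h5.le))

/-! ### Bloch solutions -/

theorem isBlochSolution_iff (k E : ℝ) (u : ℝ → ℂ) : IsBlochSolution ε μ k E u ↔
    ∃ α β : ℂ, (u = fun x => α * psi1 ε μ E x + β * psi2 ε μ E x) ∧
      α * monoA ε μ E + β * monoB ε μ E = Complex.exp (Complex.I * k) * α ∧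
      α * monoC ε μ E + β * monoA ε μ E = Complex.exp (Complex.I * k) * β := by
  have hε := h.eps.isTame
  have hμ := h.mu.isTame
  constructor
  · rintro ⟨⟨p, hp⟩, hq⟩
    have hu : u = fun x => u 0 * psi1 ε μ E x + p 0 * psi2 ε μ E x := by
      funext x
      rw [(hp.eq_psi hε hμ x).1]
      simp [mul_comm]
    refine ⟨u 0, p 0, hu, ?_⟩
    set z := Complex.exp (Complex.I * k)
    set α := u 0
    set β := p 0
    have h1 : ∀ x, (α * monoA ε μ E + β * monoB ε μ E - z * α) * psi1 ε μ E x +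
        (α * monoC ε μ E + β * monoA ε μ E - z * β) * psi2 ε μ E x = 0 := by
      intro x
      have := hq x
      rw [congrFun hu (x + 1), congrFun hu x, h.psi1_add_one, h.psi2_add_one] at this
      push_cast at this
      linear_combination this
    have h2 := h1 0
    rw [h.psi1_zero, h.psi2_zero] at h2
    have h3 : α * monoA ε μ E + β * monoB ε μ E - z * α = 0 := by simpa using h2
    refine ⟨sub_eq_zero.1 h3, ?_⟩
    obtain ⟨x, _, hx⟩ := h.exists_psi2_ne_zero E
    have h4 := h1 x
    rw [h3, zero_mul, zero_add, mul_eq_zero] at h4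
    exact sub_eq_zero.1 (h4.resolve_right (by exact_mod_cast hx))
  · rintro ⟨α, β, rfl, h1, h2⟩
    refine ⟨⟨_, isSolution_combination hε hμ E α β⟩, fun x => ?_⟩
    beta_reduce
    rw [h.psi1_add_one, h.psi2_add_one]
    push_cast
    linear_combination (psi1 ε μ E x : ℂ) * h1 + (psi2 ε μ E x : ℂ) * h2

omit h in
theorem exp_I_mul (k : ℝ) : Complex.exp (Complex.I * k) = Real.cos k + Real.sin k * Complex.I := by
  rw [mul_comm, Complex.exp_mul_I, Complex.ofReal_cos, Complex.ofReal_sin]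

/-- The Cauchy data form an eigenvector with eigenvalue z = exp(ik). Cayley-Hamilton gives z² - 2az
+ 1 = 0, to be compared with z² + 1 = 2z cos k. -/
theorem monoA_eq_cos {k E : ℝ} {u : ℝ → ℂ} (hu : IsBlochSolution ε μ k E u) (hu0 : u ≠ 0) :
    monoA ε μ E = Real.cos k := by
  obtain ⟨α, β, rfl, h1, h2⟩ := (h.isBlochSolution_iff k E u).1 hu
  set z := Complex.exp (Complex.I * k) with hz
  have hsq : (monoA ε μ E : ℂ) ^ 2 = 1 + monoB ε μ E * monoC ε μ E := by
    exact_mod_cast h.monoA_sq E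
  have h3 : (z ^ 2 - 2 * monoA ε μ E * z + 1) * α = 0 := by
    linear_combination (monoA ε μ E - z : ℂ) * h1 - (monoB ε μ E : ℂ) * h2 - α * hsq
  have h4 : (z ^ 2 - 2 * monoA ε μ E * z + 1) * β = 0 := by
    linear_combination (monoA ε μ E - z : ℂ) * h2 - (monoC ε μ E : ℂ) * h1 - β * hsq
  have h5 : z ^ 2 - 2 * monoA ε μ E * z + 1 = 0 := by
    by_contra hne
    have hα := (mul_eq_zero.1 h3).resolve_left hne
    have hβ := (mul_eq_zero.1 h4).resolve_left hne
    exact hu0 (by funext x; simp [hα, hβ])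
  have h6 : z ^ 2 + 1 = 2 * Real.cos k * z := by
    have hcs : (Real.cos k : ℂ) ^ 2 + Real.sin k ^ 2 = 1 := by
      exact_mod_cast Real.cos_sq_add_sin_sq k
    rw [hz, exp_I_mul]
    linear_combination (-(1 : ℂ)) * hcs + (Real.sin k : ℂ) ^ 2 * Complex.I_sq
  have h7 : 2 * (Real.cos k - monoA ε μ E : ℂ) * z = 0 := by linear_combination h5 - h6
  have h8 : (Real.cos k - monoA ε μ E : ℂ) = 0 := by simpa [hz, Complex.exp_ne_zero] using h7
  have h9 : (Real.cos k : ℂ) = monoA ε μ E := sub_eq_zero.1 h8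
  exact_mod_cast h9.symm

/-- Bloch solutions with the same wavenumber and different energies are orthogonal. -/
theorem cellInner_eq_zero {k E E' : ℝ} (hE : E ≠ E') {u v : ℝ → ℂ}
    (hu : IsBlochSolution ε μ k E u) (hv : IsBlochSolution ε μ k E' v) :
    cellInner ε u v = 0 := by
  have hε := h.eps.isTame
  have hμ := h.mu.isTame
  obtain ⟨α, β, rfl, h1, h2⟩ := (h.isBlochSolution_iff k E u).1 hu
  obtain ⟨α', β', rfl, h3, h4⟩ := (h.isBlochSolution_iff k E' v).1 hv
  have hv' := (isSolution_combination hε hμ E' α' β').clm_comp hε hμ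
    (Complex.conjCLE : ℂ →L[ℝ] ℂ)
  have hw := (isSolution_combination hε hμ E α β).wronskian_eq hε hμ hv' 1
  simp only [ContinuousLinearEquiv.coe_coe, Complex.conjCLE_apply, h.psi1_zero, h.psi2_zero,
    flux1_zero hε hμ, flux2_zero hε hμ, h.flux2_one] at hw
  rw [h1, h2, h3, h4] at hw
  -- Since the Floquet multiplier has modulus one, the Wronskian of u and the conjugate of v takes
  -- the same value at 0 and at 1, and Lagrange's identity leaves only the inner product.
  have hz : Complex.exp (Complex.I * k) * (starRingEnd ℂ) (Complex.exp (Complex.I * k)) = 1 := by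
    rw [Complex.mul_conj, Complex.normSq_eq_norm_sq, mul_comm, Complex.norm_exp_ofReal_mul_I]
    simp
  simp only [map_mul, map_add, Complex.ofReal_one, Complex.ofReal_zero, mul_one, mul_zero,
    add_zero, zero_add] at hw
  have h5 : (E - E') • cellInner ε (fun x => α * psi1 ε μ E x + β * psi2 ε μ E x)
      (fun x => α' * psi1 ε μ E' x + β' * psi2 ε μ E' x) = 0 := by
    have h6 : cellInner ε (fun x => α * psi1 ε μ E x + β * psi2 ε μ E x)
      (fun x => α' * psi1 ε μ E' x + β' * psi2 ε μ E' x) =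
      ∫ t in (0 : ℝ)..1, ε t • ((α * psi1 ε μ E t + β * psi2 ε μ E t) *
      ((starRingEnd ℂ) α' * (starRingEnd ℂ) (psi1 ε μ E' t : ℂ) +
        (starRingEnd ℂ) β' * (starRingEnd ℂ) (psi2 ε μ E' t : ℂ))) := by
      simp [cellInner]
    rw [h6]
    linear_combination (α * (starRingEnd ℂ) β' - β * (starRingEnd ℂ) α') * hz - hw
  exact (smul_eq_zero.1 h5).resolve_left (sub_ne_zero.2 hE)

end IsSymmetricMedium

/-! ### Bands and gaps of the discriminant -/

/-- `[l, u]` is a spectral band on which half the discriminant runs from `s = ±1` to `-s`. -/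
structure IsBand (ε μ : ℝ → ℝ) (s l u : ℝ) : Prop where
  sign : s = 1 ∨ s = -1
  lt : l < u
  lower : monoA ε μ l = s
  upper : monoA ε μ u = -s
  abs_lt : ∀ E ∈ Ioo l u, |monoA ε μ E| < 1

/-- `(u, l)` is a (possibly empty) spectral gap in which half the discriminant has sign `s`. -/
structure IsGap (ε μ : ℝ → ℝ) (s u l : ℝ) : Prop where
  le : u ≤ l
  one_lt : ∀ E ∈ Ioo u l, 1 < s * monoA ε μ E

/-- The first `n` bands, `[L j, U j]`, `1 ≤ j ≤ n`, and the gaps between them. -/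
structure BandChain (ε μ : ℝ → ℝ) (n : ℕ) (L U : ℕ → ℝ) : Prop where
  zero : L 1 = 0
  band : ∀ j, 1 ≤ j → j ≤ n → IsBand ε μ ((-1) ^ (j + 1)) (L j) (U j)
  gap : ∀ j, 1 ≤ j → j < n → IsGap ε μ ((-1) ^ j) (U j) (L (j + 1))

theorem mul_self_of_sign {s : ℝ} (hs : s = 1 ∨ s = -1) : s * s = 1 := by
  rcases hs with rfl | rfl <;> norm_num

theorem neg_one_pow_sign (n : ℕ) : (-1 : ℝ) ^ n = 1 ∨ (-1 : ℝ) ^ n = -1 := neg_one_pow_eq_or ℝ n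

namespace IsSymmetricMedium

variable {ε μ : ℝ → ℝ} (h : IsSymmetricMedium ε μ)
include h

theorem hasDerivAt_mul_monoA (s E : ℝ) : HasDerivAt (fun E => s * monoA ε μ E)
    (s * ((monoC ε μ E * gram22 ε μ E 1 - monoB ε μ E * gram11 ε μ E 1) / 2)) E :=
  (h.hasDerivAt_monoA E).const_mul s

theorem continuous_mul_monoA (s : ℝ) : Continuous fun E => s * monoA ε μ E :=
  continuous_const.mul h.continuous_monoA

omit h in
theorem abs_mul_of_sign {s : ℝ} (hs : s = 1 ∨ s = -1) (x : ℝ) : |s * x| = |x| := by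
  rcases hs with rfl | rfl <;> simp

/-- If half the discriminant, up to sign, has a local minimum with value at most `1` and above `-1`,
the minimum is less than one nearby. -/
theorem not_isLocalMin {s E : ℝ} (hs : s = 1 ∨ s = -1) (h1 : -1 < s * monoA ε μ E)
    (h2 : s * monoA ε μ E ≤ 1) : ¬IsLocalMin (fun E => s * monoA ε μ E) E := by
  intro hmin
  have hd := hmin.hasDerivAt_eq_zero (h.hasDerivAt_mul_monoA s E)
  have hs0 : s ≠ 0 := by rcases hs with rfl | rfl <;> norm_num
  have hd := (mul_eq_zero.1 hd).resolve_left hs0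
  -- Strictly between -1 and 1 the derivative of a cannot vanish. At the value 1 a critical point
  -- has b = c = 0, and then |a| < 1 nearby, so the point is no minimum.
  rcases h2.lt_or_eq with h2 | h2
  · exact h.deriv_ne_zero_of_abs_lt (by rw [← abs_mul_of_sign hs]; exact abs_lt.2 ⟨h1, h2⟩) hd
  · have ha : monoA ε μ E ^ 2 = 1 := by
      linear_combination (s * monoA ε μ E + 1) * h2 - monoA ε μ E ^ 2 * mul_self_of_sign hs
    have h3 := h.monoA_sq E
    obtain ⟨hb, hc⟩ := h.eq_zero_of_deriv_eq_zero (by linarith) hd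
    obtain ⟨E', h4, h5⟩ := ((h.eventually_mul_neg hb hc).and
      (hmin.filter_mono nhdsWithin_le_nhds)).exists
    have h6 := h.monoA_sq E'
    have h7 : |s * monoA ε μ E'| < 1 := by
      rw [abs_mul_of_sign hs, ← sq_lt_one_iff_abs_lt_one]; linarith
    beta_reduce at h5
    linarith [(abs_lt.1 h7).2]

/-- Beyond a point where half the discriminant is `s = ±1` there is a gap followed by a band, if
half the discriminant reaches `-s`. -/
theorem exists_next_band {s u₀ : ℝ} (hs : s = 1 ∨ s = -1) (hu : monoA ε μ u₀ = s)
    (hE : ∃ E > u₀, monoA ε μ E = -s) : ∃ l u, IsGap ε μ s u₀ l ∧ IsBand ε μ s l u := by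
  have hss := mul_self_of_sign hs
  set f : ℝ → ℝ := fun E => s * monoA ε μ E with hf
  have hfc : Continuous f := h.continuous_mul_monoA s
  have hf_iff : ∀ E, f E = -1 ↔ monoA ε μ E = -s := fun E => by
    rw [hf]; rcases hs with rfl | rfl <;> constructor <;> intro hh <;> simp at * <;> linarith
  have hf_iff' : ∀ E, f E = 1 ↔ monoA ε μ E = s := fun E => by
    rw [hf]; rcases hs with rfl | rfl <;> constructor <;> intro hh <;> simp at * <;> linarith
  have hfu : f u₀ = 1 := (hf_iff' _).2 hu
  obtain ⟨E₁, hE₁, hE₁'⟩ := hE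
  -- The band ends at u, the first energy after u₀ with s·a = -1, and starts at l, the last energy
  -- before u with s·a = 1.
  let T : Set ℝ := {E | u₀ ≤ E ∧ f E = -1}
  have hTc : IsClosed T := (isClosed_Ici (a := u₀)).inter (isClosed_eq hfc continuous_const)
  have hTne : T.Nonempty := ⟨E₁, hE₁.le, (hf_iff _).2 hE₁'⟩
  have hTb : BddBelow T := ⟨u₀, fun E hE => hE.1⟩
  obtain ⟨hu1, hu2⟩ : sInf T ∈ T := hTc.csInf_mem hTne hTb
  set u := sInf T with hudef
  have hmin : ∀ E, u₀ ≤ E → E < u → -1 < f E := by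
    intro E h1 h2
    by_contra! h3
    obtain ⟨y, hy1, hy2⟩ := intermediate_value_Icc' h1 hfc.continuousOn
      (show (-1 : ℝ) ∈ Icc (f E) (f u₀) from ⟨h3, by rw [hfu]; norm_num⟩)
    exact absurd (csInf_le hTb ⟨hy1.1, hy2⟩) (not_le.2 (hy1.2.trans_lt h2))
  let V : Set ℝ := {E | E ∈ Icc u₀ u ∧ f E = 1}
  have hVc : IsClosed V := (isClosed_Icc (a := u₀)).inter (isClosed_eq hfc continuous_const)
  have hVb : BddAbove V := ⟨u, fun E hE => hE.1.2⟩
  obtain ⟨⟨hl1, hl2⟩, hl3⟩ : sSup V ∈ V := hVc.csSup_mem ⟨u₀, ⟨le_rfl, hu1⟩, hfu⟩ hVb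
  set l := sSup V
  have hlu : l < u := lt_of_le_of_ne hl2 fun hlu => by rw [hlu, hu2] at hl3; norm_num at hl3
  have hmax : ∀ E, l < E → E ≤ u → f E < 1 := by
    intro E h1 h2
    by_contra! h3
    obtain ⟨y, hy1, hy2⟩ := intermediate_value_Icc' h2 hfc.continuousOn
      (show (1 : ℝ) ∈ Icc (f u) (f E) from ⟨by rw [hu2]; norm_num, h3⟩)
    exact absurd (le_csSup hVb ⟨⟨hl1.trans (h1.le.trans hy1.1), hy1.2⟩, hy2⟩)
      (not_le.2 (h1.trans_le hy1.1))
  -- If s·a fell below 1 between u₀ and l, where it equals 1, its minimum there would be interior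
  -- with value in (-1, 1), which `not_isLocalMin` forbids.
  have hge : ∀ E ∈ Icc u₀ l, 1 ≤ f E := by
    obtain ⟨x, hx, hx'⟩ := isCompact_Icc.exists_isMinOn (nonempty_Icc.2 hl1) hfc.continuousOn
    by_contra! hc
    obtain ⟨E, hE, hE'⟩ := hc
    have h1 : f x < 1 := (hx' hE).trans_lt hE'
    have hxu : x ≠ u₀ := fun hh => by rw [hh, hfu] at h1; exact lt_irrefl _ h1
    have hxl : x ≠ l := fun hh => by rw [hh, hl3] at h1; exact lt_irrefl _ h1
    have hxi : x ∈ Ioo u₀ l := ⟨lt_of_le_of_ne hx.1 hxu.symm, lt_of_le_of_ne hx.2 hxl⟩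
    exact h.not_isLocalMin hs (hmin x hx.1 (hx.2.trans_lt hlu)) h1.le
      (hx'.isLocalMin (Icc_mem_nhds hxi.1 hxi.2))
  refine ⟨l, u, ⟨hl1, fun E hE => ?_⟩, ⟨hs, hlu, (hf_iff' _).1 hl3, (hf_iff _).1 hu2,
    fun E hE => ?_⟩⟩
  · refine lt_of_le_of_ne (hge E ⟨hE.1.le, hE.2.le⟩) fun heq => ?_
    refine h.not_isLocalMin hs (E := E) (by rw [← heq]; norm_num) heq.ge ?_
    filter_upwards [Icc_mem_nhds hE.1 hE.2] with y hy
    rw [← heq]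
    exact hge y hy
  · rw [← abs_mul_of_sign hs]
    exact abs_lt.2 ⟨hmin E (hl1.trans hE.1.le) hE.2, hmax E hE.1 hE.2.le⟩

/-- The spectrum starts at zero energy. -/
theorem eq_zero_of_isGap {l : ℝ} (hg : IsGap ε μ 1 0 l) : l = 0 := by
  by_contra hne
  have hl : 0 < l := lt_of_le_of_ne hg.le (Ne.symm hne)
  -- At zero energy a = 1, c = 0 and b > 0, so a' < 0 and a drops below 1 at once; an open gap would
  -- keep it above 1.
  have h1 := (hasDerivAt_iff_tendsto_slope.1 (h.hasDerivAt_monoA 0)).mono_left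
    (nhdsWithin_mono 0 (fun x (hx : 0 < x) => ne_of_gt hx) : 𝓝[>] (0 : ℝ) ≤ _)
  rw [h.monoC_zero, zero_mul, zero_sub] at h1
  have h2 : -(monoB ε μ 0 * gram11 ε μ 0 1) / 2 < 0 := by
    have := mul_pos h.monoB_zero_pos (h.gram11_pos 0)
    linarith
  obtain ⟨E, h3, h4⟩ := ((h1.eventually (gt_mem_nhds h2)).and (Ioo_mem_nhdsGT hl)).exists
  have h5 := hg.one_lt E h4
  rw [slope_def_field, h.monoA_zero, sub_zero, div_lt_iff₀ h4.1] at h3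
  linarith

/-! ### Properties of a single band -/

section Band

variable {s l u : ℝ}

theorem strictAntiOn_of_isBand (hb : IsBand ε μ s l u) :
    StrictAntiOn (fun E => s * monoA ε μ E) (Icc l u) := by
  have hss := mul_self_of_sign hb.sign
  refine ContinuousOn.strictAntiOn_of_injOn_Icc hb.lt.le ?_ (h.continuous_mul_monoA s).continuousOn ?_
  · rw [hb.lower, hb.upper]; linarith
  · have key : ∀ x ∈ Icc l u, ∀ y ∈ Icc l u, x < y → s * monoA ε μ x ≠ s * monoA ε μ y := by
      intro x hx y hy hxy heq
      obtain ⟨c, hc, hc'⟩ := exists_hasDerivAt_eq_zero hxy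
        (h.continuous_mul_monoA s).continuousOn heq fun E _ => h.hasDerivAt_mul_monoA s E
      have hs0 : s ≠ 0 := by rcases hb.sign with rfl | rfl <;> norm_num
      exact h.deriv_ne_zero_of_abs_lt (hb.abs_lt c ⟨hx.1.trans_lt hc.1, hc.2.trans_le hy.2⟩)
        ((mul_eq_zero.1 hc').resolve_left hs0)
    intro x hx y hy heq
    rcases lt_trichotomy x y with h1 | h1 | h1
    exacts [absurd heq (key x hx y hy h1), h1, absurd heq.symm (key y hy x hx h1)]

theorem eq_of_isBand (hb : IsBand ε μ s l u) {x y : ℝ} (hx : x ∈ Icc l u) (hy : y ∈ Icc l u)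
    (hxy : monoA ε μ x = monoA ε μ y) : x = y :=
  (h.strictAntiOn_of_isBand hb).injOn hx hy (by rw [hxy])

/-- On the band s·a decreases, so s(c∫εψ₂² - b∫εψ₁²) ≤ 0. As b and c have opposite signs, only one
assignment is compatible with this. -/
theorem sign_of_isBand (hb : IsBand ε μ s l u) {E : ℝ} (hE : E ∈ Ioo l u) :
    0 < s * monoB ε μ E ∧ s * monoC ε μ E < 0 := by
  have hA := h.gram11_pos E
  have hB := h.gram22_pos E
  have hss := mul_self_of_sign hb.sign
  have h1 := h.mul_neg_of_abs_lt (hb.abs_lt E hE)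
  have h2 : s * monoC ε μ E * gram22 ε μ E 1 ≤ s * monoB ε μ E * gram11 ε μ E 1 := by
    have hanti : MonotoneOn (fun E => -s * monoA ε μ E) (Icc l u) := by
      have := (h.strictAntiOn_of_isBand hb).antitoneOn.neg
      simpa [← neg_mul] using this
    have hmem := Icc_mem_nhds hE.1 hE.2
    have := (h.hasDerivAt_mul_monoA (-s) E).hasDerivWithinAt.nonneg_of_monotoneOn
      (accPt_iff_frequently.2 ?_) hanti
    · linarith
    · have : ∀ᶠ y in 𝓝[≠] E, y ≠ E ∧ y ∈ Icc l u :=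
        (eventually_mem_nhdsWithin.and (nhdsWithin_le_nhds hmem))
      exact this.frequently.filter_mono nhdsWithin_le_nhds
  have h3 : (s * monoB ε μ E) * (s * monoC ε μ E) < 0 := by
    calc _ = (s * s) * (monoB ε μ E * monoC ε μ E) := by ring
      _ < 0 := by rw [hss]; linarith
  rcases mul_neg_iff.1 h3 with h4 | h4
  · exact h4
  · have h5 := mul_pos h4.2 hB
    have h6 := mul_neg_of_neg_of_pos h4.1 hA
    linarith

theorem exists_energy_of_isBand (hb : IsBand ε μ s l u) (k : ℝ) :
    ∃ e ∈ Icc l u, monoA ε μ e = Real.cos k := by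
  have hss := mul_self_of_sign hb.sign
  have h1 : s * Real.cos k ∈ Icc (s * monoA ε μ u) (s * monoA ε μ l) := by
    rw [hb.lower, hb.upper, mul_neg, hss]
    exact abs_le.1 (by rw [abs_mul_of_sign hb.sign]; exact abs_cos_le_one k)
  obtain ⟨e, he, he'⟩ := intermediate_value_Icc' hb.lt.le
    (h.continuous_mul_monoA s).continuousOn h1
  have hs0 : s ≠ 0 := by rcases hb.sign with rfl | rfl <;> norm_num
  exact ⟨e, he, mul_left_cancel₀ hs0 he'⟩

theorem mul_eq_zero_of_sign {E : ℝ} (hs : s = 1 ∨ s = -1) (ha : monoA ε μ E = s) :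
    monoB ε μ E * monoC ε μ E = 0 := by
  have h1 := h.monoA_sq E
  have h2 := mul_self_of_sign hs
  rw [ha, sq, h2] at h1
  linarith

/-- At an edge of an open gap the monodromy matrix is not a multiple of the identity. -/
theorem not_both_zero_of_gap (hg : IsGap ε μ s u l) (hul : u < l) {E : ℝ} (hE : E = u ∨ E = l)
    (hs : s = 1 ∨ s = -1) : ¬(monoB ε μ E = 0 ∧ monoC ε μ E = 0) := by
  rintro ⟨hb, hc⟩
  have h1 := h.eventually_mul_neg hb hc
  have h2 : ∃ᶠ E' in 𝓝[≠] E, E' ∈ Ioo u l := by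
    rcases hE with rfl | rfl
    · exact (Eventually.frequently (Ioo_mem_nhdsGT hul)).filter_mono
        (nhdsWithin_mono _ fun x (hx : _ < x) => ne_of_gt hx)
    · exact (Eventually.frequently (Ioo_mem_nhdsLT hul)).filter_mono
        (nhdsWithin_mono _ fun x (hx : x < _) => ne_of_lt hx)
  obtain ⟨E', h3, h4⟩ := (h2.and_eventually h1).exists
  have h5 := h.monoA_sq E'
  have h6 : |s * monoA ε μ E'| < 1 := by
    rw [abs_mul_of_sign hs, ← sq_lt_one_iff_abs_lt_one]; linarith
  linarith [(abs_lt.1 h6).2, hg.one_lt E' h3]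

/-- Where two bands touch the monodromy matrix is a multiple of the identity. -/
theorem both_zero_of_touch {s' l' u' : ℝ} (hb : IsBand ε μ s l u) (hb' : IsBand ε μ s' l' u')
    (hul : u = l') : monoB ε μ u = 0 ∧ monoC ε μ u = 0 := by
  subst hul
  have hss : s' = -s := hb'.lower.symm.trans hb.upper
  have hs' := mul_self_of_sign hb.sign
  by_contra hne
  have h0 : monoB ε μ u * monoC ε μ u = 0 := h.mul_eq_zero_of_sign hb'.sign hb'.lower
  have hd : (monoC ε μ u * gram22 ε μ u 1 - monoB ε μ u * gram11 ε μ u 1) / 2 ≠ 0 := fun hd =>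
    hne (h.eq_zero_of_deriv_eq_zero h0 hd)
  -- On both bands s·a stays above -1 and equals -1 at the common edge. A local minimum makes a'
  -- vanish there, which forces b = c = 0.
  have hmax : IsLocalMin (fun E => s * monoA ε μ E) u := by
    filter_upwards [Ioo_mem_nhds hb.lt hb'.lt] with y hy
    rw [hb.upper, mul_neg, hs']
    rcases lt_trichotomy y u with h1 | h1 | h1
    · have := hb.abs_lt y ⟨hy.1, h1⟩
      rw [← abs_mul_of_sign hb.sign] at this
      exact (abs_lt.1 this).1.le
    · rw [h1, hb.upper, mul_neg, hs']
    · have := hb'.abs_lt y ⟨h1, hy.2⟩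
      rw [← abs_mul_of_sign hb.sign] at this
      exact (abs_lt.1 this).1.le
  have := hmax.hasDerivAt_eq_zero (h.hasDerivAt_mul_monoA s u)
  have hs0 : s ≠ 0 := by rcases hb.sign with rfl | rfl <;> norm_num
  exact hd ((mul_eq_zero.1 this).resolve_left hs0)

/-- The sign of `b` in a gap, whose lower edge is the upper edge of a band, when `b` vanishes at the
edge, and when it does not. -/
theorem sign_of_gap_lower {l' : ℝ} (hb : IsBand ε μ s l u) (hg : IsGap ε μ (-s) u l') {E : ℝ}
    (hE : E ∈ Ioo u l') :
    (monoB ε μ u = 0 → monoC ε μ u ≠ 0 ∧ 0 < (-s) * monoB ε μ E) ∧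
    (monoB ε μ u ≠ 0 → monoC ε μ u = 0 ∧ (-s) * monoB ε μ E < 0) := by
  have hs : -s = 1 ∨ -s = -1 := by rcases hb.sign with rfl | rfl <;> simp
  have hs0 : s ≠ 0 := by rcases hb.sign with rfl | rfl <;> norm_num
  have hss := mul_self_of_sign hb.sign
  have hul : u < l' := hE.1.trans hE.2
  have hne := h.not_both_zero_of_gap hg hul (Or.inl rfl) hs
  have h0 : monoB ε μ u * monoC ε μ u = 0 := h.mul_eq_zero_of_sign hs hb.upper
  have hpos : ∀ E' ∈ Ioo u l', 0 < monoB ε μ E' * monoC ε μ E' := by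
    intro E' hE'
    have h1 := h.monoA_sq E'
    have h2 := hg.one_lt E' hE'
    have h3 : 1 < ((-s) * monoA ε μ E') ^ 2 := by
      rw [one_lt_sq_iff_one_lt_abs]; exact h2.trans_le (le_abs_self _)
    have h4 : ((-s) * monoA ε μ E') ^ 2 = monoA ε μ E' ^ 2 := by
      linear_combination (monoA ε μ E' ^ 2) * hss
    linarith
  -- a continuous function that is negative at `u` and has no zero in the gap
  have key : ∀ f : ℝ → ℝ, Continuous f → (∀ E' ∈ Ioo u l', f E' ≠ 0) → f u ≠ 0 →
      (∀ E' ∈ Ioo l u, f E' ≤ 0) → f E < 0 := by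
    intro f hf hf0 hfu hfl
    have h1 : f u ≤ 0 := by
      have : u ∈ closure (Ioo l u) := by rw [closure_Ioo hb.lt.ne]; exact right_mem_Icc.2 hb.lt.le
      exact closure_minimal hfl (isClosed_le hf continuous_const) this
    have h2 := lt_of_le_of_ne h1 hfu
    by_contra! h3
    obtain ⟨y, hy, hy'⟩ := intermediate_value_Icc hE.1.le hf.continuousOn
      (show (0 : ℝ) ∈ Icc (f u) (f E) from ⟨h1, h3⟩)
    rcases eq_or_lt_of_le hy.1 with h4 | h4
    · exact hfu (h4 ▸ hy')
    · exact hf0 y ⟨h4, hy.2.trans_lt hE.2⟩ hy'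
  constructor
  · intro hbu
    have hcu : monoC ε μ u ≠ 0 := fun hc => hne ⟨hbu, hc⟩
    refine ⟨hcu, ?_⟩
    -- As b vanishes at the edge, it is c that carries its sign from the band across the edge into
    -- the gap; bc > 0 then transfers the sign to b.
    have h1 := key (fun E => s * monoC ε μ E) (continuous_const.mul h.continuous_monoC)
      (fun E' hE' => mul_ne_zero hs0 (right_ne_zero_of_mul (hpos E' hE').ne')) (mul_ne_zero hs0 hcu)
      fun E' hE' => (h.sign_of_isBand hb hE').2.le
    have h2 : 0 < ((-s) * monoB ε μ E) * ((-s) * monoC ε μ E) := by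
      calc _ < monoB ε μ E * monoC ε μ E := hpos E hE
        _ = _ := by linear_combination (-(monoB ε μ E * monoC ε μ E)) * hss
    exact pos_of_mul_pos_left h2 (by linarith)
  · intro hbu
    refine ⟨(mul_eq_zero.1 h0).resolve_left hbu, ?_⟩
    exact key (fun E => (-s) * monoB ε μ E) (continuous_const.mul h.continuous_monoB)
      (fun E' hE' => mul_ne_zero (neg_ne_zero.2 hs0) (left_ne_zero_of_mul (hpos E' hE').ne'))
      (mul_ne_zero (neg_ne_zero.2 hs0) hbu)
      fun E' hE' => by linarith [(h.sign_of_isBand hb hE').1]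

/-- Closure passes the weak signs of the band to its lower edge, and the absence of zeros in the gap
carries them further down. Together with `sign_of_gap_lower` this yields two determinations of the
sign of b in the same gap. -/
theorem sign_of_gap_upper {u' : ℝ} (hb : IsBand ε μ s l u) (hg : IsGap ε μ s u' l) {E : ℝ}
    (hE : E ∈ Ioo u' l) :
    (monoB ε μ l = 0 → monoC ε μ l ≠ 0 ∧ s * monoB ε μ E < 0) ∧
    (monoB ε μ l ≠ 0 → monoC ε μ l = 0 ∧ 0 < s * monoB ε μ E) := by
  have hs := hb.sign
  have hs0 : s ≠ 0 := by rcases hb.sign with rfl | rfl <;> norm_num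
  have hss := mul_self_of_sign hb.sign
  have hul : u' < l := hE.1.trans hE.2
  have hne := h.not_both_zero_of_gap hg hul (Or.inr rfl) hs
  have h0 : monoB ε μ l * monoC ε μ l = 0 := h.mul_eq_zero_of_sign hs hb.lower
  have hpos : ∀ E' ∈ Ioo u' l, 0 < monoB ε μ E' * monoC ε μ E' := by
    intro E' hE'
    have h1 := h.monoA_sq E'
    have h2 := hg.one_lt E' hE'
    have h3 : 1 < (s * monoA ε μ E') ^ 2 := by
      rw [one_lt_sq_iff_one_lt_abs]; exact h2.trans_le (le_abs_self _)
    have h4 : (s * monoA ε μ E') ^ 2 = monoA ε μ E' ^ 2 := by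
      linear_combination (monoA ε μ E' ^ 2) * hss
    linarith
  have key : ∀ f : ℝ → ℝ, Continuous f → (∀ E' ∈ Ioo u' l, f E' ≠ 0) → f l ≠ 0 →
      (∀ E' ∈ Ioo l u, f E' ≤ 0) → f E < 0 := by
    intro f hf hf0 hfu hfl
    have h1 : f l ≤ 0 := by
      have : l ∈ closure (Ioo l u) := by rw [closure_Ioo hb.lt.ne]; exact left_mem_Icc.2 hb.lt.le
      exact closure_minimal hfl (isClosed_le hf continuous_const) this
    by_contra! h3
    obtain ⟨y, hy, hy'⟩ := intermediate_value_Icc' hE.2.le hf.continuousOn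
      (show (0 : ℝ) ∈ Icc (f l) (f E) from ⟨h1, h3⟩)
    rcases eq_or_lt_of_le hy.2 with h4 | h4
    · exact hfu (h4 ▸ hy')
    · exact hf0 y ⟨hE.1.trans_le hy.1, h4⟩ hy'
  constructor
  · intro hbu
    have hcu : monoC ε μ l ≠ 0 := fun hc => hne ⟨hbu, hc⟩
    refine ⟨hcu, ?_⟩
    have h1 := key (fun E => s * monoC ε μ E) (continuous_const.mul h.continuous_monoC)
      (fun E' hE' => mul_ne_zero hs0 (right_ne_zero_of_mul (hpos E' hE').ne')) (mul_ne_zero hs0 hcu)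
      fun E' hE' => (h.sign_of_isBand hb hE').2.le
    have h2 : 0 < (-(s * monoB ε μ E)) * (-(s * monoC ε μ E)) := by
      calc _ < monoB ε μ E * monoC ε μ E := hpos E hE
        _ = _ := by linear_combination (-(monoB ε μ E * monoC ε μ E)) * hss
    linarith [pos_of_mul_pos_left h2 (by linarith)]
  · intro hbu
    refine ⟨(mul_eq_zero.1 h0).resolve_left hbu, ?_⟩
    have := key (fun E => -(s * monoB ε μ E)) (continuous_const.mul h.continuous_monoB).neg
      (fun E' hE' => neg_ne_zero.2 (mul_ne_zero hs0 (left_ne_zero_of_mul (hpos E' hE').ne')))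
      (neg_ne_zero.2 (mul_ne_zero hs0 hbu))
      fun E' hE' => by linarith [(h.sign_of_isBand hb hE').1]
    linarith

end Band

end IsSymmetricMedium

/-! ### The cell inner product -/

theorem cellInner_eq_smul (ε : ℝ → ℝ) (u v : ℝ → ℂ) : cellInner ε u v =
    ∫ x in (0 : ℝ)..1, ε x • (u x * (starRingEnd ℂ) (v x)) := by
  simp [cellInner]

theorem cellInner_add_left {ε : ℝ → ℝ} (hε : IsTame ε) {u u' v : ℝ → ℂ} (hu : Continuous u)
    (hu' : Continuous u') (hv : Continuous v) :
    cellInner ε (u + u') v = cellInner ε u v + cellInner ε u' v := by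
  simp only [cellInner_eq_smul]
  have hv' : Continuous fun t => (starRingEnd ℂ) (v t) := Complex.continuous_conj.comp hv
  rw [← intervalIntegral.integral_add
    (hε.intervalIntegrable_smul (u := fun t => u t * (starRingEnd ℂ) (v t)) (hu.mul hv') 0 1)
    (hε.intervalIntegrable_smul (u := fun t => u' t * (starRingEnd ℂ) (v t)) (hu'.mul hv') 0 1)]
  congr 1
  ext t
  simp only [Pi.add_apply, Complex.real_smul]
  ring

theorem cellInner_smul_left (ε : ℝ → ℝ) (c : ℂ) (u v : ℝ → ℂ) :
    cellInner ε (c • u) v = c * cellInner ε u v := by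
  simp only [cellInner, ← intervalIntegral.integral_const_mul]
  congr 1
  ext t
  simp only [Pi.smul_apply, smul_eq_mul]
  ring

theorem cellInner_sum_left {ε : ℝ → ℝ} (hε : IsTame ε) {ι : Type*} (s : Finset ι) (c : ι → ℂ)
    {u : ι → ℝ → ℂ} {v : ℝ → ℂ} (hu : ∀ i, Continuous (u i)) (hv : Continuous v) :
    cellInner ε (∑ i ∈ s, c i • u i) v = ∑ i ∈ s, c i * cellInner ε (u i) v := by
  classical
  induction s using Finset.induction_on with
  | empty => simp [cellInner]
  | insert i s hi ih =>
    rw [Finset.sum_insert hi, Finset.sum_insert hi, cellInner_add_left hε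
      ((hu i).const_smul (c i)) ?_ hv, cellInner_smul_left, ih]
    have : (∑ i ∈ s, c i • u i) = fun x => ∑ i ∈ s, c i * u i x := by
      funext x; simp
    rw [this]
    exact continuous_finsetSum _ fun i _ => continuous_const.mul (hu i)

theorem linearIndependent_of_cellInner {ε : ℝ → ℝ} (hε : IsTame ε) {ι : Type*} {v : ι → ℝ → ℂ}
    (hv : ∀ i, Continuous (v i)) (h0 : ∀ i, cellInner ε (v i) (v i) ≠ 0)
    (h : ∀ i j, i ≠ j → cellInner ε (v i) (v j) = 0) : LinearIndependent ℂ v := by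
  rw [linearIndependent_iff']
  intro s c hs i hi
  have h1 := cellInner_sum_left hε s c hv (hv i)
  rw [hs, Finset.sum_eq_single i (fun j _ hj => by rw [h j i hj, mul_zero])
    (fun hh => absurd hi hh)] at h1
  have h2 : cellInner ε (0 : ℝ → ℂ) (v i) = 0 := by simp [cellInner]
  rw [h2] at h1
  exact (mul_eq_zero.1 h1.symm).resolve_right (h0 i)

/-- The combination `α ψ_{E,1} + β ψ_{E,2}`. -/
def comb (ε μ : ℝ → ℝ) (E : ℝ) (α β : ℂ) : ℝ → ℂ := fun x => α * psi1 ε μ E x + β * psi2 ε μ E x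

namespace IsSymmetricMedium

variable {ε μ : ℝ → ℝ} (h : IsSymmetricMedium ε μ)
include h

theorem continuous_comb (E : ℝ) (α β : ℂ) : Continuous (comb ε μ E α β) :=
  (isSolution_combination h.eps.isTame h.mu.isTame E α β).continuous_fst

theorem cellInner_comb (E : ℝ) (α β α' β' : ℂ) :
    cellInner ε (comb ε μ E α β) (comb ε μ E α' β') =
      α * (starRingEnd ℂ) α' * gram11 ε μ E 1 +
      (α * (starRingEnd ℂ) β' + β * (starRingEnd ℂ) α') * gram12 ε μ E 1 +
      β * (starRingEnd ℂ) β' * gram22 ε μ E 1 := by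
  have hε := h.eps.isTame
  have h1 := h.continuous_psi1 E
  have h2 := h.continuous_psi2 E
  have key : ∀ f : ℝ → ℝ, Continuous f → IntervalIntegrable
      (fun t => ((ε t * f t : ℝ) : ℂ)) volume 0 1 := fun f hf =>
    ⟨(hε.intervalIntegrable_mul hf 0 1).1.ofReal, (hε.intervalIntegrable_mul hf 0 1).2.ofReal⟩
  have k11 := key (fun t => psi1 ε μ E t * psi1 ε μ E t) (h1.mul h1)
  have k12 := key (fun t => psi1 ε μ E t * psi2 ε μ E t) (h1.mul h2)
  have k22 := key (fun t => psi2 ε μ E t * psi2 ε μ E t) (h2.mul h2)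
  simp only [gram11, gram12, gram22, ← intervalIntegral.integral_ofReal,
    ← intervalIntegral.integral_const_mul, cellInner, comb]
  rw [← intervalIntegral.integral_add (k11.const_mul _) (k12.const_mul _),
    ← intervalIntegral.integral_add ((k11.const_mul _).add (k12.const_mul _)) (k22.const_mul _)]
  congr 1
  ext t
  simp only [map_add, map_mul, Complex.conj_ofReal]
  push_cast
  ring

theorem isBloch_comb {k E : ℝ} {α β : ℂ}
    (h1 : α * monoA ε μ E + β * monoB ε μ E = Complex.exp (Complex.I * k) * α)
    (h2 : α * monoC ε μ E + β * monoA ε μ E = Complex.exp (Complex.I * k) * β) :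
    IsBlochSolution ε μ k E (comb ε μ E α β) :=
  (h.isBlochSolution_iff k E _).2 ⟨α, β, rfl, h1, h2⟩

omit h in
theorem comb_mem_span {E : ℝ} {α β α' β' : ℂ} (c : ℂ) (hα : α = c * α') (hβ : β = c * β') :
    comb ε μ E α β ∈ Submodule.span ℂ {comb ε μ E α' β'} := by
  rw [Submodule.mem_span_singleton]
  refine ⟨c, ?_⟩
  funext x
  simp only [comb, Pi.smul_apply, smul_eq_mul, hα, hβ]
  ring

end IsSymmetricMedium

/-! ### Explicit Bloch modes and the Bloch space -/

open Classical in
/-- A Bloch mode of energy `E` in a band with upper edge `u`. Where two bands touch, the mode of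
the lower band is `ψ_{E,1}` and that of the upper one `ψ_{E,2}`. -/
def modeCoeff (ε μ : ℝ → ℝ) (k u E : ℝ) : ℂ × ℂ :=
  if Real.sin k ≠ 0 then (monoB ε μ E, Complex.I * Real.sin k)
  else if E = u then (if monoC ε μ E = 0 then (1, 0) else (0, 1))
  else (if monoB ε μ E = 0 then (0, 1) else (1, 0))

/-- See `modeCoeff`. -/
def bandModeOf (ε μ : ℝ → ℝ) (k u E : ℝ) : ℝ → ℂ :=
  comb ε μ E (modeCoeff ε μ k u E).1 (modeCoeff ε μ k u E).2

namespace IsSymmetricMedium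

variable {ε μ : ℝ → ℝ} (h : IsSymmetricMedium ε μ)
include h

theorem continuous_bandModeOf (k u E : ℝ) : Continuous (bandModeOf ε μ k u E) :=
  h.continuous_comb _ _ _

theorem mul_eq_neg_sin_sq {k E : ℝ} (ha : monoA ε μ E = Real.cos k) :
    monoB ε μ E * monoC ε μ E = -Real.sin k ^ 2 := by
  have h1 := h.monoA_sq E
  rw [ha] at h1
  linarith [Real.sin_sq_add_cos_sq k]

theorem isBloch_bandModeOf {k u E : ℝ} (ha : monoA ε μ E = Real.cos k) :
    IsBlochSolution ε μ k E (bandModeOf ε μ k u E) := by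
  have hbc := h.mul_eq_neg_sin_sq ha
  have hbc' : (monoB ε μ E : ℂ) * monoC ε μ E = -(Real.sin k : ℂ) ^ 2 := by exact_mod_cast hbc
  unfold bandModeOf modeCoeff
  by_cases hs : Real.sin k = 0
  · rw [if_neg (not_not.2 hs)]
    rw [hs] at hbc
    have hz : Complex.exp (Complex.I * k) = Real.cos k := by rw [exp_I_mul, hs]; simp
    split_ifs with h1 h2 h2 <;> refine h.isBloch_comb ?_ ?_ <;> rw [hz, ha] <;> dsimp only
    · ring
    · simp [h2]
    · have : monoB ε μ E = 0 := by
        have : monoB ε μ E * monoC ε μ E = 0 := by simpa using hbc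
        exact (mul_eq_zero.1 this).resolve_right h2
      simp [this]
    · ring
    · simp [h2]
    · ring
    · ring
    · have : monoC ε μ E = 0 := by
        have : monoB ε μ E * monoC ε μ E = 0 := by simpa using hbc
        exact (mul_eq_zero.1 this).resolve_left h2
      simp [this]
  · rw [if_pos hs]
    refine h.isBloch_comb ?_ ?_ <;> rw [exp_I_mul, ha] <;> dsimp only
    · ring
    · linear_combination hbc' - (Real.sin k : ℂ) ^ 2 * Complex.I_sq

theorem cellInner_bandModeOf_ne_zero (k u E : ℝ) :
    cellInner ε (bandModeOf ε μ k u E) (bandModeOf ε μ k u E) ≠ 0 := by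
  have hA := h.gram11_pos E
  have hB := h.gram22_pos E
  unfold bandModeOf
  rw [h.cellInner_comb]
  unfold modeCoeff
  split_ifs with h1 h2 h3 h3
  · have h4 : (monoB ε μ E : ℂ) * (starRingEnd ℂ) (monoB ε μ E : ℂ) * gram11 ε μ E 1 +
        (monoB ε μ E * (starRingEnd ℂ) (Complex.I * Real.sin k) +
          Complex.I * Real.sin k * (starRingEnd ℂ) (monoB ε μ E : ℂ)) * gram12 ε μ E 1 +
        Complex.I * Real.sin k * (starRingEnd ℂ) (Complex.I * Real.sin k) * gram22 ε μ E 1 =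
        ((monoB ε μ E ^ 2 * gram11 ε μ E 1 + Real.sin k ^ 2 * gram22 ε μ E 1 : ℝ) : ℂ) := by
      simp only [map_mul, Complex.conj_ofReal, Complex.conj_I]
      simp only [Complex.ofReal_add, Complex.ofReal_mul, Complex.ofReal_pow]
      linear_combination (-(Real.sin k : ℂ) ^ 2 * gram22 ε μ E 1) * Complex.I_sq
    rw [h4]
    have : 0 < Real.sin k ^ 2 := by positivity
    exact_mod_cast (by positivity :
      (0 : ℝ) < monoB ε μ E ^ 2 * gram11 ε μ E 1 + Real.sin k ^ 2 * gram22 ε μ E 1).ne'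
  all_goals simp [hA.ne', hB.ne']

/-- If the monodromy matrix is not a multiple of the identity, the Bloch solutions are the
multiples of one mode. -/
theorem mem_span_bandModeOf {k u E : ℝ} (hne : ¬(monoB ε μ E = 0 ∧ monoC ε μ E = 0)) {w : ℝ → ℂ}
    (hw : IsBlochSolution ε μ k E w) : w ∈ Submodule.span ℂ {bandModeOf ε μ k u E} := by
  by_cases hw0 : w = 0
  · rw [hw0]; exact Submodule.zero_mem _
  have ha := h.monoA_eq_cos hw hw0
  have hbc := h.mul_eq_neg_sin_sq ha
  obtain ⟨α, β, hw', h1, h2⟩ := (h.isBlochSolution_iff k E w).1 hw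
  change w = comb ε μ E α β at hw'
  rw [hw', bandModeOf]
  rw [exp_I_mul, ha] at h1 h2
  unfold modeCoeff
  by_cases hs : Real.sin k = 0
  · rw [if_neg (not_not.2 hs)]
    rw [hs] at hbc h1 h2
    simp only [Complex.ofReal_zero, zero_mul, add_zero] at h1 h2
    have hbc' : monoB ε μ E * monoC ε μ E = 0 := by simpa using hbc
    have h3 : β * monoB ε μ E = 0 := by linear_combination h1
    have h4 : α * monoC ε μ E = 0 := by linear_combination h2
    by_cases hb : monoB ε μ E = 0
    · have hc : monoC ε μ E ≠ 0 := fun hc => hne ⟨hb, hc⟩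
      have hα : α = 0 := (mul_eq_zero.1 h4).resolve_right (by exact_mod_cast hc)
      rw [if_neg hc, if_pos hb, ite_self]
      exact comb_mem_span β (by simp [hα]) (by simp)
    · have hβ : β = 0 := (mul_eq_zero.1 h3).resolve_right (by exact_mod_cast hb)
      have hc : monoC ε μ E = 0 := (mul_eq_zero.1 hbc').resolve_left hb
      rw [if_neg hb, if_pos hc, ite_self]
      exact comb_mem_span α (by simp) (by simp [hβ])
  · rw [if_pos hs]
    have hb : (monoB ε μ E : ℂ) ≠ 0 := by
      intro hb
      have hb' : monoB ε μ E = 0 := by exact_mod_cast hb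
      rw [hb', zero_mul, eq_comm, neg_eq_zero] at hbc
      exact hs (pow_eq_zero_iff two_ne_zero |>.1 hbc)
    refine comb_mem_span (α / monoB ε μ E) ?_ ?_
    · field_simp
    · field_simp
      linear_combination h1

/-- With b = c = 0 and a = ±1, `gram_relation` leaves only the mixed integral. So ψ₁ and ψ₂ are
orthogonal at a touching point and can serve as the modes of the two touching bands. -/
theorem gram12_eq_zero {E : ℝ} (hb : monoB ε μ E = 0) (hc : monoC ε μ E = 0) :
    gram12 ε μ E 1 = 0 := by
  have h1 := h.gram_relation E
  have h2 := h.monoA_sq E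
  rw [hb, hc] at h1
  rw [hb, zero_mul, add_zero] at h2
  have : monoA ε μ E ≠ 0 := fun h0 => by rw [h0] at h2; norm_num at h2
  simpa [this] using h1

/-! ### Band energies -/

section Chain

variable {n : ℕ} {L U : ℕ → ℝ} (hc : BandChain ε μ n L U)
include hc

omit h in
theorem upper_le_lower {i j : ℕ} (hi : 1 ≤ i) (hij : i < j) (hj : j ≤ n) : U i ≤ L j := by
  induction j, hij using Nat.le_induction with
  | base => exact (hc.gap i hi (by omega)).le
  | succ j hij ih =>
    have h1 := ih (by omega)
    have h2 := (hc.band j (by omega) (by omega)).lt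
    have h3 := (hc.gap j (by omega) (by omega)).le
    linarith

omit h in
theorem upper_lt_upper {i j : ℕ} (hi : 1 ≤ i) (hij : i < j) (hj : j ≤ n) : U i < U j :=
  (upper_le_lower hc hi hij hj).trans_lt (hc.band j (by omega) hj).lt

omit h in
theorem upper_le_upper {i j : ℕ} (hi : 1 ≤ i) (hij : i ≤ j) (hj : j ≤ n) : U i ≤ U j := by
  rcases hij.eq_or_lt with rfl | hij
  · exact le_rfl
  · exact (upper_lt_upper hc hi hij hj).le

omit h in
theorem BandChain.mono {m : ℕ} (hm : m ≤ n) : BandChain ε μ m L U where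
  zero := hc.zero
  band j h1 h2 := hc.band j h1 (h2.trans hm)
  gap j h1 h2 := hc.gap j h1 (h2.trans_le hm)

/-- Below zero energy and inside the gaps of the chain |a| > 1, so nothing but the bands is left. -/
theorem exists_band_of_le {E : ℝ} (hn : 1 ≤ n) (hE : E ≤ U n) (ha : |monoA ε μ E| ≤ 1) :
    ∃ i, 1 ≤ i ∧ i ≤ n ∧ E ∈ Icc (L i) (U i) := by
  induction n, hn using Nat.le_induction with
  | base =>
    refine ⟨1, le_rfl, le_rfl, ?_, hE⟩
    rw [hc.zero]
    by_contra! h1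
    linarith [h.one_lt_monoA_of_neg h1, (abs_le.1 ha).2]
  | succ n hn ih =>
    by_cases h1 : E ≤ U n
    · obtain ⟨i, hi, hi', hi''⟩ := ih (BandChain.mono hc (Nat.le_succ n)) h1
      exact ⟨i, hi, by omega, hi''⟩
    · refine ⟨n + 1, by omega, le_rfl, ?_, hE⟩
      by_contra! h2
      have h3 := (hc.gap n hn (by omega)).one_lt E ⟨not_le.1 h1, h2⟩
      rw [← abs_mul_of_sign (neg_one_pow_sign n)] at ha
      linarith [(abs_le.1 ha).2]

/-- A point where the monodromy matrix is a multiple of the identity is a common edge of two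
bands. -/
theorem eq_edge_of_both_zero {E : ℝ} (hn : 1 ≤ n) (hE : E < U n) (hb : monoB ε μ E = 0)
    (hcE : monoC ε μ E = 0) : ∃ i, 1 ≤ i ∧ i < n ∧ E = U i ∧ U i = L (i + 1) := by
  have ha : |monoA ε μ E| = 1 := by
    have := h.monoA_sq E
    rw [hb, zero_mul, add_zero] at this
    rw [← abs_one (α := ℝ)]
    exact (sq_eq_sq_iff_abs_eq_abs _ 1).1 (by rw [this, one_pow])
  obtain ⟨i, h1, h2, h3⟩ := h.exists_band_of_le hc hn hE.le ha.le
  have hbi := hc.band i h1 h2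
  rcases eq_or_lt_of_le h3.1 with h4 | h4
  -- The lower edge of the first band is the energy 0, where b > 0. The lower edge of a later band
  -- cannot border an open gap, since b and c have no common zero there.
  · rcases h1.eq_or_lt with rfl | h1
    · exfalso
      rw [← h4, hc.zero] at hb
      exact h.monoB_zero_pos.ne' hb
    · obtain ⟨j, rfl⟩ : ∃ j, i = j + 1 := ⟨i - 1, by omega⟩
      have hg := hc.gap j (by omega) (by omega)
      rcases hg.le.eq_or_lt with h5 | h5
      · exact ⟨j, by omega, by omega, by rw [← h4, h5], h5⟩
      · exact absurd ⟨hb, hcE⟩ (h.not_both_zero_of_gap hg h5 (Or.inr h4.symm) (neg_one_pow_sign j))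
  rcases eq_or_lt_of_le h3.2 with h5 | h5
  · have hin : i < n := lt_of_le_of_ne h2 fun hh => by rw [h5, hh] at hE; exact lt_irrefl _ hE
    have hg := hc.gap i h1 hin
    rcases hg.le.eq_or_lt with h6 | h6
    · exact ⟨i, h1, hin, h5, h6⟩
    · exact absurd ⟨hb, hcE⟩ (h.not_both_zero_of_gap hg h6 (Or.inl h5) (neg_one_pow_sign i))
  · exact absurd ha (hbi.abs_lt E ⟨h4, h5⟩).ne

variable {k : ℝ} {e : ℕ → ℝ}
  (he : ∀ i, 1 ≤ i → i ≤ n → e i ∈ Icc (L i) (U i) ∧ monoA ε μ (e i) = Real.cos k)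
include he

omit h in
theorem energy_le_energy {i j : ℕ} (hi : 1 ≤ i) (hij : i ≤ j) (hj : j ≤ n) : e i ≤ e j := by
  rcases hij.eq_or_lt with rfl | hij
  · exact le_rfl
  · exact ((he i hi (by omega)).1.2.trans (upper_le_lower hc hi hij hj)).trans
      (he j (by omega) hj).1.1

/-- The modes of the first bands span the Bloch solutions. -/
theorem mem_span_modes {E : ℝ} (hn : 1 ≤ n) (hE : E < U n) {w : ℝ → ℂ}
    (hw : IsBlochSolution ε μ k E w) :
    w ∈ Submodule.span ℂ {v | ∃ i, 1 ≤ i ∧ i ≤ n ∧ e i = E ∧ v = bandModeOf ε μ k (U i) (e i)} := by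
  by_cases hw0 : w = 0
  · rw [hw0]; exact Submodule.zero_mem _
  have ha := h.monoA_eq_cos hw hw0
  have ha1 : |monoA ε μ E| ≤ 1 := by rw [ha]; exact abs_cos_le_one k
  obtain ⟨i, h1, h2, h3⟩ := h.exists_band_of_le hc hn hE.le ha1
  have hei : ∀ i, 1 ≤ i → i ≤ n → E ∈ Icc (L i) (U i) → e i = E := fun i h1 h2 h3 =>
    h.eq_of_isBand (hc.band i h1 h2) (he i h1 h2).1 h3 ((he i h1 h2).2.trans ha.symm)
  -- At a touching point the Bloch space is two-dimensional, spanned by ψ₁ from the lower band and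
  -- ψ₂ from the upper one; E < U n ensures that the upper band still belongs to the chain.
  by_cases hd : monoB ε μ E = 0 ∧ monoC ε μ E = 0
  · obtain ⟨j, hj1, hj2, hj3, hj4⟩ := h.eq_edge_of_both_zero hc hn hE hd.1 hd.2
    have hj5 : e j = E := hei j hj1 hj2.le ⟨by
      rw [hj3]; exact (hc.band j hj1 hj2.le).lt.le, hj3.le⟩
    have hj6 : e (j + 1) = E := hei (j + 1) (by omega) hj2 ⟨by rw [hj3, hj4], by
      rw [hj3]; exact upper_le_upper hc hj1 (by omega) hj2⟩
    have hne : E ≠ U (j + 1) := by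
      rw [hj3]; exact (upper_lt_upper hc hj1 (Nat.lt_succ_self j) hj2).ne
    have hs : Real.sin k = 0 := by
      have := h.mul_eq_neg_sin_sq ha
      rw [hd.1, zero_mul, eq_comm, neg_eq_zero] at this
      exact pow_eq_zero_iff two_ne_zero |>.1 this
    have hm1 : bandModeOf ε μ k (U j) (e j) = comb ε μ E 1 0 := by
      rw [bandModeOf, modeCoeff, if_neg (not_not.2 hs), hj5, if_pos hj3, if_pos hd.2]
    have hm2 : bandModeOf ε μ k (U (j + 1)) (e (j + 1)) = comb ε μ E 0 1 := by
      rw [bandModeOf, modeCoeff, if_neg (not_not.2 hs), hj6, if_neg hne, if_pos hd.1]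
    obtain ⟨α, β, hw', -, -⟩ := (h.isBlochSolution_iff k E w).1 hw
    have hw2 : w = α • comb ε μ E 1 0 + β • comb ε μ E 0 1 := by
      rw [hw']; funext x; simp [comb]
    rw [hw2]
    refine Submodule.add_mem _ (Submodule.smul_mem _ _ (Submodule.subset_span
      ⟨j, hj1, hj2.le, hj5, hm1.symm⟩)) (Submodule.smul_mem _ _ (Submodule.subset_span
      ⟨j + 1, by omega, hj2, hj6, hm2.symm⟩))
  · have := h.mem_span_bandModeOf (u := U i) hd hw
    refine Submodule.span_mono ?_ this
    rintro _ rfl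
    exact ⟨i, h1, h2, hei i h1 h2 h3, by rw [hei i h1 h2 h3]⟩

theorem cellInner_modes_eq_zero {i j : ℕ} (hi : 1 ≤ i) (hij : i < j) (hj : j ≤ n) :
    cellInner ε (bandModeOf ε μ k (U i) (e i)) (bandModeOf ε μ k (U j) (e j)) = 0 ∧
    cellInner ε (bandModeOf ε μ k (U j) (e j)) (bandModeOf ε μ k (U i) (e i)) = 0 := by
  have hi' : i ≤ n := by omega
  have hj' : 1 ≤ j := by omega
  have hbi := h.isBloch_bandModeOf (u := U i) (he i hi hi').2
  have hbj := h.isBloch_bandModeOf (u := U j) (he j hj' hj).2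
  by_cases hE : e i = e j
  · have h1 : e i = U i := le_antisymm (he i hi hi').1.2 (by
      rw [hE]; exact (upper_le_lower hc hi hij hj).trans (he j hj' hj).1.1)
    have h2 : U i = L j := le_antisymm (upper_le_lower hc hi hij hj) (by
      rw [← h1, hE]; exact (he j hj' hj).1.1)
    obtain ⟨hb, hcE⟩ := h.both_zero_of_touch (hc.band i hi hi') (hc.band j hj' hj) h2
    have hs : Real.sin k = 0 := by
      have := h.mul_eq_neg_sin_sq (he i hi hi').2
      rw [h1, hb, zero_mul, eq_comm, neg_eq_zero] at this
      exact pow_eq_zero_iff two_ne_zero |>.1 this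
    have hne : U i ≠ U j := (upper_lt_upper hc hi hij hj).ne
    have hm1 : bandModeOf ε μ k (U i) (e i) = comb ε μ (U i) 1 0 := by
      rw [bandModeOf, modeCoeff, if_neg (not_not.2 hs), h1, if_pos rfl, if_pos hcE]
    have hm2 : bandModeOf ε μ k (U j) (e j) = comb ε μ (U i) 0 1 := by
      rw [bandModeOf, modeCoeff, if_neg (not_not.2 hs), ← hE, h1, if_neg hne, if_pos hb]
    rw [hm1, hm2, h.cellInner_comb, h.cellInner_comb, h.gram12_eq_zero hb hcE]
    simp
  · exact ⟨h.cellInner_eq_zero hE hbi hbj, h.cellInner_eq_zero (Ne.symm hE) hbj hbi⟩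

/-- The modes of the first j bands are pairwise orthogonal, which gives j independent Bloch
solutions with energies up to e j. Strictly below e j all Bloch solutions lie in the span of j - 1
modes. -/
theorem isLeast_bandEnergy_set {j : ℕ} (hj : 1 ≤ j) (hjn : j ≤ n) :
    IsLeast {E : ℝ | (j : Cardinal) ≤ Module.rank ℂ
      (Submodule.span ℂ {u : ℝ → ℂ | ∃ E' ≤ E, IsBlochSolution ε μ k E' u})} (e j) := by
  constructor
  · rw [mem_ofPred_eq, Module.le_rank_iff]
    have hli : LinearIndependent ℂ
        (fun i : Fin j => bandModeOf ε μ k (U (i + 1)) (e (i + 1))) := by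
      refine linearIndependent_of_cellInner h.eps.isTame (fun i => h.continuous_bandModeOf _ _ _)
        (fun i => h.cellInner_bandModeOf_ne_zero _ _ _) fun i i' hii => ?_
      rcases lt_or_gt_of_ne (fun hh => hii (Fin.ext hh) : (i : ℕ) ≠ i') with h1 | h1
      · exact (h.cellInner_modes_eq_zero hc he (i := i + 1) (j := i' + 1) (by omega) (by omega)
          (by omega)).1
      · exact (h.cellInner_modes_eq_zero hc he (i := i' + 1) (j := i + 1) (by omega) (by omega)
          (by omega)).2
    refine ⟨fun i => ⟨bandModeOf ε μ k (U (i + 1)) (e (i + 1)), Submodule.subset_span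
      ⟨e (i + 1), energy_le_energy hc he (by omega) (by omega) hjn,
        h.isBloch_bandModeOf (he (i + 1) (by omega) (by omega)).2⟩⟩, ?_⟩
    exact LinearIndependent.of_comp (Submodule.subtype _) hli
  · intro E hE
    classical
    by_contra! hlt
    have h1 : Submodule.span ℂ {u : ℝ → ℂ | ∃ E' ≤ E, IsBlochSolution ε μ k E' u} ≤
        Submodule.span ℂ (((Finset.Icc 1 (j - 1)).image
          fun i => bandModeOf ε μ k (U i) (e i) : Finset (ℝ → ℂ)) : Set (ℝ → ℂ)) := by
      rw [Submodule.span_le]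
      rintro w ⟨E', hE', hw⟩
      have h2 : E' < e j := hE'.trans_lt hlt
      refine Submodule.span_mono ?_ (h.mem_span_modes hc he (hj.trans hjn) (h2.trans_le
        ((he j hj hjn).1.2.trans (upper_le_upper hc hj hjn le_rfl))) hw)
      rintro v ⟨i, hi, hi', hi'', rfl⟩
      have h3 : i < j := by
        by_contra! h3
        exact absurd (energy_le_energy hc he hj h3 hi') (not_le.2 (by rw [hi'']; exact h2))
      simp only [Finset.coe_image, Finset.coe_Icc, mem_image, mem_Icc]
      exact ⟨i, ⟨hi, by omega⟩, rfl⟩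
    have h4 := (Submodule.rank_mono h1).trans (rank_span_finset_le _)
    have h5 : (j : Cardinal) ≤ ((j - 1 : ℕ) : Cardinal) := by
      refine (hE.trans h4).trans ?_
      exact_mod_cast Finset.card_image_le.trans (by simp)
    have h6 : j ≤ j - 1 := by exact_mod_cast h5
    omega

end Chain

end IsSymmetricMedium

/-! ### Existence of the first bands and their edges -/

/-- The set whose infimum is the band energy. -/
def bandSet (ε μ : ℝ → ℝ) (j : ℕ) (k : ℝ) : Set ℝ := {E : ℝ | (j : Cardinal) ≤
    Module.rank ℂ (Submodule.span ℂ {u : ℝ → ℂ | ∃ E' ≤ E, IsBlochSolution ε μ k E' u})}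

/-- The wavenumber `0` or `π` with cosine `(-1) ^ j`. -/
def edgeWavenumber (j : ℕ) : ℝ := if Even j then 0 else π

theorem cos_edgeWavenumber (j : ℕ) : Real.cos (edgeWavenumber j) = (-1) ^ j := by
  unfold edgeWavenumber
  split_ifs with hj
  · simp [hj.neg_one_pow]
  · simp [(Nat.not_even_iff_odd.1 hj).neg_one_pow]

theorem edgeWavenumber_mem (j : ℕ) : edgeWavenumber j ∈ Icc 0 π := by
  unfold edgeWavenumber
  split_ifs
  exacts [⟨le_rfl, pi_pos.le⟩, ⟨pi_pos.le, le_rfl⟩]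

theorem edgeWavenumber_mem' (j : ℕ) : edgeWavenumber j ∈ Icc (-π) π :=
  ⟨by linarith [(edgeWavenumber_mem j).1, pi_pos], (edgeWavenumber_mem j).2⟩

namespace IsSymmetricMedium

variable {ε μ : ℝ → ℝ} (h : IsSymmetricMedium ε μ)
include h

omit h in
theorem exists_bloch_of_mem_bandSet {j : ℕ} {k E : ℝ} (hj : 1 ≤ j) (hE : E ∈ bandSet ε μ j k) :
    ∃ E' ≤ E, ∃ u, u ≠ 0 ∧ IsBlochSolution ε μ k E' u := by
  by_contra! hcon
  have h1 : Submodule.span ℂ {u : ℝ → ℂ | ∃ E' ≤ E, IsBlochSolution ε μ k E' u} = ⊥ := by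
    rw [Submodule.span_eq_bot]
    rintro u ⟨E', hE', hu⟩
    by_contra hu0
    exact hcon E' hE' u hu0 hu
  unfold bandSet at hE
  rw [mem_ofPred_eq, h1, rank_bot] at hE
  have : j ≤ 0 := by exact_mod_cast hE
  omega

theorem nonneg_of_mem_bandSet {j : ℕ} {k E : ℝ} (hj : 1 ≤ j) (hE : E ∈ bandSet ε μ j k) :
    0 ≤ E := by
  obtain ⟨E', hE', u, hu0, hu⟩ := exists_bloch_of_mem_bandSet hj hE
  refine le_trans ?_ hE'
  by_contra! hneg
  have h1 := h.one_lt_monoA_of_neg hneg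
  rw [h.monoA_eq_cos hu hu0] at h1
  exact absurd (cos_le_one k) (not_le.2 h1)

theorem bandEnergy_nonneg {j : ℕ} (hj : 1 ≤ j) (k : ℝ) : 0 ≤ bandEnergy ε μ j k :=
  Real.sInf_nonneg fun _ hE => h.nonneg_of_mem_bandSet hj hE

omit h in
theorem bandSet_mono {i j : ℕ} (hij : i ≤ j) (k : ℝ) : bandSet ε μ j k ⊆ bandSet ε μ i k :=
  fun _ hE => le_trans (Nat.cast_le.2 hij : (i : Cardinal.{0}) ≤ j) (mem_ofPred_eq.mp hE)

theorem exists_energies {n : ℕ} {L U : ℕ → ℝ} (hc : BandChain ε μ n L U) (k : ℝ) : ∃ e : ℕ → ℝ,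
    ∀ i, 1 ≤ i → i ≤ n → e i ∈ Icc (L i) (U i) ∧ monoA ε μ (e i) = Real.cos k := by
  have : ∀ i, ∃ e : ℝ, 1 ≤ i → i ≤ n → e ∈ Icc (L i) (U i) ∧ monoA ε μ e = Real.cos k := by
    intro i
    by_cases hi : 1 ≤ i ∧ i ≤ n
    · obtain ⟨e, he, he'⟩ := h.exists_energy_of_isBand (hc.band i hi.1 hi.2) k
      exact ⟨e, fun _ _ => ⟨he, he'⟩⟩
    · exact ⟨0, fun h1 h2 => absurd ⟨h1, h2⟩ hi⟩
  choose e he using this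
  exact ⟨e, he⟩

/-- A Bloch solution with k = π has a = -1, and its energy is positive because a ≥ 1 for E ≤ 0.
Hence a runs from 1 at zero energy to -1. -/
theorem exists_chain_one (hS : (bandSet ε μ 1 π).Nonempty) : ∃ L U, BandChain ε μ 1 L U := by
  obtain ⟨E, hE⟩ := hS
  obtain ⟨E', -, u, hu0, hu⟩ := exists_bloch_of_mem_bandSet le_rfl hE
  have ha := h.monoA_eq_cos hu hu0
  rw [cos_pi] at ha
  have hpos : 0 < E' := by
    rcases lt_trichotomy E' 0 with h1 | h1 | h1
    · linarith [h.one_lt_monoA_of_neg h1]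
    · rw [h1, h.monoA_zero] at ha; norm_num at ha
    · exact h1
  obtain ⟨l, u, hg, hb⟩ := h.exists_next_band (Or.inl rfl) h.monoA_zero ⟨E', hpos, ha⟩
  obtain rfl := h.eq_zero_of_isGap hg
  refine ⟨fun _ => 0, fun _ => u, rfl, fun j h1 h2 => ?_, fun j h1 h2 => by omega⟩
  obtain rfl : j = 1 := by omega
  simpa using hb

/-- If a never took the value -(-1)^m beyond U m, all Bloch solutions with cos k = (-1)^(m+1) would
have energies below U m and lie in the span of m modes. Then no energy could qualify for band m + 1
at this wavenumber. -/
theorem exists_chain_succ {m : ℕ} (hm : 1 ≤ m) {L U : ℕ → ℝ} (hc : BandChain ε μ m L U)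
    (hS : (bandSet ε μ (m + 1) (edgeWavenumber (m + 1))).Nonempty) :
    ∃ L U, BandChain ε μ (m + 1) L U := by
  classical
  set k := edgeWavenumber (m + 1) with hk
  have hcos : Real.cos k = (-1) ^ (m + 1) := cos_edgeWavenumber _
  have hUm : monoA ε μ (U m) = (-1) ^ m := by
    rw [(hc.band m hm le_rfl).upper, pow_succ]; ring
  have hex : ∃ E > U m, monoA ε μ E = -(-1) ^ m := by
    by_contra! hcon
    obtain ⟨E, hE⟩ := hS
    obtain ⟨e, he⟩ := h.exists_energies hc k
    have h1 : Submodule.span ℂ {u : ℝ → ℂ | ∃ E' ≤ E, IsBlochSolution ε μ k E' u} ≤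
        Submodule.span ℂ (((Finset.Icc 1 m).image
          fun i => bandModeOf ε μ k (U i) (e i) : Finset (ℝ → ℂ)) : Set (ℝ → ℂ)) := by
      rw [Submodule.span_le]
      rintro w ⟨E', hE', hw⟩
      by_cases hw0 : w = 0
      · rw [hw0]; exact Submodule.zero_mem _
      have ha := h.monoA_eq_cos hw hw0
      rw [hcos, pow_succ, mul_neg_one] at ha
      have h2 : E' < U m := by
        rcases lt_trichotomy E' (U m) with h2 | h2 | h2
        · exact h2
        · rw [h2, hUm] at ha
          rcases neg_one_pow_sign m with h3 | h3 <;> rw [h3] at ha <;> norm_num at ha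
        · exact absurd ha (hcon E' h2)
      refine Submodule.span_mono ?_ (h.mem_span_modes hc he hm h2 hw)
      rintro v ⟨i, hi, hi', hi'', rfl⟩
      simp only [Finset.coe_image, Finset.coe_Icc, mem_image, mem_Icc]
      exact ⟨i, ⟨hi, hi'⟩, rfl⟩
    have h4 := (Submodule.rank_mono h1).trans (rank_span_finset_le _)
    have h5 : ((m + 1 : ℕ) : Cardinal) ≤ ((m : ℕ) : Cardinal) := by
      refine (le_trans hE h4).trans ?_
      exact_mod_cast Finset.card_image_le.trans (by simp)
    have h6 : m + 1 ≤ m := by exact_mod_cast h5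
    omega
  obtain ⟨l, u, hg, hb⟩ := h.exists_next_band (neg_one_pow_sign m) hUm hex
  refine ⟨Function.update L (m + 1) l, Function.update U (m + 1) u, ?_, fun j h1 h2 => ?_,
    fun j h1 h2 => ?_⟩
  · rw [Function.update_of_ne (by omega)]; exact hc.zero
  · rcases h2.eq_or_lt with rfl | h2
    · simpa [pow_succ] using hb
    · rw [Function.update_of_ne h2.ne, Function.update_of_ne h2.ne]
      exact hc.band j h1 (by omega)
  · rw [Function.update_of_ne (by omega)]
    rcases (Nat.le_of_lt_succ h2).eq_or_lt with rfl | h3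
    · simpa using hg
    · rw [Function.update_of_ne (by omega)]
      exact hc.gap j h1 h3

theorem exists_chain {n : ℕ} (hn : 1 ≤ n) (hS : ∀ k ∈ Icc (-π) π, (bandSet ε μ n k).Nonempty) :
    ∃ L U, BandChain ε μ n L U := by
  have key : ∀ m, 1 ≤ m → m ≤ n → ∃ L U, BandChain ε μ m L U := by
    intro m hm
    induction m, hm using Nat.le_induction with
    | base =>
      exact fun h1 => h.exists_chain_one
        ((hS π ⟨by linarith [pi_pos], le_rfl⟩).mono (bandSet_mono h1 π))
    | succ m hm ih =>
      intro h1
      obtain ⟨L, U, hc⟩ := ih (by omega)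
      exact h.exists_chain_succ hm hc ((hS _ (edgeWavenumber_mem' _)).mono (bandSet_mono h1 _))
  exact key n hn le_rfl

section Chain

variable {n : ℕ} {L U : ℕ → ℝ} (hc : BandChain ε μ n L U)
include hc

theorem bandEnergy_eq {j : ℕ} (hj : 1 ≤ j) (hjn : j ≤ n) {k E : ℝ} (hE : E ∈ Icc (L j) (U j))
    (ha : monoA ε μ E = Real.cos k) : bandEnergy ε μ j k = E := by
  obtain ⟨e, he⟩ := h.exists_energies hc k
  have h1 : bandEnergy ε μ j k = e j := (h.isLeast_bandEnergy_set hc he hj hjn).csInf_eq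
  rw [h1]
  exact h.eq_of_isBand (hc.band j hj hjn) (he j hj hjn).1 hE ((he j hj hjn).2.trans ha.symm)

theorem bandEnergy_spec {j : ℕ} (hj : 1 ≤ j) (hjn : j ≤ n) (k : ℝ) :
    bandEnergy ε μ j k ∈ Icc (L j) (U j) ∧ monoA ε μ (bandEnergy ε μ j k) = Real.cos k := by
  obtain ⟨e, he⟩ := h.exists_energies hc k
  rw [h.bandEnergy_eq hc hj hjn (he j hj hjn).1 (he j hj hjn).2]
  exact he j hj hjn

theorem bandEnergy_upper {j : ℕ} (hj : 1 ≤ j) (hjn : j ≤ n) {k : ℝ} (hk : Real.cos k = (-1) ^ j) :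
    bandEnergy ε μ j k = U j := by
  have hb := hc.band j hj hjn
  refine h.bandEnergy_eq hc hj hjn ⟨hb.lt.le, le_rfl⟩ ?_
  rw [hb.upper, hk, pow_succ]; ring

theorem bandEnergy_lower {j : ℕ} (hj : 1 ≤ j) (hjn : j ≤ n) {k : ℝ}
    (hk : Real.cos k = (-1) ^ (j + 1)) : bandEnergy ε μ j k = L j := by
  have hb := hc.band j hj hjn
  exact h.bandEnergy_eq hc hj hjn ⟨le_rfl, hb.lt.le⟩ (by rw [hb.lower, hk])

theorem bandMin_eq {j : ℕ} (hj : 1 ≤ j) (hjn : j ≤ n) : bandMin ε μ j = L j := by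
  refine IsLeast.csInf_eq ⟨⟨edgeWavenumber (j + 1), edgeWavenumber_mem' _,
    h.bandEnergy_lower hc hj hjn (cos_edgeWavenumber _)⟩, ?_⟩
  rintro _ ⟨k, -, rfl⟩
  exact (h.bandEnergy_spec hc hj hjn k).1.1

theorem bandMax_eq {j : ℕ} (hj : 1 ≤ j) (hjn : j ≤ n) : bandMax ε μ j = U j := by
  refine IsGreatest.csSup_eq ⟨⟨edgeWavenumber j, edgeWavenumber_mem' _,
    h.bandEnergy_upper hc hj hjn (cos_edgeWavenumber _)⟩, ?_⟩
  rintro _ ⟨k, -, rfl⟩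
  exact (h.bandEnergy_spec hc hj hjn k).1.2

end Chain

/-- If the gap above the `m`-th band is not empty, the first `m + 1` bands exist. -/
theorem exists_chain_of_gap {m : ℕ} (hm : 1 ≤ m) (hne : (bandGap ε μ m).Nonempty) :
    ∃ L U, BandChain ε μ (m + 1) L U ∧ bandGap ε μ m = Ioo (U m) (L (m + 1)) ∧
      U m < L (m + 1) := by
  have hS : ∀ k ∈ Icc (-π) π, (bandSet ε μ (m + 1) k).Nonempty := by
    intro k hk
    by_contra hemp
    rw [not_nonempty_iff_eq_empty] at hemp
    -- The infimum of the empty set of reals is 0 by convention. A missing band energy would thus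
    -- give `bandMin` ≤ 0 ≤ `bandMax` and an empty gap.
    have h1 : bandEnergy ε μ (m + 1) k = 0 := by
      change sInf (bandSet ε μ (m + 1) k) = 0
      rw [hemp, Real.sInf_empty]
    have h2 : bandMin ε μ (m + 1) ≤ 0 := by
      rw [← h1]
      refine csInf_le ⟨0, ?_⟩ ⟨k, hk, rfl⟩
      rintro _ ⟨k', -, rfl⟩
      exact h.bandEnergy_nonneg (by omega) k'
    have h3 : 0 ≤ bandMax ε μ m := Real.sSup_nonneg (by
      rintro _ ⟨k', -, rfl⟩
      exact h.bandEnergy_nonneg hm k')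
    obtain ⟨E, hE⟩ := hne
    linarith [hE.1, hE.2]
  obtain ⟨L, U, hc⟩ := h.exists_chain (by omega) hS
  have h1 : bandGap ε μ m = Ioo (U m) (L (m + 1)) := by
    rw [bandGap, h.bandMin_eq hc (by omega) le_rfl, h.bandMax_eq hc hm (by omega)]
  refine ⟨L, U, hc, h1, ?_⟩
  rw [h1] at hne
  exact nonempty_Ioo.1 hne

end IsSymmetricMedium

/-! ### Dirac points -/

/-- This converts a dispersion relation in |sin k| into one in |k - k₀| up to a quadratic error. -/
theorem abs_abs_sin_sub_abs_le {x : ℝ} (hx : |x| ≤ 1) : |(|Real.sin x| - |x|)| ≤ x ^ 2 := by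
  have key : ∀ y : ℝ, 0 ≤ y → y ≤ 1 → |(|Real.sin y| - |y|)| ≤ y ^ 2 := by
    intro y hy hy1
    rcases hy.eq_or_lt with rfl | hy0
    · simp
    have h1 := Real.sin_le hy
    have h2 := Real.sin_gt_sub_cube hy0
    have h3 : 0 ≤ Real.sin y := sin_nonneg_of_nonneg_of_le_pi hy (hy1.trans (by linarith [pi_gt_three]))
    have h4 : y ^ 3 ≤ y ^ 2 := pow_le_pow_of_le_one hy hy1 (by norm_num)
    have h5 := h2
    rw [abs_of_nonneg h3, abs_of_nonneg hy, abs_sub_comm, abs_of_nonneg (by linarith)]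
    have h6 : 0 ≤ y ^ 3 := by positivity
    linarith
  rcases le_total 0 x with h0 | h0
  · exact key x h0 ((le_abs_self x).trans hx)
  · have := key (-x) (by linarith) ((neg_le_abs x).trans hx)
    simpa using this

namespace IsSymmetricMedium

variable {ε μ : ℝ → ℝ} (h : IsSymmetricMedium ε μ)
include h

theorem analyticAt_monoB (E : ℝ) : AnalyticAt ℝ (monoB ε μ) E :=
  analyticAt_psi2 h.eps.isTame h.mu.isTame 1 E

theorem analyticAt_monoC (E : ℝ) : AnalyticAt ℝ (monoC ε μ) E :=
  analyticAt_flux1 h.eps.isTame h.mu.isTame 1 E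

omit h in
theorem _root_.AnalyticAt.differentiableAt_dslope {f : ℝ → ℝ} {x : ℝ} (hf : AnalyticAt ℝ f x) :
    DifferentiableAt ℝ (dslope f x) x := by
  obtain ⟨p, hp⟩ := hf
  exact hp.has_fpower_series_dslope_fslope.analyticAt.differentiableAt

/-- Near a point where the monodromy matrix is `±1`, the energy depends linearly on `|sin k|`. -/
theorem exists_linear_dispersion {E₀ : ℝ} (hb : monoB ε μ E₀ = 0) (hc : monoC ε μ E₀ = 0) :
    ∃ g : ℝ → ℝ, 0 < g E₀ ∧ DifferentiableAt ℝ g E₀ ∧ ∀ᶠ E in 𝓝 E₀, ∀ k,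
      monoA ε μ E = Real.cos k → |E - E₀| = |Real.sin k| * g E := by
  -- Dividing b and c by E - E₀ gives (E - E₀)² H(E) = -bc = sin² k with H(E₀) > 0, so g = H^(-1/2)
  -- is the required factor.
  set H : ℝ → ℝ := fun E => -(dslope (monoB ε μ) E₀ E * dslope (monoC ε μ) E₀ E) with hH
  have hHd : DifferentiableAt ℝ H E₀ :=
    ((h.analyticAt_monoB E₀).differentiableAt_dslope.mul
      (h.analyticAt_monoC E₀).differentiableAt_dslope).neg
  have ha := h.monoA_sq E₀
  rw [hb, zero_mul, add_zero] at ha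
  have hH0 : 0 < H E₀ := by
    simp only [hH, dslope_same, (h.hasDerivAt_monoB E₀).deriv, (h.hasDerivAt_monoC E₀).deriv, hb,
      hc, zero_mul, zero_sub, sub_zero]
    have : 0 < gram11 ε μ E₀ 1 * gram22 ε μ E₀ 1 := mul_pos (h.gram11_pos E₀) (h.gram22_pos E₀)
    calc (0 : ℝ) < monoA ε μ E₀ ^ 2 * (gram11 ε μ E₀ 1 * gram22 ε μ E₀ 1) := by
          rw [ha, one_mul]; exact this
      _ = _ := by ring
  refine ⟨fun E => (√(H E))⁻¹, inv_pos.2 (sqrt_pos.2 hH0),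
    (hHd.sqrt hH0.ne').inv (sqrt_pos.2 hH0).ne', ?_⟩
  filter_upwards [hHd.continuousAt.eventually (lt_mem_nhds hH0)] with E hE k hk
  have h1 := sub_smul_dslope (monoB ε μ) E₀ E
  have h2 := sub_smul_dslope (monoC ε μ) E₀ E
  rw [hb, sub_zero, smul_eq_mul] at h1
  rw [hc, sub_zero, smul_eq_mul] at h2
  have h3 := h.mul_eq_neg_sin_sq hk
  have h4 : (E - E₀) ^ 2 * H E = Real.sin k ^ 2 := by
    rw [← h1, ← h2] at h3
    simp only [hH]
    linear_combination -h3
  have h5 : |E - E₀| * √(H E) = |Real.sin k| := by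
    rw [← sqrt_sq_eq_abs, ← sqrt_mul (sq_nonneg _), h4, sqrt_sq_eq_abs]
  rw [← h5]
  field_simp [(sqrt_pos.2 hE).ne']

/-! ### Continuity of band energies; Dirac points as closed gaps -/

section Chain

variable {n : ℕ} {L U : ℕ → ℝ} (hc : BandChain ε μ n L U)
include hc

/-- Energies of one band are compared through the strictly decreasing function s·a, whose value at
the band energy is s cos k and so depends continuously on k. -/
theorem continuous_bandEnergy {j : ℕ} (hj : 1 ≤ j) (hjn : j ≤ n) :
    Continuous (bandEnergy ε μ j) := by
  rw [continuous_iff_continuousAt]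
  intro k₀
  have hb := hc.band j hj hjn
  have hanti := h.strictAntiOn_of_isBand hb
  set s : ℝ := (-1) ^ (j + 1)
  obtain ⟨h0, h0'⟩ := h.bandEnergy_spec hc hj hjn k₀
  have hcos : Tendsto (fun k => s * Real.cos k) (𝓝 k₀) (𝓝 (s * Real.cos k₀)) :=
    (continuous_const.mul continuous_cos).tendsto k₀
  refine tendsto_order.2 ⟨fun y hy => ?_, fun y hy => ?_⟩
  · by_cases hyl : y < L j
    · exact Eventually.of_forall fun k => hyl.trans_le (h.bandEnergy_spec hc hj hjn k).1.1
    · have hyI : y ∈ Icc (L j) (U j) := ⟨not_lt.1 hyl, (hy.trans_le h0.2).le⟩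
      have h1 := hanti hyI h0 hy
      beta_reduce at h1
      rw [h0'] at h1
      filter_upwards [hcos.eventually (gt_mem_nhds h1)] with k hk
      obtain ⟨h2, h2'⟩ := h.bandEnergy_spec hc hj hjn k
      by_contra! h3
      have := hanti.antitoneOn h2 hyI h3
      beta_reduce at this
      rw [h2'] at this
      linarith
  · by_cases hyl : U j < y
    · exact Eventually.of_forall fun k => (h.bandEnergy_spec hc hj hjn k).1.2.trans_lt hyl
    · have hyI : y ∈ Icc (L j) (U j) := ⟨(h0.1.trans_lt hy).le, not_lt.1 hyl⟩
      have h1 := hanti h0 hyI hy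
      beta_reduce at h1
      rw [h0'] at h1
      filter_upwards [hcos.eventually (lt_mem_nhds h1)] with k hk
      obtain ⟨h2, h2'⟩ := h.bandEnergy_spec hc hj hjn k
      by_contra! h3
      have := hanti.antitoneOn hyI h2 h3
      beta_reduce at this
      rw [h2'] at this
      linarith

omit h hc in
theorem abs_sin_sub_edgeWavenumber (j : ℕ) (k : ℝ) :
    |Real.sin (k - edgeWavenumber j)| = |Real.sin k| := by
  unfold edgeWavenumber
  split_ifs
  · simp
  · rw [Real.sin_sub_pi, abs_neg]

/-- In |E - E₀| = |sin k| g(E) one replaces |sin k| by |k - k₀| and g(E) by g(E₀). Each replacement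
costs O((k - k₀)²), the second because g is differentiable and |E - E₀| is itself of order |k - k₀|.
-/
theorem exists_dispersion_bound {i j : ℕ} (hj : 1 ≤ j) (hjn : j ≤ n) {E₀ : ℝ} {g : ℝ → ℝ}
    (hg0 : 0 < g E₀) (hg : DifferentiableAt ℝ g E₀) (hev : ∀ᶠ E in 𝓝 E₀, ∀ k,
      monoA ε μ E = Real.cos k → |E - E₀| = |Real.sin k| * g E)
    (hE : bandEnergy ε μ j (edgeWavenumber i) = E₀) :
    ∃ δ > 0, ∃ C : ℝ, ∀ k, |k - edgeWavenumber i| < δ →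
      |(|bandEnergy ε μ j k - E₀| - g E₀ * |k - edgeWavenumber i|)| ≤
        C * (k - edgeWavenumber i) ^ 2 := by
  set k₀ := edgeWavenumber i
  obtain ⟨K, hK⟩ := hg.hasDerivAt.isBigO_sub.bound
  have hcont : Tendsto (bandEnergy ε μ j) (𝓝 k₀) (𝓝 E₀) := by
    have := (h.continuous_bandEnergy hc hj hjn).tendsto k₀
    rwa [hE] at this
  have hgc : ∀ᶠ E in 𝓝 E₀, |g E| ≤ 2 * g E₀ := by
    have : Tendsto (fun E => |g E|) (𝓝 E₀) (𝓝 |g E₀|) := hg.continuousAt.abs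
    rw [abs_of_pos hg0] at this
    exact (this.eventually (gt_mem_nhds (by linarith : g E₀ < 2 * g E₀))).mono fun _ hh => le_of_lt hh
  obtain ⟨δ, hδ, hball⟩ := Metric.eventually_nhds_iff.1
    (hcont.eventually (hev.and (hK.and hgc)))
  refine ⟨min δ 1, lt_min hδ one_pos, 2 * g E₀ + |K| * (2 * g E₀), fun k hk => ?_⟩
  obtain ⟨h1, h2, h3⟩ := hball (show dist k k₀ < δ from hk.trans_le (min_le_left _ _))
  have h4 := h1 k (h.bandEnergy_spec hc hj hjn k).2
  set E := bandEnergy ε μ j k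
  set κ := k - k₀
  have h5 : |Real.sin k| = |Real.sin κ| := (abs_sin_sub_edgeWavenumber i k).symm
  have h6 := abs_abs_sin_sub_abs_le (hk.trans_le (min_le_right _ _)).le
  have h7 : |Real.sin κ| ≤ |κ| := abs_sin_le_abs
  rw [h5] at h4
  have h8 : |g E - g E₀| ≤ |K| * (|κ| * (2 * g E₀)) := by
    refine (show |g E - g E₀| ≤ K * |E - E₀| from h2).trans ?_
    refine mul_le_mul (le_abs_self K) ?_ (abs_nonneg _) (abs_nonneg _)
    rw [h4]
    exact mul_le_mul h7 ((le_abs_self _).trans h3)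
      (by
        by_contra! hneg
        have : |Real.sin κ| * g E ≤ 0 := mul_nonpos_of_nonneg_of_nonpos (abs_nonneg _) hneg.le
        have hE0 : |E - E₀| = 0 := le_antisymm (h4 ▸ this) (abs_nonneg _)
        rw [abs_eq_zero, sub_eq_zero] at hE0
        rw [hE0] at hneg
        linarith) (abs_nonneg _)
  rw [h4]
  calc |(|Real.sin κ| * g E - g E₀ * |κ|)|
      = |(|Real.sin κ| - |κ|) * g E + |κ| * (g E - g E₀)| := by congr 1; ring
    _ ≤ |(|Real.sin κ| - |κ|)| * |g E| + |κ| * |g E - g E₀| := by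
        refine (abs_add_le _ _).trans ?_
        rw [abs_mul, abs_mul, abs_abs]
    _ ≤ κ ^ 2 * (2 * g E₀) + |κ| * (|K| * (|κ| * (2 * g E₀))) := by
        gcongr
    _ = (2 * g E₀ + |K| * (2 * g E₀)) * κ ^ 2 := by
        rw [← sq_abs κ]; ring

omit hc in
theorem rank_bloch_eq_two {i : ℕ} {E₀ : ℝ} (ha : monoA ε μ E₀ = (-1) ^ i)
    (hb : monoB ε μ E₀ = 0) (hcE : monoC ε μ E₀ = 0) :
    Module.rank ℂ (Submodule.span ℂ
      {u : ℝ → ℂ | IsBlochSolution ε μ (edgeWavenumber i) E₀ u}) = 2 := by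
  classical
  have hz : Complex.exp (Complex.I * edgeWavenumber i) = monoA ε μ E₀ := by
    rw [exp_I_mul, cos_edgeWavenumber, ha]
    have : Real.sin (edgeWavenumber i) = 0 := by
      have h1 := Real.sin_sq_add_cos_sq (edgeWavenumber i)
      rw [cos_edgeWavenumber, ← pow_mul, mul_comm, pow_mul] at h1
      have h2 : Real.sin (edgeWavenumber i) ^ 2 = 0 := by
        rw [neg_one_sq, one_pow] at h1; linarith
      exact pow_eq_zero_iff two_ne_zero |>.1 h2
    rw [this]; simp
  have hB : ∀ α β : ℂ, IsBlochSolution ε μ (edgeWavenumber i) E₀ (comb ε μ E₀ α β) := by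
    intro α β
    refine h.isBloch_comb ?_ ?_ <;> rw [hz]
    · rw [hb]; push_cast; ring
    · rw [hcE]; push_cast; ring
  apply le_antisymm
  · have h1 : Submodule.span ℂ {u : ℝ → ℂ | IsBlochSolution ε μ (edgeWavenumber i) E₀ u} ≤
        Submodule.span ℂ (({comb ε μ E₀ 1 0, comb ε μ E₀ 0 1} : Finset (ℝ → ℂ)) : Set (ℝ → ℂ)) := by
      rw [Submodule.span_le]
      intro w hw
      obtain ⟨α, β, rfl, -, -⟩ := (h.isBlochSolution_iff _ _ w).1 hw
      have hw2 : (fun x => α * (psi1 ε μ E₀ x : ℂ) + β * psi2 ε μ E₀ x) =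
          α • comb ε μ E₀ 1 0 + β • comb ε μ E₀ 0 1 := by
        funext x; simp [comb]
      rw [hw2]
      exact Submodule.add_mem _ (Submodule.smul_mem _ _ (Submodule.subset_span (by simp)))
        (Submodule.smul_mem _ _ (Submodule.subset_span (by simp)))
    refine ((Submodule.rank_mono h1).trans (rank_span_finset_le _)).trans ?_
    exact_mod_cast Finset.card_le_two
  · have hli : LinearIndependent ℂ ![comb ε μ E₀ 1 0, comb ε μ E₀ 0 1] := by
      refine linearIndependent_of_cellInner h.eps.isTame (fun i => ?_) (fun i => ?_)
        fun i j hij => ?_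
      · fin_cases i <;> exact h.continuous_comb _ _ _
      · fin_cases i
        · simp [h.cellInner_comb, (h.gram11_pos E₀).ne']
        · simp [h.cellInner_comb, (h.gram22_pos E₀).ne']
      · have hC := h.gram12_eq_zero hb hcE
        fin_cases i <;> fin_cases j <;> simp_all [h.cellInner_comb]
    have : ((2 : ℕ) : Cardinal) ≤ Module.rank ℂ (Submodule.span ℂ
        {u : ℝ → ℂ | IsBlochSolution ε μ (edgeWavenumber i) E₀ u}) := by
      rw [Module.le_rank_iff]
      refine ⟨fun i => ⟨![comb ε μ E₀ 1 0, comb ε μ E₀ 0 1] i, Submodule.subset_span ?_⟩,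
        LinearIndependent.of_comp (Submodule.subtype _) hli⟩
      fin_cases i <;> exact hB _ _
    exact_mod_cast this

/-- The same factor g governs both bands, so they have the same slope g(U i). One band lies below U
i and the other above, which resolves the absolute value of E - U i with opposite signs. -/
theorem isDiracPoint_of_touch {i : ℕ} (hi : 1 ≤ i) (hin : i < n) (ht : U i = L (i + 1)) :
    IsDiracPoint ε μ (edgeWavenumber i) (U i) := by
  have hbi := hc.band i hi hin.le
  have hbi' := hc.band (i + 1) (by omega) hin
  obtain ⟨hb, hcE⟩ := h.both_zero_of_touch hbi hbi' ht
  have ha : monoA ε μ (U i) = (-1) ^ i := by rw [hbi.upper, pow_succ]; ring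
  have he1 : bandEnergy ε μ i (edgeWavenumber i) = U i :=
    h.bandEnergy_upper hc hi hin.le (cos_edgeWavenumber i)
  have he2 : bandEnergy ε μ (i + 1) (edgeWavenumber i) = U i := by
    rw [ht]
    refine h.bandEnergy_lower hc (by omega) hin ?_
    rw [cos_edgeWavenumber, pow_succ, pow_succ]; ring
  obtain ⟨g, hg0, hg, hev⟩ := h.exists_linear_dispersion hb hcE
  obtain ⟨δ₁, hδ₁, C₁, h1⟩ := h.exists_dispersion_bound hc (i := i) hi hin.le hg0 hg hev he1
  obtain ⟨δ₂, hδ₂, C₂, h2⟩ := h.exists_dispersion_bound hc (i := i) (by omega) hin hg0 hg hev he2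
  refine ⟨⟨i, hi, he1, he2, g (U i), hg0, min δ₁ δ₂, lt_min hδ₁ hδ₂, max C₁ C₂, fun k hk => ?_⟩,
    h.rank_bloch_eq_two ha hb hcE⟩
  have h3 := h1 k (hk.trans_le (min_le_left _ _))
  have h4 := h2 k (hk.trans_le (min_le_right _ _))
  have h5 : bandEnergy ε μ i k - U i ≤ 0 := by linarith [(h.bandEnergy_spec hc hi hin.le k).1.2]
  have h6 : 0 ≤ bandEnergy ε μ (i + 1) k - U i := by
    linarith [(h.bandEnergy_spec hc (by omega : 1 ≤ i + 1) hin k).1.1]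
  rw [abs_of_nonpos h5, abs_sub_comm] at h3
  rw [abs_of_nonneg h6] at h4
  have hsq := sq_nonneg (k - edgeWavenumber i)
  refine ⟨?_, ?_⟩
  · refine le_trans (le_of_eq ?_) (h3.trans (mul_le_mul_of_nonneg_right (le_max_left _ _) hsq))
    congr 1; ring
  · refine le_trans (le_of_eq ?_) (h4.trans (mul_le_mul_of_nonneg_right (le_max_right _ _) hsq))
    congr 1; ring

omit hc in
theorem both_zero_of_rank {k E : ℝ} (hr : Module.rank ℂ (Submodule.span ℂ
    {u : ℝ → ℂ | IsBlochSolution ε μ k E u}) = 2) : monoB ε μ E = 0 ∧ monoC ε μ E = 0 := by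
  classical
  by_contra hne
  have h1 : Submodule.span ℂ {u : ℝ → ℂ | IsBlochSolution ε μ k E u} ≤
      Submodule.span ℂ (({bandModeOf ε μ k 0 E} : Finset (ℝ → ℂ)) : Set (ℝ → ℂ)) := by
    rw [Submodule.span_le]
    intro w hw
    simpa using h.mem_span_bandModeOf (u := 0) hne hw
  have h2 := (Submodule.rank_mono h1).trans (rank_span_finset_le _)
  rw [hr, Finset.card_singleton] at h2
  have : (2 : ℕ) ≤ 1 := by exact_mod_cast h2
  omega

open Classical in
/-- The Dirac points below the `m`-th band are the closed gaps below it. -/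
theorem numDiracBelow_eq {m : ℕ} (hm : 1 ≤ m) (hmn : m ≤ n) : numDiracBelow ε μ m =
    ((Finset.Ico 1 m).filter fun i => U i = L (i + 1)).card := by
  have hset : {q : ℝ × ℝ | q.1 ∈ Icc 0 π ∧ IsDiracPoint ε μ q.1 q.2 ∧ q.2 ≤ bandMin ε μ m} =
      (fun i => (edgeWavenumber i, U i)) ''
        (((Finset.Ico 1 m).filter fun i => U i = L (i + 1) : Finset ℕ) : Set ℕ) := by
    ext ⟨k, E⟩
    simp only [mem_ofPred_eq, Finset.coe_filter, Finset.mem_Ico, mem_image, Prod.mk.injEq]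
    rw [h.bandMin_eq hc hm hmn]
    constructor
    · rintro ⟨hk, hd, hE⟩
      obtain ⟨hb, hcE⟩ := h.both_zero_of_rank hd.2
      obtain ⟨i, hi, him, hEi, hUi⟩ := h.eq_edge_of_both_zero (BandChain.mono hc hmn) hm
        (hE.trans_lt (hc.band m hm hmn).lt) hb hcE
      refine ⟨i, ⟨⟨hi, him⟩, hUi⟩, ?_, hEi.symm⟩
      -- The energy determines cos k = a, and on the reduced zone [0, π] this determines k, so each
      -- closed gap counts once.
      refine injOn_cos (edgeWavenumber_mem i) hk ?_
      have hex : ∃ u, IsBlochSolution ε μ k E u ∧ u ≠ 0 := by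
        by_contra! hcon
        have : Submodule.span ℂ {u : ℝ → ℂ | IsBlochSolution ε μ k E u} = ⊥ := by
          rw [Submodule.span_eq_bot]; exact hcon
        have h2 := hd.2
        rw [this, rank_bot] at h2
        exact two_ne_zero h2.symm
      obtain ⟨u, hu, hu0⟩ := hex
      rw [cos_edgeWavenumber, ← h.monoA_eq_cos hu hu0, hEi,
        (hc.band i hi (by omega)).upper, pow_succ]
      ring
    · rintro ⟨i, ⟨⟨hi, him⟩, hUi⟩, rfl, rfl⟩
      exact ⟨edgeWavenumber_mem i, h.isDiracPoint_of_touch hc hi (by omega) hUi,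
        upper_le_lower hc hi him hmn⟩
  rw [numDiracBelow, hset, InjOn.ncard_image, ncard_coe_finset]
  intro i hi j hj hij
  simp only [Finset.coe_filter, Finset.mem_Ico, mem_ofPred_eq] at hi hj
  have hU : U i = U j := (Prod.mk.inj hij).2
  rcases lt_trichotomy i j with h1 | h1 | h1
  · exact absurd hU (upper_lt_upper hc hi.1.1 h1 (by omega)).ne
  · exact h1
  · exact absurd hU.symm (upper_lt_upper hc hj.1.1 h1 (by omega)).ne

end Chain

end IsSymmetricMedium

/-! ### The Bloch modes inside the half zone -/

/-- The `cellInner`-norm of `b ψ_{E,1} + i sin k ψ_{E,2}`. -/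
def modeN (ε μ : ℝ → ℝ) (k E : ℝ) : ℝ :=
  √(monoB ε μ E ^ 2 * gram11 ε μ E 1 + Real.sin k ^ 2 * gram22 ε μ E 1)

/-- The coefficient of `ψ_{E,1}` in the normalized Bloch mode. -/
def modeP (ε μ : ℝ → ℝ) (k E : ℝ) : ℝ := monoB ε μ E / modeN ε μ k E

/-- The coefficient of `i ψ_{E,2}` in the normalized Bloch mode. -/
def modeQ (ε μ : ℝ → ℝ) (k E : ℝ) : ℝ := Real.sin k / modeN ε μ k E

/-- The derivative of `ψ_{E,1}` with respect to the energy. -/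
def dpsi1 (ε μ : ℝ → ℝ) (E x : ℝ) : ℝ := psi1 ε μ E x * gram12 ε μ E x - psi2 ε μ E x * gram11 ε μ E x

/-- The derivative of `ψ_{E,2}` with respect to the energy. -/
def dpsi2 (ε μ : ℝ → ℝ) (E x : ℝ) : ℝ := psi1 ε μ E x * gram22 ε μ E x - psi2 ε μ E x * gram12 ε μ E x

namespace IsSymmetricMedium

variable {ε μ : ℝ → ℝ} (h : IsSymmetricMedium ε μ)
include h

theorem modeN_sq_pos {k E : ℝ} (hk : Real.sin k ≠ 0) :
    0 < monoB ε μ E ^ 2 * gram11 ε μ E 1 + Real.sin k ^ 2 * gram22 ε μ E 1 := by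
  have hA := h.gram11_pos E
  have hB := h.gram22_pos E
  have : 0 < Real.sin k ^ 2 := by positivity
  positivity

theorem modeN_pos {k E : ℝ} (hk : Real.sin k ≠ 0) : 0 < modeN ε μ k E :=
  sqrt_pos.2 (h.modeN_sq_pos hk)

theorem modeP_sq_add_modeQ_sq {k E : ℝ} (hk : Real.sin k ≠ 0) :
    modeP ε μ k E ^ 2 * gram11 ε μ E 1 + modeQ ε μ k E ^ 2 * gram22 ε μ E 1 = 1 := by
  have h1 := h.modeN_pos (E := E) hk
  have h2 : modeN ε μ k E ^ 2 =
      monoB ε μ E ^ 2 * gram11 ε μ E 1 + Real.sin k ^ 2 * gram22 ε μ E 1 :=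
    sq_sqrt (h.modeN_sq_pos hk).le
  rw [modeP, modeQ, div_pow, div_pow, h2]
  have := (h.modeN_sq_pos (E := E) hk).ne'
  field_simp

theorem isRegularFamily_dpsi1 : IsRegularFamily (dpsi1 ε μ) :=
  ((isRegularFamily_psi1 h.eps.isTame h.mu.isTame).mul
    (isRegularFamily_gram12 h.eps.isTame h.mu.isTame)).sub
    ((isRegularFamily_psi2 h.eps.isTame h.mu.isTame).mul
    (isRegularFamily_gram11 h.eps.isTame h.mu.isTame))

theorem isRegularFamily_dpsi2 : IsRegularFamily (dpsi2 ε μ) :=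
  ((isRegularFamily_psi1 h.eps.isTame h.mu.isTame).mul
    (isRegularFamily_gram22 h.eps.isTame h.mu.isTame)).sub
    ((isRegularFamily_psi2 h.eps.isTame h.mu.isTame).mul
    (isRegularFamily_gram12 h.eps.isTame h.mu.isTame))

theorem hasDerivAt_gram11 (E : ℝ) : HasDerivAt (fun E => gram11 ε μ E 1)
    (∫ t in (0 : ℝ)..1, ε t * (dpsi1 ε μ E t * psi1 ε μ E t + psi1 ε μ E t * dpsi1 ε μ E t)) E := by
  have h1 := isRegularFamily_psi1 h.eps.isTame h.mu.isTame
  have h2 := h.isRegularFamily_dpsi1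
  exact (h1.mul h1).hasDerivAt_integral ((h2.mul h1).add (h1.mul h2)) (fun E x =>
    (hasDerivAt_psi1 h.eps.isTame h.mu.isTame E x).mul
      (hasDerivAt_psi1 h.eps.isTame h.mu.isTame E x)) h.eps.isTame E

theorem hasDerivAt_gram22 (E : ℝ) : HasDerivAt (fun E => gram22 ε μ E 1)
    (∫ t in (0 : ℝ)..1, ε t * (dpsi2 ε μ E t * psi2 ε μ E t + psi2 ε μ E t * dpsi2 ε μ E t)) E := by
  have h1 := isRegularFamily_psi2 h.eps.isTame h.mu.isTame
  have h2 := h.isRegularFamily_dpsi2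
  exact (h1.mul h1).hasDerivAt_integral ((h2.mul h1).add (h1.mul h2)) (fun E x =>
    (hasDerivAt_psi2 h.eps.isTame h.mu.isTame E x).mul
      (hasDerivAt_psi2 h.eps.isTame h.mu.isTame E x)) h.eps.isTame E

section Chain

variable {n : ℕ} {L U : ℕ → ℝ} (hc : BandChain ε μ n L U) {j : ℕ} (hj : 1 ≤ j) (hjn : j ≤ n)
include hc hj hjn

theorem rawMode_eq (k : ℝ) : rawMode ε μ j k =
    comb ε μ (bandEnergy ε μ j k) (monoB ε μ (bandEnergy ε μ j k)) (Complex.I * Real.sin k) := by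
  have ha := (h.bandEnergy_spec hc hj hjn k).2
  funext x
  rw [rawMode, comb, exp_I_mul, ← monoA, ha]
  ring

theorem monoB_ne_zero {k : ℝ} (hk : k ∈ Ioo 0 π) : monoB ε μ (bandEnergy ε μ j k) ≠ 0 := by
  have ha := (h.bandEnergy_spec hc hj hjn k).2
  have h1 := h.mul_eq_neg_sin_sq ha
  intro h0
  rw [h0, zero_mul, eq_comm, neg_eq_zero] at h1
  exact (sin_pos_of_mem_Ioo hk).ne' (pow_eq_zero_iff two_ne_zero |>.1 h1)

theorem halfZoneMode_eq {k : ℝ} (hk : k ∈ Ioo 0 π) : halfZoneMode ε μ j k =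
    comb ε μ (bandEnergy ε μ j k) (modeP ε μ k (bandEnergy ε μ j k))
      (Complex.I * modeQ ε μ k (bandEnergy ε μ j k)) := by
  have hne : rawMode ε μ j k ≠ 0 := by
    intro h0
    have h1 := congrFun h0 0
    rw [h.rawMode_eq hc hj hjn, comb, h.psi1_zero, h.psi2_zero] at h1
    simp only [Complex.ofReal_one, mul_one, Complex.ofReal_zero, mul_zero, add_zero,
      Pi.zero_apply] at h1
    exact h.monoB_ne_zero hc hj hjn hk (by exact_mod_cast h1)
  have hN : cellNorm ε (rawMode ε μ j k) = modeN ε μ k (bandEnergy ε μ j k) := by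
    rw [cellNorm, h.rawMode_eq hc hj hjn, h.cellInner_comb, modeN]
    congr 1
    simp only [map_mul, Complex.conj_ofReal, Complex.conj_I, Complex.add_re, Complex.mul_re,
      Complex.ofReal_re, Complex.ofReal_im, Complex.mul_im, Complex.I_re, Complex.I_im,
      Complex.neg_re, Complex.neg_im, Complex.add_im]
    ring
  rw [halfZoneMode, if_pos hne]
  funext x
  rw [hN, h.rawMode_eq hc hj hjn, comb, comb, modeP, modeQ]
  push_cast
  ring

theorem periodicPart_eq {k : ℝ} (hk : k ∈ Ioo 0 π) (x : ℝ) : periodicPart ε μ j k x =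
    (modeP ε μ k (bandEnergy ε μ j k) * psi1 ε μ (bandEnergy ε μ j k) x +
      Complex.I * modeQ ε μ k (bandEnergy ε μ j k) * psi2 ε μ (bandEnergy ε μ j k) x) *
      Complex.exp (-(Complex.I * k * x)) := by
  rw [periodicPart, blochMode, if_pos hk.1.le, h.halfZoneMode_eq hc hj hjn hk, comb]

/-- As a function of cos k the band energy inverts a, whose derivative does not vanish inside the
band; the substitution k = arccos y is smooth away from 0 and π. -/
theorem differentiableAt_bandEnergy {k : ℝ} (hk : k ∈ Ioo 0 π) :
    DifferentiableAt ℝ (bandEnergy ε μ j) k := by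
  have hb := hc.band j hj hjn
  set e := bandEnergy ε μ j
  have hspec := h.bandEnergy_spec hc hj hjn
  have hab : |monoA ε μ (e k)| < 1 := by
    rw [(hspec k).2, abs_lt]
    refine ⟨?_, ?_⟩
    · rw [← cos_pi]; exact cos_lt_cos_of_nonneg_of_le_pi hk.1.le le_rfl hk.2
    · rw [← cos_zero]; exact cos_lt_cos_of_nonneg_of_le_pi le_rfl hk.2.le hk.1
  have hac : arccos (Real.cos k) = k := arccos_cos hk.1.le hk.2.le
  have hlt := abs_lt.1 (by rw [← (hspec k).2]; exact hab : |Real.cos k| < 1)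
  have h1 : HasDerivAt (fun y => e (arccos y)) _ (Real.cos k) :=
    HasDerivAt.of_local_left_inverse (f := monoA ε μ)
      ((h.continuous_bandEnergy hc hj hjn).comp continuous_arccos).continuousAt
      (by rw [hac]; exact h.hasDerivAt_monoA (e k)) (h.deriv_ne_zero_of_abs_lt hab)
      (by
        filter_upwards [Icc_mem_nhds hlt.1 hlt.2] with y hy
        rw [(hspec _).2, cos_arccos hy.1 hy.2])
  have h2 := (h1.comp k (hasDerivAt_cos k)).differentiableAt
  refine h2.congr_of_eventuallyEq ?_
  filter_upwards [Ioo_mem_nhds hk.1 hk.2] with κ hκ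
  simp only [Function.comp, arccos_cos hκ.1.le hκ.2.le]

theorem differentiableAt_modePQ {k : ℝ} (hk : k ∈ Ioo 0 π) :
    DifferentiableAt ℝ (fun κ => modeP ε μ κ (bandEnergy ε μ j κ)) k ∧
    DifferentiableAt ℝ (fun κ => modeQ ε μ κ (bandEnergy ε μ j κ)) k := by
  have he := h.differentiableAt_bandEnergy hc hj hjn hk
  have hs := (sin_pos_of_mem_Ioo hk).ne'
  have hb : DifferentiableAt ℝ (fun κ => monoB ε μ (bandEnergy ε μ j κ)) k :=
    (h.hasDerivAt_monoB _).differentiableAt.comp k he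
  have hA : DifferentiableAt ℝ (fun κ => gram11 ε μ (bandEnergy ε μ j κ) 1) k :=
    (h.hasDerivAt_gram11 _).differentiableAt.comp k he
  have hB : DifferentiableAt ℝ (fun κ => gram22 ε μ (bandEnergy ε μ j κ) 1) k :=
    (h.hasDerivAt_gram22 _).differentiableAt.comp k he
  have hsin : DifferentiableAt ℝ Real.sin k := Real.differentiableAt_sin
  have hN : DifferentiableAt ℝ (fun κ => modeN ε μ κ (bandEnergy ε μ j κ)) k :=
    (((hb.pow 2).mul hA).add ((hsin.pow 2).mul hB)).sqrt (h.modeN_sq_pos hs).ne'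
  exact ⟨hb.div hN (h.modeN_pos hs).ne', hsin.div hN (h.modeN_pos hs).ne'⟩

/-- The reflection x ↦ 1 - x acts on ψ₁, ψ₂ through the monodromy matrix. The mode is real along ψ₁,
imaginary along ψ₂, and an eigenvector for exp(ik), so reflecting it amounts to conjugating it. -/
theorem periodicPart_one_sub {k : ℝ} (hk : k ∈ Ioo 0 π) (x : ℝ) :
    periodicPart ε μ j k (1 - x) = (starRingEnd ℂ) (periodicPart ε μ j k x) := by
  have ha := (h.bandEnergy_spec hc hj hjn k).2
  rw [h.periodicPart_eq hc hj hjn hk, h.periodicPart_eq hc hj hjn hk, h.psi1_one_sub,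
    h.psi2_one_sub]
  set E := bandEnergy ε μ j k
  have hbc := h.mul_eq_neg_sin_sq ha
  have hN := (h.modeN_pos (E := E) (sin_pos_of_mem_Ioo hk).ne').ne'
  have h1 : modeQ ε μ k E * monoB ε μ E = Real.sin k * modeP ε μ k E := by
    rw [modeP, modeQ]; ring
  have h2 : modeP ε μ k E * monoC ε μ E = -(Real.sin k * modeQ ε μ k E) := by
    rw [modeP, modeQ]
    field_simp
    linear_combination hbc
  have h1' : (modeQ ε μ k E : ℂ) * monoB ε μ E = Real.sin k * modeP ε μ k E := by
    exact_mod_cast h1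
  have h2' : (modeP ε μ k E : ℂ) * monoC ε μ E = -(Real.sin k * modeQ ε μ k E) := by
    exact_mod_cast h2
  have h3 : Complex.exp (-(Complex.I * k * ((1 - x : ℝ) : ℂ))) * Complex.exp (Complex.I * k) =
      Complex.exp (Complex.I * k * x) := by
    rw [← Complex.exp_add]
    congr 1
    push_cast
    ring
  have h4 : (starRingEnd ℂ) (Complex.exp (-(Complex.I * k * x))) = Complex.exp (Complex.I * k * x) := by
    rw [← Complex.exp_conj]
    congr 1
    simp
  rw [map_mul, h4, ← h3, exp_I_mul]
  simp only [map_add, map_mul, Complex.conj_ofReal, Complex.conj_I, Complex.ofReal_sub,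
    Complex.ofReal_mul]
  rw [ha]
  linear_combination (Complex.I * psi1 ε μ E x * Complex.exp (-(Complex.I * k * (1 - x)))) * h1'
    - (psi2 ε μ E x * Complex.exp (-(Complex.I * k * (1 - x)))) * h2'
    + (Real.sin k * modeQ ε μ k E * psi2 ε μ E x * Complex.exp (-(Complex.I * k * (1 - x)))) *
      Complex.I_sq

/-- The Berry connection vanishes on the positive half of the zone. -/
theorem berryConnection_eq_zero {k : ℝ} (hk : k ∈ Ioo 0 π) : berryConnection ε μ j k = 0 := by
  have hmem : Ioo 0 π ∈ 𝓝 k := Ioo_mem_nhds hk.1 hk.2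
  set e := bandEnergy ε μ j with he_def
  set u : ℝ → ℝ → ℂ := fun κ x => periodicPart ε μ j κ x with hu_def
  set u' : ℝ → ℂ := fun x => deriv (fun κ => u κ x) k with hu'_def
  have hI : berryConnection ε μ j k =
      ∫ x in (0 : ℝ)..1, (ε x : ℂ) * (u' x * (starRingEnd ℂ) (u k x)) := rfl
  -- symmetry
  have hu'_symm : ∀ x, u' (1 - x) = (starRingEnd ℂ) (u' x) := by
    intro x
    have h1 : (fun κ => u κ (1 - x)) =ᶠ[𝓝 k] fun κ => star (u κ x) := by
      filter_upwards [hmem] with κ hκ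
      exact h.periodicPart_one_sub hc hj hjn hκ x
    rw [hu'_def]
    beta_reduce
    rw [h1.deriv_eq, deriv.star]
    rfl
  -- The substitution x ↦ 1 - x turns the integrand into its conjugate, because ε is invariant.
  have hreal : (starRingEnd ℂ) (berryConnection ε μ j k) = berryConnection ε μ j k := by
    rw [hI]
    have h1 := intervalIntegral.integral_comp_sub_left (a := 0) (b := 1)
      (fun x => (ε x : ℂ) * (u' x * (starRingEnd ℂ) (u k x))) 1
    rw [sub_self, sub_zero] at h1
    rw [← h1, ← intervalIntegral.intervalIntegral_conj]
    conv_rhs => rw [h1]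
    congr 1
    ext x
    rw [hu'_symm, ← h.eps.inversion, show u k (1 - x) = (starRingEnd ℂ) (u k x) from
      h.periodicPart_one_sub hc hj hjn hk x]
    simp
  -- normalization
  by_cases hint : IntervalIntegrable (fun x => (ε x : ℂ) * (u' x * (starRingEnd ℂ) (u k x)))
    volume 0 1
  -- A non-integrable integrand would have integral zero by convention, so this case needs no
  -- argument.
  swap
  · rw [hI]; exact intervalIntegral.integral_undef hint
  obtain ⟨hP, hQ⟩ := h.differentiableAt_modePQ hc hj hjn hk
  have hP := hP.hasDerivAt
  have hQ := hQ.hasDerivAt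
  have he := (h.differentiableAt_bandEnergy hc hj hjn hk).hasDerivAt
  set P := fun κ => modeP ε μ κ (e κ) with hP_def
  set Q := fun κ => modeQ ε μ κ (e κ) with hQ_def
  set P' := deriv P k
  set Q' := deriv Q k
  set e' := deriv e k
  have hψ1 : ∀ x, HasDerivAt (fun κ => psi1 ε μ (e κ) x) (dpsi1 ε μ (e k) x * e') k := fun x =>
    (hasDerivAt_psi1 h.eps.isTame h.mu.isTame (e k) x).comp k he
  have hψ2 : ∀ x, HasDerivAt (fun κ => psi2 ε μ (e κ) x) (dpsi2 ε μ (e k) x * e') k := fun x =>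
    (hasDerivAt_psi2 h.eps.isTame h.mu.isTame (e k) x).comp k he
  let ρ' : ℝ → ℝ := fun x => (2 * P k * P') * (psi1 ε μ (e k) x * psi1 ε μ (e k) x) +
    (P k ^ 2 * e') * (dpsi1 ε μ (e k) x * psi1 ε μ (e k) x + psi1 ε μ (e k) x * dpsi1 ε μ (e k) x) +
    ((2 * Q k * Q') * (psi2 ε μ (e k) x * psi2 ε μ (e k) x) +
    (Q k ^ 2 * e') * (dpsi2 ε μ (e k) x * psi2 ε μ (e k) x + psi2 ε μ (e k) x * dpsi2 ε μ (e k) x))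
  -- The real part of the integrand is half the k-derivative of ε|u|². The exponential has modulus
  -- one, so |u|² = P²ψ₁² + Q²ψ₂².
  have hre : ∀ x, ((ε x : ℂ) * (u' x * (starRingEnd ℂ) (u k x))).re = ε x * (ρ' x) / 2 := by
    intro x
    have hud : HasDerivAt (fun κ => u κ x) (u' x) k := by
      have h1 : DifferentiableAt ℝ (fun κ : ℝ => ((P κ : ℂ) * psi1 ε μ (e κ) x +
          Complex.I * Q κ * psi2 ε μ (e κ) x) * Complex.exp (-(Complex.I * κ * x))) k := by
        have h2 : HasDerivAt (fun κ : ℝ => Complex.exp (-(Complex.I * κ * x)))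
            (Complex.exp (-(Complex.I * k * x)) * (-(Complex.I * (1 : ℝ) * x))) k :=
          ((((hasDerivAt_id k).ofReal_comp).const_mul Complex.I).mul_const (x : ℂ)).neg.cexp
        exact (((hP.ofReal_comp.mul (hψ1 x).ofReal_comp).add
          ((hQ.ofReal_comp.const_mul Complex.I).mul (hψ2 x).ofReal_comp)).mul h2).differentiableAt
      refine (h1.congr_of_eventuallyEq ?_).hasDerivAt
      filter_upwards [hmem] with κ hκ
      exact h.periodicPart_eq hc hj hjn hκ x
    have h1 : HasDerivAt (fun κ => Complex.normSq (u κ x)) (2 * (u' x * (starRingEnd ℂ) (u k x)).re) k := by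
      have h2 : HasDerivAt (fun κ => (u κ x).re) (u' x).re k :=
        Complex.reCLM.hasFDerivAt.comp_hasDerivAt k hud
      have h3 : HasDerivAt (fun κ => (u κ x).im) (u' x).im k :=
        Complex.imCLM.hasFDerivAt.comp_hasDerivAt k hud
      refine ((h2.fun_mul h2).fun_add (h3.fun_mul h3)).congr_deriv ?_
      simp only [Complex.mul_re, Complex.conj_re, Complex.conj_im]
      ring
    have h4 : HasDerivAt (fun κ => P κ * P κ * (psi1 ε μ (e κ) x * psi1 ε μ (e κ) x) +
        Q κ * Q κ * (psi2 ε μ (e κ) x * psi2 ε μ (e κ) x)) (ρ' x) k := by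
      refine (((hP.fun_mul hP).fun_mul ((hψ1 x).fun_mul (hψ1 x))).fun_add
        ((hQ.fun_mul hQ).fun_mul ((hψ2 x).fun_mul (hψ2 x)))).congr_deriv ?_
      simp only [ρ']
      ring
    have h5 : (fun κ => Complex.normSq (u κ x)) =ᶠ[𝓝 k] fun κ =>
        P κ * P κ * (psi1 ε μ (e κ) x * psi1 ε μ (e κ) x) +
        Q κ * Q κ * (psi2 ε μ (e κ) x * psi2 ε μ (e κ) x) := by
      filter_upwards [hmem] with κ hκ
      have h6 : u κ x = _ := h.periodicPart_eq hc hj hjn hκ x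
      have h7 : Complex.normSq (Complex.exp (-(Complex.I * κ * x))) = 1 := by
        rw [Complex.normSq_eq_norm_sq, show -(Complex.I * κ * x) = ((-(κ * x) : ℝ) : ℂ) * Complex.I by
          push_cast; ring, Complex.norm_exp_ofReal_mul_I, one_pow]
      rw [h6, Complex.normSq_mul, h7, mul_one, Complex.normSq_apply]
      simp only [Complex.add_re, Complex.mul_re, Complex.ofReal_re, Complex.ofReal_im,
        Complex.mul_im, Complex.I_re, Complex.I_im, Complex.add_im, P, Q]
      ring
    have h8 := (h1.congr_of_eventuallyEq h5.symm).unique h4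
    rw [Complex.re_ofReal_mul]
    linear_combination (ε x / 2) * h8
  -- The integral is the k-derivative of the squared norm of the mode, which is constantly 1.
  have hzero : ∫ x in (0 : ℝ)..1, ε x * ρ' x = 0 := by
    have hε := h.eps.isTame
    have c1 := h.continuous_psi1 (e k)
    have c2 := h.continuous_psi2 (e k)
    have c3 := h.isRegularFamily_dpsi1.continuous_right (e k)
    have c4 := h.isRegularFamily_dpsi2.continuous_right (e k)
    have i1 := (hε.intervalIntegrable_mul (u := fun x => psi1 ε μ (e k) x * psi1 ε μ (e k) x)
      (by fun_prop) 0 1).const_mul (2 * P k * P')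
    have i2 := (hε.intervalIntegrable_mul (u := fun x => dpsi1 ε μ (e k) x * psi1 ε μ (e k) x +
      psi1 ε μ (e k) x * dpsi1 ε μ (e k) x) (by fun_prop) 0 1).const_mul (P k ^ 2 * e')
    have i3 := (hε.intervalIntegrable_mul (u := fun x => psi2 ε μ (e k) x * psi2 ε μ (e k) x)
      (by fun_prop) 0 1).const_mul (2 * Q k * Q')
    have i4 := (hε.intervalIntegrable_mul (u := fun x => dpsi2 ε μ (e k) x * psi2 ε μ (e k) x +
      psi2 ε μ (e k) x * dpsi2 ε μ (e k) x) (by fun_prop) 0 1).const_mul (Q k ^ 2 * e')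
    have h1 : HasDerivAt (fun κ => P κ * P κ * gram11 ε μ (e κ) 1 + Q κ * Q κ * gram22 ε μ (e κ) 1)
        (∫ x in (0 : ℝ)..1, ε x * ρ' x) k := by
      have hA := (h.hasDerivAt_gram11 (e k)).comp k he
      have hB := (h.hasDerivAt_gram22 (e k)).comp k he
      refine (((hP.fun_mul hP).fun_mul hA).fun_add ((hQ.fun_mul hQ).fun_mul hB)).congr_deriv ?_
      have h2 : ∫ x in (0 : ℝ)..1, ε x * ρ' x = (2 * P k * P') * gram11 ε μ (e k) 1 +
          (P k ^ 2 * e') * (∫ t in (0 : ℝ)..1, ε t * (dpsi1 ε μ (e k) t * psi1 ε μ (e k) t +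
            psi1 ε μ (e k) t * dpsi1 ε μ (e k) t)) + ((2 * Q k * Q') * gram22 ε μ (e k) 1 +
          (Q k ^ 2 * e') * (∫ t in (0 : ℝ)..1, ε t * (dpsi2 ε μ (e k) t * psi2 ε μ (e k) t +
            psi2 ε μ (e k) t * dpsi2 ε μ (e k) t))) := by
        simp only [gram11, gram22, ← intervalIntegral.integral_const_mul]
        rw [← intervalIntegral.integral_add i1 i2, ← intervalIntegral.integral_add i3 i4,
          ← intervalIntegral.integral_add (i1.add i2) (i3.add i4)]
        congr 1
        ext x
        simp only [ρ']
        ring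
      rw [h2]
      simp only [Function.comp]
      ring
    have h3 : HasDerivAt (fun κ => P κ * P κ * gram11 ε μ (e κ) 1 + Q κ * Q κ * gram22 ε μ (e κ) 1)
        0 k := by
      refine (hasDerivAt_const k (1 : ℝ)).congr_of_eventuallyEq ?_
      filter_upwards [hmem] with κ hκ
      have := h.modeP_sq_add_modeQ_sq (E := e κ) (sin_pos_of_mem_Ioo hκ).ne'
      rw [sq, sq] at this
      exact this
    exact h1.unique h3
  have hre0 : (berryConnection ε μ j k).re = 0 := by
    have h1 := Complex.reCLM.intervalIntegral_comp_comm hint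
    simp only [Complex.reCLM_apply] at h1
    rw [hI, ← h1]
    simp only [hre, intervalIntegral.integral_div, hzero, zero_div]
  exact Complex.ext hre0 (Complex.conj_eq_iff_im.1 hreal)

end Chain

end IsSymmetricMedium

/-! ### The Zak phase -/

open Classical in
/-- The parity of the Bloch mode at an edge of an open gap, `-1` if the mode is odd, and `1` at a
Dirac point. -/
def edgeSign (ε μ : ℝ → ℝ) (E : ℝ) : ℝ := if monoB ε μ E = 0 ∧ monoC ε μ E ≠ 0 then -1 else 1

open Classical in
/-- The overlap of a limiting Bloch mode at a band edge with its reflection. -/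
def edgeOverlap (ε μ : ℝ → ℝ) (E : ℝ) : ℝ :=
  if monoB ε μ E = 0 then (if monoC ε μ E = 0 then 0 else -1) else 1

/-- The overlaps 1, -1 and 0 have the phases 0, -π and 0; the convention for a vanishing overlap is
what makes a Dirac point count with sign 1. -/
theorem exp_jumpPhase_edgeOverlap (ε μ : ℝ → ℝ) (E : ℝ) :
    Complex.exp (Complex.I * jumpPhase (edgeOverlap ε μ E)) = edgeSign ε μ E := by
  unfold edgeOverlap edgeSign jumpPhase
  by_cases hb : monoB ε μ E = 0
  · by_cases hc : monoC ε μ E = 0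
    · simp [hb, hc]
    · simp only [hb, hc, if_true, if_false, ne_eq, not_false_eq_true, and_self, Complex.ofReal_neg,
        Complex.ofReal_one, neg_eq_zero, one_ne_zero, Complex.log_neg_one, Complex.mul_im,
        Complex.ofReal_re, Complex.I_im, mul_one, Complex.ofReal_im, Complex.I_re, mul_zero,
        add_zero]
      rw [mul_neg, Complex.exp_neg, mul_comm, Complex.exp_pi_mul_I]
      norm_num
  · simp [hb]

namespace IsSymmetricMedium

variable {ε μ : ℝ → ℝ} (h : IsSymmetricMedium ε μ)
include h

theorem comb_neg (E : ℝ) (α β : ℂ) (x : ℝ) : comb ε μ E α β (-x) = comb ε μ E α (-β) x := by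
  simp only [comb, h.psi1_neg, h.psi2_neg]
  push_cast
  ring

/-- Reflection negates the coefficient of ψ₂, so the overlap is the even weight minus the odd
weight. The cross term drops out at a pure-parity edge because PQ = 0, at a Dirac point because ψ₁
and ψ₂ are orthogonal. -/
theorem cellInner_comb_neg {E P Q : ℝ} (hPQ : P * Q * gram12 ε μ E 1 = 0) :
    cellInner ε (comb ε μ E P (Complex.I * Q)) (comb ε μ E P (-(Complex.I * Q))) =
      ((P ^ 2 * gram11 ε μ E 1 - Q ^ 2 * gram22 ε μ E 1 : ℝ) : ℂ) ∧
    cellInner ε (comb ε μ E P (-(Complex.I * Q))) (comb ε μ E P (Complex.I * Q)) =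
      ((P ^ 2 * gram11 ε μ E 1 - Q ^ 2 * gram22 ε μ E 1 : ℝ) : ℂ) := by
  have h1 : (P : ℂ) * Q * gram12 ε μ E 1 = 0 := by exact_mod_cast hPQ
  rw [h.cellInner_comb, h.cellInner_comb]
  simp only [map_neg, map_mul, Complex.conj_ofReal, Complex.conj_I]
  push_cast
  constructor
  · linear_combination (2 * Complex.I) * h1 + (Q ^ 2 * gram22 ε μ E 1 : ℂ) * Complex.I_sq
  · linear_combination (-2 * Complex.I) * h1 + (Q ^ 2 * gram22 ε μ E 1 : ℂ) * Complex.I_sq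

section Chain

variable {n : ℕ} {L U : ℕ → ℝ} (hc : BandChain ε μ n L U) {j : ℕ} (hj : 1 ≤ j) (hjn : j ≤ n)
include hc hj hjn

/-- Reflection changes the sign of ψ₂, whose coefficient is imaginary, so the inversion that defines
the negative half of the zone is complex conjugation. -/
theorem periodicPart_of_neg {k : ℝ} (hk : k ∈ Ioo (-π) 0) (x : ℝ) :
    periodicPart ε μ j k x = (starRingEnd ℂ) (periodicPart ε μ j (-k) x) := by
  have hk' : -k ∈ Ioo 0 π := ⟨by linarith [hk.2], by linarith [hk.1]⟩
  rw [h.periodicPart_eq hc hj hjn hk', periodicPart, blochMode, if_neg (not_le.2 hk.2),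
    h.halfZoneMode_eq hc hj hjn hk', h.comb_neg, comb, map_mul, ← Complex.exp_conj]
  simp only [map_add, map_mul, map_neg, Complex.conj_ofReal, Complex.conj_I, Complex.ofReal_neg]
  ring_nf

theorem berryConnection_of_neg {k : ℝ} (hk : k ∈ Ioo (-π) 0) : berryConnection ε μ j k = 0 := by
  have hk' : -k ∈ Ioo 0 π := ⟨by linarith [hk.2], by linarith [hk.1]⟩
  have hd : ∀ x, deriv (fun κ => periodicPart ε μ j κ x) k =
      -(starRingEnd ℂ) (deriv (fun κ => periodicPart ε μ j κ x) (-k)) := by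
    intro x
    have h1 : (fun κ => periodicPart ε μ j κ x) =ᶠ[𝓝 k]
        fun κ => star (periodicPart ε μ j (-κ) x) := by
      filter_upwards [Ioo_mem_nhds hk.1 hk.2] with κ hκ
      exact h.periodicPart_of_neg hc hj hjn hκ x
    rw [h1.deriv_eq, deriv.star, deriv_comp_neg (fun κ => periodicPart ε μ j κ x), star_neg]
    rfl
  have h1 : berryConnection ε μ j k = -(starRingEnd ℂ) (berryConnection ε μ j (-k)) := by
    unfold berryConnection cellInner
    rw [← intervalIntegral.intervalIntegral_conj, ← intervalIntegral.integral_neg]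
    congr 1
    ext x
    simp only [hd, h.periodicPart_of_neg hc hj hjn hk]
    simp
  rw [h1, h.berryConnection_eq_zero hc hj hjn hk', map_zero, neg_zero]

theorem zakPhase_eq : zakPhase ε μ j =
    jumpPhase (cellInner ε (edgeMode ε μ j (𝓝[>] 0)) (edgeMode ε μ j (𝓝[<] 0))) +
    jumpPhase (cellInner ε (edgeMode ε μ j (𝓝[>] (-π))) (edgeMode ε μ j (𝓝[<] π))) := by
  have hπ : -π ≤ 0 := by linarith [pi_pos]
  have h1 : ∫ k in (-π)..0, berryConnection ε μ j k = 0 := by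
    rw [intervalIntegral.integral_congr_Ioo_of_le hπ
      (g := fun _ => (0 : ℂ)) fun k hk => h.berryConnection_of_neg hc hj hjn hk]
    simp
  have h2 : ∫ k in (0 : ℝ)..π, berryConnection ε μ j k = 0 := by
    rw [intervalIntegral.integral_congr_Ioo_of_le pi_pos.le
      (g := fun _ => (0 : ℂ)) fun k hk => h.berryConnection_eq_zero hc hj hjn hk]
    simp
  rw [zakPhase, h1, h2]
  simp

/-- Where b vanishes at an edge, bψ₁ + i sin k ψ₂ tends to 0, and its limiting direction is the
limit t of b / sin k. From bc = -sin² k one gets b / sin k = -sin k / c, which tends to 0 if c ≠ 0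
at the edge. If c = 0 as well, (b / sin k)² = -b/c tends to the quotient of derivatives ∫εψ₂²/∫εψ₁²,
and the sign of the root is that of b in the band. -/
theorem tendsto_modeB_div_sin {l : Filter ℝ} {k₀ : ℝ} (hl : l ≤ 𝓝 k₀)
    (hlI : ∀ᶠ k in l, k ∈ Ioo 0 π) (hs : Real.sin k₀ = 0)
    (hb : monoB ε μ (bandEnergy ε μ j k₀) = 0) :
    ∃ t : ℝ, Tendsto (fun k => monoB ε μ (bandEnergy ε μ j k) / Real.sin k) l (𝓝 t) ∧
      (monoC ε μ (bandEnergy ε μ j k₀) ≠ 0 → t = 0) ∧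
      (monoC ε μ (bandEnergy ε μ j k₀) = 0 →
        t ^ 2 * gram11 ε μ (bandEnergy ε μ j k₀) 1 = gram22 ε μ (bandEnergy ε μ j k₀) 1) := by
  set e := bandEnergy ε μ j with he_def
  have hspec := h.bandEnergy_spec hc hj hjn
  have he : Tendsto e l (𝓝 (e k₀)) := ((h.continuous_bandEnergy hc hj hjn).tendsto k₀).mono_left hl
  by_cases hcE : monoC ε μ (e k₀) = 0
  · have hband := hc.band j hj hjn
    set s : ℝ := (-1) ^ (j + 1)
    have hss := mul_self_of_sign hband.sign
    have hA := h.gram11_pos (e k₀)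
    have hB := h.gram22_pos (e k₀)
    have ha0 : monoA ε μ (e k₀) ≠ 0 := fun h0 => by
      have := h.monoA_sq (e k₀)
      rw [h0, hb] at this
      norm_num at this
    have habs : ∀ k ∈ Ioo 0 π, |monoA ε μ (e k)| < 1 := by
      intro k hk
      have h1 := h.monoA_sq (e k)
      have h2 := h.mul_eq_neg_sin_sq (hspec k).2
      have h3 : 0 < Real.sin k ^ 2 := pow_pos (sin_pos_of_mem_Ioo hk) 2
      exact (sq_lt_one_iff_abs_lt_one _).1 (by linarith)
    have hsa : |s| = 1 := by simp [s]
    have hin : ∀ k ∈ Ioo 0 π, e k ∈ Ioo (L j) (U j) := by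
      intro k hk
      have h1 := habs k hk
      refine ⟨lt_of_le_of_ne (hspec k).1.1 fun h0 => ?_, lt_of_le_of_ne (hspec k).1.2 fun h0 => ?_⟩
      · rw [← h0, hband.lower, hsa] at h1
        exact lt_irrefl _ h1
      · rw [h0, hband.upper, abs_neg, hsa] at h1
        exact lt_irrefl _ h1
    have hne : ∀ᶠ k in l, e k ∈ ({e k₀}ᶜ : Set ℝ) := by
      filter_upwards [hlI] with k hk h0
      have h1 := habs k hk
      rw [mem_singleton_iff.1 h0] at h1
      have h2 := h.monoA_sq (e k₀)
      rw [hb, zero_mul, add_zero] at h2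
      rw [← sq_lt_one_iff_abs_lt_one, h2] at h1
      exact lt_irrefl _ h1
    have he' : Tendsto e l (𝓝[≠] (e k₀)) := tendsto_nhdsWithin_iff.2 ⟨he, hne⟩
    have hdb := (hasDerivAt_iff_tendsto_slope.1 (h.hasDerivAt_monoB (e k₀))).comp he'
    have hdc := (hasDerivAt_iff_tendsto_slope.1 (h.hasDerivAt_monoC (e k₀))).comp he'
    have hC := h.gram12_eq_zero hb hcE
    rw [hC, hb, mul_zero, sub_zero] at hdb
    rw [hC, mul_zero, zero_sub] at hdc
    have hq := (hdb.div hdc (by simp [ha0, hA.ne'])).neg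
    rw [mul_div_assoc, mul_comm, div_mul_eq_mul_div] at hq
    have hsq : Tendsto (fun k => (monoB ε μ (e k) / Real.sin k) ^ 2) l
        (𝓝 (gram22 ε μ (e k₀) 1 / gram11 ε μ (e k₀) 1)) := by
      refine (hq.congr' ?_).trans (le_of_eq ?_)
      · filter_upwards [hlI, hne] with k hk hk'
        have h2 := h.mul_eq_neg_sin_sq (hspec k).2
        have h3 := (sin_pos_of_mem_Ioo hk).ne'
        have h4 : e k - e k₀ ≠ 0 := sub_ne_zero.2 hk'
        have h5 : monoC ε μ (e k) ≠ 0 := fun h0 => by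
          rw [h0, mul_zero, eq_comm, neg_eq_zero] at h2
          exact h3 (pow_eq_zero_iff two_ne_zero |>.1 h2)
        simp only [Pi.div_apply, Function.comp, slope_def_field, hb, hcE, sub_zero]
        field_simp
        linear_combination (-monoB ε μ (e k)) * h2
      · congr 1
        field_simp
    have hsqrt := (continuous_sqrt.tendsto _).comp hsq
    refine ⟨s * √(gram22 ε μ (e k₀) 1 / gram11 ε μ (e k₀) 1), ?_, fun h0 => absurd hcE h0,
      fun _ => ?_⟩
    · refine (hsqrt.const_mul s).congr' ?_
      filter_upwards [hlI] with k hk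
      have h1 := (h.sign_of_isBand hband (hin k hk)).1
      have h2 := sin_pos_of_mem_Ioo hk
      have h3 : 0 < s * (monoB ε μ (e k) / Real.sin k) := by rw [← mul_div_assoc]; positivity
      have h4 : (monoB ε μ (e k) / Real.sin k) ^ 2 = (s * (monoB ε μ (e k) / Real.sin k)) ^ 2 := by
        rw [mul_pow, sq s, hss, one_mul]
      rw [Function.comp, h4, sqrt_sq h3.le, ← mul_assoc, hss, one_mul]
    · rw [mul_pow, sq_sqrt (by positivity), sq, hss]
      field_simp
  · refine ⟨0, ?_, fun _ => rfl, fun h0 => absurd h0 hcE⟩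
    have h1 : Tendsto (fun k => -Real.sin k / monoC ε μ (e k)) l
        (𝓝 (-Real.sin k₀ / monoC ε μ (e k₀))) :=
      ((continuous_sin.tendsto k₀).mono_left hl).neg.div
        ((h.continuous_monoC.tendsto _).comp he) hcE
    rw [hs, neg_zero, zero_div] at h1
    refine h1.congr' ?_
    filter_upwards [hlI] with k hk
    have h2 := h.mul_eq_neg_sin_sq (hspec k).2
    have h3 := (sin_pos_of_mem_Ioo hk).ne'
    have h5 : monoC ε μ (e k) ≠ 0 := fun h0 => by
      rw [h0, mul_zero, eq_comm, neg_eq_zero] at h2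
      exact h3 (pow_eq_zero_iff two_ne_zero |>.1 h2)
    field_simp
    linear_combination -h2

/-- The limits of the Bloch modes at the edges of the half zone. -/
theorem exists_tendsto_halfZoneMode {l : Filter ℝ} {k₀ : ℝ} (hl : l ≤ 𝓝 k₀)
    (hlI : ∀ᶠ k in l, k ∈ Ioo 0 π) (hs : Real.sin k₀ = 0) : ∃ P Q : ℝ,
    (∀ x, Tendsto (fun k => halfZoneMode ε μ j k x) l
      (𝓝 (comb ε μ (bandEnergy ε μ j k₀) P (Complex.I * Q) x))) ∧
    P * Q * gram12 ε μ (bandEnergy ε μ j k₀) 1 = 0 ∧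
    P ^ 2 * gram11 ε μ (bandEnergy ε μ j k₀) 1 - Q ^ 2 * gram22 ε μ (bandEnergy ε μ j k₀) 1 =
      edgeOverlap ε μ (bandEnergy ε μ j k₀) := by
  set e := bandEnergy ε μ j with he_def
  have he : Tendsto e l (𝓝 (e k₀)) := ((h.continuous_bandEnergy hc hj hjn).tendsto k₀).mono_left hl
  have hA := h.gram11_pos (e k₀)
  have hB := h.gram22_pos (e k₀)
  have hsin : Tendsto Real.sin l (𝓝 (Real.sin k₀)) := (continuous_sin.tendsto k₀).mono_left hl
  have tb := (h.continuous_monoB.tendsto _).comp he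
  have tA : Tendsto (fun k => gram11 ε μ (e k) 1) l (𝓝 (gram11 ε μ (e k₀) 1)) :=
    (h.hasDerivAt_gram11 (e k₀)).continuousAt.tendsto.comp he
  have tB : Tendsto (fun k => gram22 ε μ (e k) 1) l (𝓝 (gram22 ε μ (e k₀) 1)) :=
    (h.hasDerivAt_gram22 (e k₀)).continuousAt.tendsto.comp he
  suffices hmain : ∃ P Q : ℝ, Tendsto (fun k => modeP ε μ k (e k)) l (𝓝 P) ∧
      Tendsto (fun k => modeQ ε μ k (e k)) l (𝓝 Q) ∧ P * Q * gram12 ε μ (e k₀) 1 = 0 ∧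
      P ^ 2 * gram11 ε μ (e k₀) 1 - Q ^ 2 * gram22 ε μ (e k₀) 1 = edgeOverlap ε μ (e k₀) by
    obtain ⟨P, Q, hP, hQ, h1, h2⟩ := hmain
    refine ⟨P, Q, fun x => ?_, h1, h2⟩
    have t1 : Tendsto (fun k => psi1 ε μ (e k) x) l (𝓝 (psi1 ε μ (e k₀) x)) :=
      (analyticAt_psi1 h.eps.isTame h.mu.isTame x (e k₀)).continuousAt.tendsto.comp he
    have t2 : Tendsto (fun k => psi2 ε μ (e k) x) l (𝓝 (psi2 ε μ (e k₀) x)) :=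
      (analyticAt_psi2 h.eps.isTame h.mu.isTame x (e k₀)).continuousAt.tendsto.comp he
    refine Tendsto.congr' ?_ ((hP.ofReal.mul t1.ofReal).add
      ((hQ.ofReal.const_mul Complex.I).mul t2.ofReal))
    filter_upwards [hlI] with k hk
    rw [h.halfZoneMode_eq hc hj hjn hk, comb]
  by_cases hb : monoB ε μ (e k₀) = 0
  -- Both the coefficients and the norm are divided by sin k > 0, so that the limit is no longer of
  -- the form 0/0.
  · obtain ⟨t, ht, ht1, ht2⟩ := h.tendsto_modeB_div_sin hc hj hjn hl hlI hs hb
    have hD : 0 < t ^ 2 * gram11 ε μ (e k₀) 1 + gram22 ε μ (e k₀) 1 := by positivity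
    have tD : Tendsto (fun k => √((monoB ε μ (e k) / Real.sin k) ^ 2 * gram11 ε μ (e k) 1 +
        gram22 ε μ (e k) 1)) l (𝓝 √(t ^ 2 * gram11 ε μ (e k₀) 1 + gram22 ε μ (e k₀) 1)) :=
      (continuous_sqrt.tendsto _).comp (((ht.pow 2).mul tA).add tB)
    set D := √(t ^ 2 * gram11 ε μ (e k₀) 1 + gram22 ε μ (e k₀) 1) with hD_def
    have hD0 : 0 < D := sqrt_pos.2 hD
    have hDsq : D ^ 2 = t ^ 2 * gram11 ε μ (e k₀) 1 + gram22 ε μ (e k₀) 1 := sq_sqrt hD.le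
    have hN : ∀ᶠ k in l, modeN ε μ k (e k) = Real.sin k *
        √((monoB ε μ (e k) / Real.sin k) ^ 2 * gram11 ε μ (e k) 1 + gram22 ε μ (e k) 1) := by
      filter_upwards [hlI] with k hk
      have h1 := sin_pos_of_mem_Ioo hk
      nth_rw 1 [← sqrt_sq h1.le]
      rw [← sqrt_mul (sq_nonneg _), modeN]
      congr 1
      field_simp
    refine ⟨t / D, 1 / D, (ht.div tD hD0.ne').congr' ?_,
      ((tendsto_const_nhds (x := (1 : ℝ))).div tD hD0.ne').congr' ?_, ?_, ?_⟩
    · filter_upwards [hN] with k hk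
      rw [modeP, hk, Pi.div_apply, div_div]
    · filter_upwards [hN, hlI] with k hk hk'
      have h1 := (sin_pos_of_mem_Ioo hk').ne'
      rw [modeQ, hk, Pi.div_apply, div_mul_eq_div_div, div_self h1]
    · by_cases hcE : monoC ε μ (e k₀) = 0
      · rw [h.gram12_eq_zero hb hcE, mul_zero]
      · rw [ht1 hcE]; simp
    · have h1 : (t / D) ^ 2 * gram11 ε μ (e k₀) 1 - (1 / D) ^ 2 * gram22 ε μ (e k₀) 1 =
          (t ^ 2 * gram11 ε μ (e k₀) 1 - gram22 ε μ (e k₀) 1) / D ^ 2 := by ring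
      rw [h1, hDsq, edgeOverlap, if_pos hb]
      -- At a Dirac point the limit mode has equal even and odd weights and is orthogonal to its
      -- reflection; otherwise t = 0 and the mode is odd.
      by_cases hcE : monoC ε μ (e k₀) = 0
      · rw [if_pos hcE, ht2 hcE, sub_self, zero_div]
      · rw [if_neg hcE, ht1 hcE]
        field_simp
        ring
  · have hN0 : 0 < monoB ε μ (e k₀) ^ 2 * gram11 ε μ (e k₀) 1 +
        Real.sin k₀ ^ 2 * gram22 ε μ (e k₀) 1 := by positivity
    have tN : Tendsto (fun k => modeN ε μ k (e k)) l (𝓝 (modeN ε μ k₀ (e k₀))) :=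
      (continuous_sqrt.tendsto _).comp (((tb.pow 2).mul tA).add ((hsin.pow 2).mul tB))
    have hN : 0 < modeN ε μ k₀ (e k₀) := sqrt_pos.2 hN0
    have hNsq : modeN ε μ k₀ (e k₀) ^ 2 = monoB ε μ (e k₀) ^ 2 * gram11 ε μ (e k₀) 1 := by
      rw [modeN, sq_sqrt hN0.le, hs]; ring
    refine ⟨_, _, tb.div tN hN.ne', hsin.div tN hN.ne', ?_, ?_⟩
    · rw [hs]; simp
    · rw [hs, edgeOverlap, if_neg hb, div_pow, hNsq]
      field_simp
      ring

/-- The inner products of the one-sided limits of the Bloch modes. -/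
theorem cellInner_edgeMode :
    cellInner ε (edgeMode ε μ j (𝓝[>] 0)) (edgeMode ε μ j (𝓝[<] 0)) =
      edgeOverlap ε μ (bandEnergy ε μ j 0) ∧
    cellInner ε (edgeMode ε μ j (𝓝[>] (-π))) (edgeMode ε μ j (𝓝[<] π)) =
      edgeOverlap ε μ (bandEnergy ε μ j π) := by
  constructor
  · obtain ⟨P, Q, h1, h2, h3⟩ := h.exists_tendsto_halfZoneMode hc hj hjn
      (l := 𝓝[>] 0) nhdsWithin_le_nhds (Ioo_mem_nhdsGT pi_pos) sin_zero
    have e1 : edgeMode ε μ j (𝓝[>] 0) =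
        comb ε μ (bandEnergy ε μ j 0) P (Complex.I * Q) := by
      funext x
      refine Tendsto.limUnder_eq ((h1 x).congr' ?_)
      filter_upwards [self_mem_nhdsWithin] with k hk
      rw [blochMode, if_pos (le_of_lt hk)]
    have e2 : edgeMode ε μ j (𝓝[<] 0) =
        comb ε μ (bandEnergy ε μ j 0) P (-(Complex.I * Q)) := by
      funext x
      have tn : Tendsto (fun k : ℝ => -k) (𝓝[<] 0) (𝓝[>] 0) := by
        simpa using tendsto_neg_nhdsLT (a := (0 : ℝ))
      rw [← h.comb_neg]
      refine Tendsto.limUnder_eq (((h1 (-x)).comp tn).congr' ?_)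
      filter_upwards [self_mem_nhdsWithin] with k hk
      rw [blochMode, if_neg (not_le.2 hk), Function.comp]
    rw [e1, e2, (h.cellInner_comb_neg h2).1, h3]
  · obtain ⟨P, Q, h1, h2, h3⟩ := h.exists_tendsto_halfZoneMode hc hj hjn
      (l := 𝓝[<] π) nhdsWithin_le_nhds (Ioo_mem_nhdsLT pi_pos) sin_pi
    have e1 : edgeMode ε μ j (𝓝[<] π) =
        comb ε μ (bandEnergy ε μ j π) P (Complex.I * Q) := by
      funext x
      refine Tendsto.limUnder_eq ((h1 x).congr' ?_)
      filter_upwards [Ioo_mem_nhdsLT pi_pos] with k hk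
      rw [blochMode, if_pos hk.1.le]
    have e2 : edgeMode ε μ j (𝓝[>] (-π)) =
        comb ε μ (bandEnergy ε μ j π) P (-(Complex.I * Q)) := by
      funext x
      have tn : Tendsto (fun k : ℝ => -k) (𝓝[>] (-π)) (𝓝[<] π) := by
        simpa using tendsto_neg_nhdsGT (a := (-π : ℝ))
      rw [← h.comb_neg]
      refine Tendsto.limUnder_eq (((h1 (-x)).comp tn).congr' ?_)
      filter_upwards [Ioo_mem_nhdsGT (neg_lt_zero.2 pi_pos)] with k hk
      rw [blochMode, if_neg (not_le.2 hk.2), Function.comp]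
    rw [e1, e2, (h.cellInner_comb_neg h2).2, h3]

/-- The wavenumbers 0 and π are the two edges of the band, in an order that depends on the parity of
j and does not affect the product. -/
theorem exp_zakPhase : Complex.exp (Complex.I * zakPhase ε μ j) =
    ((edgeSign ε μ (L j) * edgeSign ε μ (U j) : ℝ) : ℂ) := by
  obtain ⟨h1, h2⟩ := h.cellInner_edgeMode hc hj hjn
  rw [h.zakPhase_eq hc hj hjn, h1, h2, mul_add, Complex.exp_add, exp_jumpPhase_edgeOverlap,
    exp_jumpPhase_edgeOverlap]
  rcases Nat.even_or_odd j with hp | hp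
  · rw [h.bandEnergy_upper hc hj hjn (k := 0) (by rw [cos_zero, hp.neg_one_pow]),
      h.bandEnergy_lower hc hj hjn (k := π) (by rw [cos_pi, pow_succ, hp.neg_one_pow, one_mul])]
    push_cast
    ring
  · rw [h.bandEnergy_lower hc hj hjn (k := 0) (by rw [cos_zero, pow_succ, hp.neg_one_pow]; norm_num),
      h.bandEnergy_upper hc hj hjn (k := π) (by rw [cos_pi, hp.neg_one_pow])]
    push_cast
    ring

end Chain

/-! ### The bulk index as the parity of a band-edge mode -/

section Chain

variable {n : ℕ} {L U : ℕ → ℝ} (hc : BandChain ε μ n L U) {m : ℕ} (hm : 1 ≤ m)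
include hc hm

/-- The modes at the two edges of a gap have opposite parities if the gap is open. -/
theorem edgeSign_mul_edgeSign (hmn : m < n) : edgeSign ε μ (U m) * edgeSign ε μ (L (m + 1)) =
    if U m = L (m + 1) then 1 else -1 := by
  have hb := hc.band m hm hmn.le
  have hb' := hc.band (m + 1) (by omega) hmn
  have hg := hc.gap m hm hmn
  split_ifs with heq
  · rw [← heq]
    obtain ⟨h1, h2⟩ := h.both_zero_of_touch hb hb' heq
    simp [edgeSign, h2]
  -- Each edge dictates the sign of b in the open gap through its own parity; equal parities would
  -- dictate opposite signs.
  · obtain ⟨E, hE⟩ := exists_between (lt_of_le_of_ne hg.le heq)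
    have hs : -((-1 : ℝ) ^ (m + 1)) = (-1) ^ m := by rw [pow_succ]; ring
    have hs' : (-1 : ℝ) ^ (m + 1 + 1) = (-1) ^ m := by rw [pow_succ, pow_succ]; ring
    have h1 := h.sign_of_gap_lower hb (by rw [hs]; exact hg) hE
    rw [hs'] at hb'
    have h2 := h.sign_of_gap_upper hb' hg hE
    rw [hs] at h1
    unfold edgeSign
    by_cases h3 : monoB ε μ (U m) = 0
    · obtain ⟨h4, h5⟩ := h1.1 h3
      have h6 : monoB ε μ (L (m + 1)) ≠ 0 := fun h0 => lt_asymm h5 (h2.1 h0).2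
      simp [h3, h4, h6]
    · have h5 := (h1.2 h3).2
      have h6 : monoB ε μ (L (m + 1)) = 0 := by
        by_contra h0
        exact lt_asymm h5 (h2.2 h0).2
      simp [h3, h6, (h2.1 h6).1]

-- The product regroups over the gaps, each open one giving -1. With N closed gaps among m - 1 there
-- are m - 1 - N open ones, a number of the same parity as m - 1 + N. The bottom edge E = 0 gives 1
-- since b > 0 there.
open Classical in
theorem prod_edgeSign (hmn : m ≤ n) :
    ∏ i ∈ Finset.Icc 1 m, (edgeSign ε μ (L i) * edgeSign ε μ (U i)) =
      (-1) ^ (m - 1 + ((Finset.Ico 1 m).filter fun i => U i = L (i + 1)).card) *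
        edgeSign ε μ (U m) := by
  induction m, hm using Nat.le_induction with
  | base => simp [hc.zero, edgeSign, h.monoB_zero_pos.ne']
  | succ m hm ih =>
    rw [← Finset.insert_Icc_right_eq_Icc_add_one (by omega), Finset.prod_insert (by simp),
      ih (by omega), ← Finset.insert_Ico_right_eq_Ico_add_one (by omega), Finset.filter_insert]
    have h1 := h.edgeSign_mul_edgeSign hc hm hmn
    obtain ⟨i, rfl⟩ : ∃ i, m = i + 1 := ⟨m - 1, by omega⟩
    simp only [Nat.add_sub_cancel]
    set N := ((Finset.Ico 1 (i + 1)).filter fun i => U i = L (i + 1)).card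
    split_ifs at h1 ⊢ with heq
    · rw [Finset.card_insert_of_notMem (by simp)]
      simp only [pow_add, pow_one]
      linear_combination ((-1) ^ i * (-1) ^ N * edgeSign ε μ (U (i + 1 + 1))) * h1
    · simp only [pow_add, pow_one]
      linear_combination ((-1) ^ i * (-1) ^ N * edgeSign ε μ (U (i + 1 + 1))) * h1

/-- The bulk index is the parity of the mode at the upper edge of the band. -/
theorem bulkIndex_eq (hmn : m < n) : bulkIndex ε μ m = edgeSign ε μ (U m) := by
  classical
  rw [bulkIndex, Finset.mul_sum, Complex.exp_sum, Finset.prod_congr rfl fun i hi =>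
    h.exp_zakPhase hc (Finset.mem_Icc.1 hi).1 ((Finset.mem_Icc.1 hi).2.trans hmn.le),
    ← Complex.ofReal_prod, h.prod_edgeSign hc hm hmn.le, h.numDiracBelow_eq hc hm hmn.le]
  -- The subtraction is truncated; m ≥ 1 allows moving it onto m, after which the two equal signs
  -- cancel.
  rw [show m + ((Finset.Ico 1 m).filter fun i => U i = L (i + 1)).card - 1 =
    m - 1 + ((Finset.Ico 1 m).filter fun i => U i = L (i + 1)).card by omega]
  push_cast
  rw [← mul_assoc, ← mul_pow]
  simp

end Chain

end IsSymmetricMedium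

/-! ### Square integrability on half-lines -/

/-- The integrals over successive periods form a geometric series; J/(1 - q) is the fixed point of S
↦ J + qS, which the induction preserves as a bound. -/
theorem integrableOn_Ioi_of_scaling {g : ℝ → ℝ} (hg : Continuous g) (hg0 : ∀ x, 0 ≤ g x) {q : ℝ}
    (hq0 : 0 ≤ q) (hq : q < 1) (h : ∀ x, g (x + 1) = q * g x) : IntegrableOn g (Ioi 0) := by
  set J := ∫ x in (0 : ℝ)..1, g x
  have hJ : 0 ≤ J := intervalIntegral.integral_nonneg zero_le_one fun x _ => hg0 x
  have hint : ∀ a b : ℝ, IntervalIntegrable g volume a b := fun a b => hg.intervalIntegrable a b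
  have hbound : ∀ n : ℕ, ∫ x in (0 : ℝ)..n, g x ≤ J / (1 - q) := by
    intro n
    induction n with
    | zero => simp only [Nat.cast_zero, intervalIntegral.integral_same]
              exact div_nonneg hJ (by linarith)
    | succ n ih =>
      have h1 : ∫ x in (1 : ℝ)..(n + 1), g x = q * ∫ x in (0 : ℝ)..n, g x := by
        have := intervalIntegral.integral_comp_add_right (a := 0) (b := n) g 1
        rw [zero_add] at this
        rw [← this, ← intervalIntegral.integral_const_mul]
        simp only [h]
      rw [Nat.cast_succ, ← intervalIntegral.integral_add_adjacent_intervals (hint 0 1) (hint 1 _),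
        h1]
      calc J + q * ∫ x in (0 : ℝ)..n, g x ≤ J + q * (J / (1 - q)) := by gcongr
        _ = J / (1 - q) := by field_simp [show (1 - q) ≠ 0 by linarith]; ring
  refine integrableOn_Ioi_of_intervalIntegral_norm_bounded (l := atTop) (b := fun n : ℕ => (n : ℝ))
    (J / (1 - q)) 0 (fun n => ?_) tendsto_natCast_atTop_atTop (Eventually.of_forall fun n => ?_)
  · exact hg.integrableOn_Ioc
  · simp only [norm_of_nonneg (hg0 _)]
    exact hbound n

theorem integrableOn_Ioi_comp_add_one {g : ℝ → ℝ} (hi : IntegrableOn g (Ioi 0)) :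
    IntegrableOn (fun x => g (x + 1)) (Ioi 0) := by
  have h1 := ((measurePreserving_add_right volume (1 : ℝ)).integrableOn_comp_preimage
    (measurableEmbedding_addRight 1) (f := g) (s := Ioi 1)).2
    (hi.mono_set (Ioi_subset_Ioi zero_le_one))
  have h2 : (fun x : ℝ => x + 1) ⁻¹' Ioi 1 = Ioi 0 := by ext x; simp
  rwa [h2] at h1

/-- The integral over (1, ∞) is q > 1 times the one over (0, ∞) without exceeding it, so both
vanish. The value at the endpoint 0 is then recovered from the interior point 1. -/
theorem eq_zero_of_integrableOn_Ioi_of_scaling {g : ℝ → ℝ} (hg : Continuous g)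
    (hg0 : ∀ x, 0 ≤ g x) {q : ℝ} (hq : 1 < q) (h : ∀ x, g (x + 1) = q * g x)
    (hi : IntegrableOn g (Ioi 0)) : g 0 = 0 := by
  have h1 : ∫ x in Ioi (1 : ℝ), g x = q * ∫ x in Ioi (0 : ℝ), g x := by
    have h2 := (measurePreserving_add_right volume (1 : ℝ)).setIntegral_preimage_emb
      (measurableEmbedding_addRight 1) g (Ioi 1)
    have h3 : (fun x : ℝ => x + 1) ⁻¹' Ioi 1 = Ioi 0 := by ext x; simp
    rw [h3] at h2
    rw [← h2, ← integral_const_mul]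
    simp only [h]
  have h2 : ∫ x in Ioi (1 : ℝ), g x ≤ ∫ x in Ioi (0 : ℝ), g x :=
    setIntegral_mono_set hi (Eventually.of_forall hg0)
      (Ioi_subset_Ioi zero_le_one).eventuallyLE
  have h3 : 0 ≤ ∫ x in Ioi (0 : ℝ), g x := integral_nonneg hg0
  have h4 : ∫ x in Ioi (0 : ℝ), g x = 0 := by nlinarith
  have h5 := (setIntegral_eq_zero_iff_of_nonneg_ae (Eventually.of_forall hg0) hi).1 h4
  have h6 : EqOn g 0 (Ioi 0) := Measure.eqOn_open_of_ae_eq h5 isOpen_Ioi hg.continuousOn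
    continuousOn_const
  have h7 := h6 (show (0 : ℝ) + 1 ∈ Ioi 0 by simp)
  rw [h, Pi.zero_apply] at h7
  exact (mul_eq_zero.1 h7).resolve_left (by linarith)

namespace IsSymmetricMedium

variable {ε μ : ℝ → ℝ} (h : IsSymmetricMedium ε μ)
include h

/-! ### The impedance functions -/

/-- The eigenvalues are a ∓ s√(a² - 1), and the sign s of a decides which one is small. The last
clause is the sign of the denominator of ξ_R. -/
theorem lambda_spec {s E : ℝ} (hs : s = 1 ∨ s = -1) (hE : 1 < s * monoA ε μ E) :
    (lambda1 ε μ E - monoA ε μ E) ^ 2 = monoB ε μ E * monoC ε μ E ∧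
    lambda2 ε μ E - monoA ε μ E = -(lambda1 ε μ E - monoA ε μ E) ∧
    lambda1 ε μ E ^ 2 < 1 ∧ 1 < lambda2 ε μ E ^ 2 ∧
    s * (lambda1 ε μ E - monoA ε μ E) < 0 := by
  have hss := mul_self_of_sign hs
  have hsq := h.monoA_sq E
  set a := monoA ε μ E
  have ha : 1 < a ^ 2 := by
    have : a ^ 2 = (s * a) * (s * a) := by rw [sq]; linear_combination (-(a * a)) * hss
    rw [this]; nlinarith
  set r := √(discriminant ε μ E ^ 2 - 4) with hr
  have hD : discriminant ε μ E = 2 * a := h.discriminant_eq E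
  have hr2 : r ^ 2 = 4 * (a ^ 2 - 1) := by
    rw [hr, sq_sqrt, hD]
    · ring
    · rw [hD]; nlinarith
  have hrpos : 0 < r := sqrt_pos.2 (by rw [hD]; nlinarith)
  have key : lambda1 ε μ E = a - s * r / 2 ∧ lambda2 ε μ E = a + s * r / 2 := by
    unfold lambda1 lambda2
    rw [← hr, hD]
    rcases hs with rfl | rfl
    · rw [if_pos (by linarith), if_pos (by linarith)]
      constructor <;> ring
    · rw [if_neg (by linarith), if_neg (by linarith)]
      constructor <;> ring
  obtain ⟨k1, k2⟩ := key
  have hprod : lambda1 ε μ E * lambda2 ε μ E = 1 := by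
    rw [k1, k2]
    linear_combination (-1 / 4 : ℝ) * hr2 - r ^ 2 / 4 * hss
  have hs1 : s * lambda1 ε μ E = s * a - r / 2 := by
    rw [k1]; linear_combination (-r / 2) * hss
  have hs2 : s * lambda2 ε μ E = s * a + r / 2 := by
    rw [k2]; linear_combination (r / 2) * hss
  have h2 : 1 < lambda2 ε μ E ^ 2 := by
    have : lambda2 ε μ E ^ 2 = (s * lambda2 ε μ E) ^ 2 := by rw [mul_pow, sq s, hss, one_mul]
    rw [this, hs2]
    nlinarith
  refine ⟨?_, ?_, ?_, h2, ?_⟩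
  · rw [k1]
    linear_combination r ^ 2 / 4 * hss + (1 / 4 : ℝ) * hr2 + hsq
  · rw [k1, k2]; ring
  · have : lambda1 ε μ E ^ 2 * lambda2 ε μ E ^ 2 = 1 := by rw [← mul_pow, hprod, one_pow]
    nlinarith [sq_nonneg (lambda1 ε μ E)]
  · rw [mul_sub, hs1]; linarith

variable {s E : ℝ} (hs : s = 1 ∨ s = -1) (hE : 1 < s * monoA ε μ E)
include hs hE

theorem lambda1_sub_ne_zero : lambda1 ε μ E - monoA ε μ E ≠ 0 := fun h0 => by
  have := (h.lambda_spec hs hE).2.2.2.2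
  rw [h0, mul_zero] at this
  exact lt_irrefl _ this

theorem mul_pos_of_gap : 0 < monoB ε μ E * monoC ε μ E := by
  rw [← (h.lambda_spec hs hE).1]
  exact sq_pos_of_ne_zero (h.lambda1_sub_ne_zero hs hE)

theorem monoB_ne_zero_of_gap : monoB ε μ E ≠ 0 := left_ne_zero_of_mul (h.mul_pos_of_gap hs hE).ne'

theorem xiL_eq : xiL ε μ E = -xiR ε μ E := by
  rw [xiL, xiR, (h.lambda_spec hs hE).2.1, div_neg]

theorem xiR_sq : xiR ε μ E ^ 2 = monoB ε μ E / monoC ε μ E := by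
  have hb := h.monoB_ne_zero_of_gap hs hE
  rw [xiR, div_pow, (h.lambda_spec hs hE).1, sq, mul_div_mul_left _ _ hb]

/-- Multiplying by s·b turns ξ_R into b²/(s(λ₁ - a)), whose denominator is negative. Hence ξ_R keeps
its sign in a gap, opposite to that of s·b. -/
theorem xiR_mul_neg : xiR ε μ E * (s * monoB ε μ E) < 0 := by
  have h1 := (h.lambda_spec hs hE).2.2.2.2
  have hb := h.monoB_ne_zero_of_gap hs hE
  have hne := h.lambda1_sub_ne_zero hs hE
  have hss := mul_self_of_sign hs
  have h2 : xiR ε μ E * (s * monoB ε μ E) =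
      monoB ε μ E ^ 2 / (s * (lambda1 ε μ E - monoA ε μ E)) := by
    have hs0 : s ≠ 0 := by rcases hs with rfl | rfl <;> norm_num
    rw [xiR]
    field_simp
    linear_combination hss
  rw [h2]
  exact div_neg_of_pos_of_neg (by positivity) h1

/-- The ratio ξ_R characterizes the Cauchy data that are eigenvectors for λ₁, that is, solutions
that shrink by the factor λ₁ over each period. -/
theorem integrableOn_comb_Ioi_iff (α β : ℂ) :
    IntegrableOn (fun x => ‖comb ε μ E α β x‖ ^ 2) (Ioi 0) ↔ α = xiR ε μ E * β := by
  obtain ⟨l1, l2, l3, l4, -⟩ := h.lambda_spec hs hE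
  have hb := h.monoB_ne_zero_of_gap hs hE
  have hne := h.lambda1_sub_ne_zero hs hE
  have hb' : (monoB ε μ E : ℂ) ≠ 0 := by exact_mod_cast hb
  have hne' : (lambda1 ε μ E - monoA ε μ E : ℂ) ≠ 0 := by exact_mod_cast hne
  have l1' : (lambda1 ε μ E - monoA ε μ E : ℂ) ^ 2 = monoB ε μ E * monoC ε μ E := by
    exact_mod_cast l1
  have l2' : (lambda2 ε μ E - monoA ε μ E : ℂ) = -(lambda1 ε μ E - monoA ε μ E) := by
    exact_mod_cast l2
  have hα : α = xiR ε μ E * β ↔ α * (lambda1 ε μ E - monoA ε μ E) = monoB ε μ E * β := by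
    rw [xiR, Complex.ofReal_div, Complex.ofReal_sub, div_mul_eq_mul_div, eq_div_iff hne']
  have hshift : ∀ x, comb ε μ E α β (x + 1) = (α * monoA ε μ E + β * monoB ε μ E) * psi1 ε μ E x +
      (α * monoC ε μ E + β * monoA ε μ E) * psi2 ε μ E x := by
    intro x
    rw [comb, h.psi1_add_one, h.psi2_add_one]
    push_cast
    ring
  have hcont := h.continuous_comb E α β
  rw [hα]
  constructor
  · intro hi
    -- This removes the λ₁-component. By Cayley-Hamilton w is multiplied by λ₂ over each period, yet
    -- it is square integrable, so w(0) = 0; this is the first row of the eigenvector equation.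
    set w : ℝ → ℂ := fun x => comb ε μ E α β (x + 1) - lambda1 ε μ E * comb ε μ E α β x with hw
    have hwc : Continuous w := by fun_prop
    have hw1 : ∀ x, w (x + 1) = lambda2 ε μ E * w x := by
      intro x
      simp only [hw]
      rw [hshift (x + 1), hshift, comb, h.psi1_add_one, h.psi2_add_one,
        show (lambda2 ε μ E : ℂ) = 2 * monoA ε μ E - lambda1 ε μ E by linear_combination l2']
      push_cast
      linear_combination (-(α * psi1 ε μ E x + β * psi2 ε μ E x)) * l1'
    have hw2 : ∀ x, ‖w (x + 1)‖ ^ 2 = lambda2 ε μ E ^ 2 * ‖w x‖ ^ 2 := by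
      intro x
      rw [hw1, norm_mul, mul_pow, Complex.norm_real, norm_eq_abs, sq_abs]
    have hwi : IntegrableOn (fun x => ‖w x‖ ^ 2) (Ioi 0) := by
      refine Integrable.mono' (((integrableOn_Ioi_comp_add_one hi).const_mul 2).add
        (hi.const_mul (2 * lambda1 ε μ E ^ 2))) (by fun_prop) (Eventually.of_forall fun x => ?_)
      have h1 := norm_sub_le (comb ε μ E α β (x + 1)) (lambda1 ε μ E * comb ε μ E α β x)
      rw [norm_mul, Complex.norm_real, norm_eq_abs] at h1
      rw [norm_of_nonneg (sq_nonneg _), Pi.add_apply]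
      have h2 := sq_abs (lambda1 ε μ E)
      calc ‖w x‖ ^ 2 ≤ (‖comb ε μ E α β (x + 1)‖ + |lambda1 ε μ E| * ‖comb ε μ E α β x‖) ^ 2 := by
            gcongr
        _ ≤ 2 * ‖comb ε μ E α β (x + 1)‖ ^ 2 +
            2 * |lambda1 ε μ E| ^ 2 * ‖comb ε μ E α β x‖ ^ 2 := by
            nlinarith [sq_nonneg (‖comb ε μ E α β (x + 1)‖ - |lambda1 ε μ E| * ‖comb ε μ E α β x‖)]
        _ = _ := by rw [h2]
    have h0 := eq_zero_of_integrableOn_Ioi_of_scaling (by fun_prop) (fun x => sq_nonneg _) l4 hw2 hwi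
    have h0' : w 0 = 0 := norm_eq_zero.1 (pow_eq_zero_iff two_ne_zero |>.1 h0)
    simp only [hw] at h0'
    rw [hshift, comb, h.psi1_zero, h.psi2_zero] at h0'
    push_cast at h0'
    linear_combination -h0'
  · intro hα
    have hα2 : α * monoC ε μ E = (lambda1 ε μ E - monoA ε μ E) * β := by
      apply mul_left_cancel₀ hne'
      apply mul_left_cancel₀ hb'
      linear_combination (monoB ε μ E * monoC ε μ E : ℂ) * hα - monoB ε μ E * β * l1'
    refine integrableOn_Ioi_of_scaling (by fun_prop) (fun x => sq_nonneg _) (sq_nonneg _) l3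
      fun x => ?_
    have h1 : comb ε μ E α β (x + 1) = lambda1 ε μ E * comb ε μ E α β x := by
      rw [hshift, comb]
      linear_combination (-psi1 ε μ E x : ℂ) * hα + psi2 ε μ E x * hα2
    rw [h1, norm_mul, mul_pow, Complex.norm_real, norm_eq_abs, sq_abs]

theorem integrableOn_comb_Iio_iff (α β : ℂ) :
    IntegrableOn (fun x => ‖comb ε μ E α β x‖ ^ 2) (Iio 0) ↔ α = xiL ε μ E * β := by
  have h1 := (Measure.measurePreserving_neg (volume : Measure ℝ)).integrableOn_comp_preimage
    (Homeomorph.neg ℝ).measurableEmbedding (f := fun x => ‖comb ε μ E α β x‖ ^ 2) (s := Iio 0)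
  have h2 : (Neg.neg : ℝ → ℝ) ⁻¹' Iio 0 = Ioi 0 := by ext x; simp
  rw [h2] at h1
  rw [← h1, h.xiL_eq hs hE, Complex.ofReal_neg, neg_mul, ← mul_neg,
    ← h.integrableOn_comb_Ioi_iff hs hE]
  simp only [Function.comp_def, h.comb_neg]

end IsSymmetricMedium

/-! ### Interface modes -/

theorem IsSolution.glue {ε₁ μ₁ ε₂ μ₂ : ℝ → ℝ} {E : ℝ} {u p v q : ℝ → ℂ} (hε₁ : IsTame ε₁)
    (hμ₁ : IsTame μ₁) (hε₂ : IsTame ε₂) (hμ₂ : IsTame μ₂) (h₁ : IsSolution ε₁ μ₁ E u p)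
    (h₂ : IsSolution ε₂ μ₂ E v q) (huv : v 0 = u 0) (hpq : q 0 = p 0) :
    IsSolution (joined ε₁ ε₂) (joined μ₁ μ₂) E (fun x => if 0 ≤ x then v x else u x)
      (fun x => if 0 ≤ x then q x else p x) := by
  obtain ⟨S₁, hS₁, hd₁⟩ := h₁.exists_hasDerivAt hε₁ hμ₁
  obtain ⟨S₂, hS₂, hd₂⟩ := h₂.exists_hasDerivAt hε₂ hμ₂
  refine IsSolution.of_hasDerivAt (hε₁.joined hε₂) (hμ₁.joined hμ₂)
    (Continuous.if_le h₂.continuous_fst h₁.continuous_fst continuous_const continuous_id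
      fun x hx => by rw [← hx, huv])
    (Continuous.if_le h₂.continuous_flux h₁.continuous_flux continuous_const continuous_id
      fun x hx => by rw [← hx, hpq])
    ((hS₁.union hS₂).union (countable_singleton 0)) fun x hx => ?_
  simp only [mem_union, mem_singleton_iff, not_or] at hx
  rcases lt_or_gt_of_ne hx.2 with hx0 | hx0
  · have hev : ∀ᶠ y in 𝓝 x, ¬(0 ≤ y) := by
      filter_upwards [Iio_mem_nhds hx0] with y hy
      exact not_le.2 hy
    simp only [joined, if_pos hx0, if_neg (not_le.2 hx0)]
    exact ⟨(hd₁ x hx.1.1).1.congr_of_eventuallyEq (hev.mono fun y hy => if_neg hy),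
      (hd₁ x hx.1.1).2.congr_of_eventuallyEq (hev.mono fun y hy => if_neg hy)⟩
  · have hev : ∀ᶠ y in 𝓝 x, 0 ≤ y := by
      filter_upwards [Ioi_mem_nhds hx0] with y hy
      exact le_of_lt hy
    simp only [joined, if_neg (not_lt.2 hx0.le), if_pos hx0.le]
    exact ⟨(hd₂ x hx.1.2).1.congr_of_eventuallyEq (hev.mono fun y hy => if_pos hy),
      (hd₂ x hx.1.2).2.congr_of_eventuallyEq (hev.mono fun y hy => if_pos hy)⟩

/-- The solution of the joined equation with Cauchy data `(α, β)` at the interface. -/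
def jointComb (ε₁ μ₁ ε₂ μ₂ : ℝ → ℝ) (E : ℝ) (α β : ℂ) (x : ℝ) : ℂ :=
  if 0 ≤ x then comb ε₂ μ₂ E α β x else comb ε₁ μ₁ E α β x

theorem jointComb_mul (ε₁ μ₁ ε₂ μ₂ : ℝ → ℝ) (E : ℝ) (α β c : ℂ) :
    jointComb ε₁ μ₁ ε₂ μ₂ E (c * α) (c * β) = c • jointComb ε₁ μ₁ ε₂ μ₂ E α β := by
  funext x
  simp only [jointComb, comb, Pi.smul_apply, smul_eq_mul]
  split_ifs <;> ring

section Interface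

variable {ε₁ μ₁ ε₂ μ₂ : ℝ → ℝ} (h₁ : IsSymmetricMedium ε₁ μ₁) (h₂ : IsSymmetricMedium ε₂ μ₂)
include h₁ h₂

theorem exists_isSolution_jointComb (E : ℝ) (α β : ℂ) : ∃ p,
    IsSolution (joined ε₁ ε₂) (joined μ₁ μ₂) E (jointComb ε₁ μ₁ ε₂ μ₂ E α β) p ∧ p 0 = β := by
  have hε₁ := h₁.eps.isTame
  have hμ₁ := h₁.mu.isTame
  have hε₂ := h₂.eps.isTame
  have hμ₂ := h₂.mu.isTame
  have h := (isSolution_combination hε₁ hμ₁ E α β).glue hε₁ hμ₁ hε₂ hμ₂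
    (isSolution_combination hε₂ hμ₂ E α β)
    (by simp [h₁.psi1_zero, h₁.psi2_zero, h₂.psi1_zero, h₂.psi2_zero])
    (by simp [flux1_zero hε₁ hμ₁, flux2_zero hε₁ hμ₁, flux1_zero hε₂ hμ₂, flux2_zero hε₂ hμ₂])
  exact ⟨_, h, by simp [flux1_zero hε₂ hμ₂, flux2_zero hε₂ hμ₂]⟩

omit h₁ in
theorem jointComb_zero (E : ℝ) (α β : ℂ) : jointComb ε₁ μ₁ ε₂ μ₂ E α β 0 = α := by
  simp [jointComb, comb, h₂.psi1_zero, h₂.psi2_zero]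

theorem eq_jointComb {E : ℝ} {u p : ℝ → ℂ}
    (hu : IsSolution (joined ε₁ ε₂) (joined μ₁ μ₂) E u p) :
    u = jointComb ε₁ μ₁ ε₂ μ₂ E (u 0) (p 0) := by
  obtain ⟨q, hq, hq0⟩ := exists_isSolution_jointComb h₁ h₂ E (u 0) (p 0)
  have hε := h₁.eps.isTame.joined h₂.eps.isTame
  have hμ := h₁.mu.isTame.joined h₂.mu.isTame
  funext x
  rw [(hu.eq_psi hε hμ x).1, (hq.eq_psi hε hμ x).1, jointComb_zero h₂, hq0]

theorem continuous_jointComb (E : ℝ) (α β : ℂ) : Continuous (jointComb ε₁ μ₁ ε₂ μ₂ E α β) := by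
  obtain ⟨p, hp, -⟩ := exists_isSolution_jointComb h₁ h₂ E α β
  exact hp.continuous_fst

theorem memLp_jointComb_iff (E : ℝ) (α β : ℂ) :
    MemLp (jointComb ε₁ μ₁ ε₂ μ₂ E α β) 2 volume ↔
      IntegrableOn (fun x => ‖comb ε₁ μ₁ E α β x‖ ^ 2) (Iio 0) ∧
      IntegrableOn (fun x => ‖comb ε₂ μ₂ E α β x‖ ^ 2) (Ioi 0) := by
  rw [memLp_two_iff_integrable_sq_norm
    (continuous_jointComb h₁ h₂ E α β).aestronglyMeasurable, ← integrableOn_univ,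
    ← Iic_union_Ioi (a := (0 : ℝ)), integrableOn_union, integrableOn_Iic_iff_integrableOn_Iio]
  refine and_congr (integrableOn_congr_fun (fun x hx => ?_) measurableSet_Iio)
    (integrableOn_congr_fun (fun x hx => ?_) measurableSet_Ioi)
  · simp only [jointComb, if_neg (not_le.2 (mem_Iio.1 hx))]
  · simp only [jointComb, if_pos (le_of_lt (mem_Ioi.1 hx))]

/-- A function that solves the equation for two energies vanishes, but the value at the interface is
α ≠ 0. This keeps modes of different energies apart in the final count. -/
theorem eq_of_jointComb_eq {E E' : ℝ} {α β α' β' : ℂ} (hα : α ≠ 0)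
    (heq : jointComb ε₁ μ₁ ε₂ μ₂ E α β = jointComb ε₁ μ₁ ε₂ μ₂ E' α' β') : E = E' := by
  by_contra hne
  obtain ⟨p, hp, -⟩ := exists_isSolution_jointComb h₁ h₂ E α β
  obtain ⟨p', hp', -⟩ := exists_isSolution_jointComb h₁ h₂ E' α' β'
  rw [← heq] at hp'
  have hpos : ∀ {f g : ℝ → ℝ}, (∀ x, 0 < f x) → (∀ x, 0 < g x) → ∀ x, 0 < joined f g x := by
    intro f g hf hg x
    unfold joined
    split_ifs
    exacts [hf x, hg x]
  have h0 := IsSolution.eq_zero_of_ne (h₁.eps.isTame.joined h₂.eps.isTame)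
    (h₁.mu.isTame.joined h₂.mu.isTame) (hpos h₁.eps.pos h₂.eps.pos) (hpos h₁.mu.pos h₂.mu.pos)
    hne hp hp'
  exact hα (by rw [← jointComb_zero h₂ E α β, h0, Pi.zero_apply])

variable {s₁ s₂ E : ℝ} (hs₁ : s₁ = 1 ∨ s₁ = -1) (hs₂ : s₂ = 1 ∨ s₂ = -1)
  (hE₁ : 1 < s₁ * monoA ε₁ μ₁ E) (hE₂ : 1 < s₂ * monoA ε₂ μ₂ E)
include hs₁ hE₁

omit h₂ in
theorem xiL_ne_zero : xiL ε₁ μ₁ E ≠ 0 := by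
  have h1 := h₁.xiR_mul_neg hs₁ hE₁
  rw [h₁.xiL_eq hs₁ hE₁, neg_ne_zero]
  exact left_ne_zero_of_mul h1.ne

include hs₂ hE₂

/-- The Cauchy data at the interface must lie on both lines α = ξ_L β and α = ξ_R β. Since β = 0
forces α = 0, the slopes agree and β is the only free factor. -/
theorem isInterfaceMode_iff (u : ℝ → ℂ) : IsInterfaceMode ε₁ μ₁ ε₂ μ₂ E u ↔
    xiL ε₁ μ₁ E - xiR ε₂ μ₂ E = 0 ∧
      ∃ c : ℂ, c ≠ 0 ∧ u = c • jointComb ε₁ μ₁ ε₂ μ₂ E (xiL ε₁ μ₁ E) 1 := by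
  constructor
  · rintro ⟨hu0, hu2, p, hp⟩
    have hu := eq_jointComb h₁ h₂ hp
    rw [hu, memLp_jointComb_iff h₁ h₂, h₁.integrableOn_comb_Iio_iff hs₁ hE₁,
      h₂.integrableOn_comb_Ioi_iff hs₂ hE₂] at hu2
    obtain ⟨h3, h4⟩ := hu2
    have hp0 : p 0 ≠ 0 := by
      intro h0
      rw [h0, mul_zero] at h3
      apply hu0
      rw [hu, h0, h3]
      funext x
      simp [jointComb, comb]
    refine ⟨?_, p 0, hp0, ?_⟩
    · have h5 := mul_right_cancel₀ hp0 (h3.symm.trans h4)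
      rw [sub_eq_zero]
      exact_mod_cast h5
    · rw [← jointComb_mul, mul_one, mul_comm, ← h3]
      exact hu
  · rintro ⟨hξ, c, hc, rfl⟩
    rw [← jointComb_mul, mul_one]
    refine ⟨fun h0 => ?_, ?_, ?_⟩
    · have h1 := congrFun h0 0
      rw [jointComb_zero h₂, Pi.zero_apply, mul_eq_zero] at h1
      rcases h1 with h1 | h1
      · exact hc h1
      · exact xiL_ne_zero h₁ hs₁ hE₁ (by exact_mod_cast h1)
    · rw [memLp_jointComb_iff h₁ h₂, h₁.integrableOn_comb_Iio_iff hs₁ hE₁,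
        h₂.integrableOn_comb_Ioi_iff hs₂ hE₂, ← sub_eq_zero.1 hξ]
      exact ⟨mul_comm _ _, mul_comm _ _⟩
    · obtain ⟨p, hp, -⟩ := exists_isSolution_jointComb h₁ h₂ E (c * xiL ε₁ μ₁ E) c
      exact ⟨p, hp⟩

end Interface

/-! ### Existence of an interface mode -/

namespace IsSymmetricMedium

variable {ε μ : ℝ → ℝ} (h : IsSymmetricMedium ε μ)
include h

section Gap

variable {n : ℕ} {L U : ℕ → ℝ} (hc : BandChain ε μ (n + 1) L U) (hn : 1 ≤ n) (hlt : U n < L (n + 1))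
include hc hn hlt

omit hlt in
theorem signs_in_gap : IsGap ε μ ((-1) ^ n) (U n) (L (n + 1)) ∧ ∀ E ∈ Ioo (U n) (L (n + 1)),
    ((monoB ε μ (U n) = 0 → monoC ε μ (U n) ≠ 0 ∧ 0 < (-1) ^ n * monoB ε μ E) ∧
    (monoB ε μ (U n) ≠ 0 → monoC ε μ (U n) = 0 ∧ (-1) ^ n * monoB ε μ E < 0)) ∧
    ((monoB ε μ (L (n + 1)) = 0 → monoC ε μ (L (n + 1)) ≠ 0 ∧ (-1) ^ n * monoB ε μ E < 0) ∧
    (monoB ε μ (L (n + 1)) ≠ 0 → monoC ε μ (L (n + 1)) = 0 ∧ 0 < (-1) ^ n * monoB ε μ E)) := by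
  have hb := hc.band n hn (by omega)
  have hb' := hc.band (n + 1) (by omega) le_rfl
  have hg := hc.gap n hn (by omega)
  have hs : -((-1 : ℝ) ^ (n + 1)) = (-1) ^ n := by rw [pow_succ]; ring
  have hs' : (-1 : ℝ) ^ (n + 1 + 1) = (-1) ^ n := by rw [pow_succ, pow_succ]; ring
  refine ⟨hg, fun E hE => ?_⟩
  have h1 := h.sign_of_gap_lower hb (by rw [hs]; exact hg) hE
  rw [hs'] at hb'
  have h2 := h.sign_of_gap_upper hb' hg hE
  rw [hs] at h1
  exact ⟨h1, h2⟩

omit h hc hn in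
theorem nonneg_on_gap {f : ℝ → ℝ} (hf : Continuous f) (hpos : ∀ E ∈ Ioo (U n) (L (n + 1)), 0 ≤ f E)
    {E : ℝ} (hE : E ∈ Icc (U n) (L (n + 1))) : 0 ≤ f E := by
  rw [← closure_Ioo hlt.ne] at hE
  exact closure_minimal (fun x hx => hpos x hx) (isClosed_le continuous_const hf) hE

omit hn hc hlt in
theorem sign_monoC {s E : ℝ} (hs : s = 1 ∨ s = -1) (hE : 1 < s * monoA ε μ E) :
    0 < (s * monoB ε μ E) * (s * monoC ε μ E) := by
  have h1 := h.mul_pos_of_gap hs hE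
  have hss := mul_self_of_sign hs
  have h2 : (s * monoB ε μ E) * (s * monoC ε μ E) = monoB ε μ E * monoC ε μ E := by
    linear_combination (monoB ε μ E * monoC ε μ E) * hss
  rwa [h2]

/-- The signs on a gap above a band whose upper edge carries an odd mode. -/
theorem signs_of_odd (hb : monoB ε μ (U n) = 0) :
    monoC ε μ (L (n + 1)) = 0 ∧
    (∀ E ∈ Ioc (U n) (L (n + 1)), 0 < (-1) ^ n * monoB ε μ E) ∧
    (∀ E ∈ Ico (U n) (L (n + 1)), 0 < (-1) ^ n * monoC ε μ E) := by
  obtain ⟨hg, hsig⟩ := h.signs_in_gap hc hn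
  obtain ⟨E₀, hE₀⟩ := exists_between hlt
  have hs := neg_one_pow_sign n
  have hs0 : ((-1 : ℝ)) ^ n ≠ 0 := by positivity
  have hCU := ((hsig E₀ hE₀).1.1 hb).1
  have hBL : monoB ε μ (L (n + 1)) ≠ 0 := fun h0 =>
    lt_asymm ((hsig E₀ hE₀).1.1 hb).2 ((hsig E₀ hE₀).2.1 h0).2
  have hB : ∀ E ∈ Ioo (U n) (L (n + 1)), 0 < (-1) ^ n * monoB ε μ E := fun E hE =>
    ((hsig E hE).1.1 hb).2
  have hC : ∀ E ∈ Ioo (U n) (L (n + 1)), 0 < (-1) ^ n * monoC ε μ E := fun E hE =>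
    (pos_iff_pos_of_mul_pos (h.sign_monoC hs (hg.one_lt E hE))).1 (hB E hE)
  refine ⟨((hsig E₀ hE₀).2.2 hBL).1, fun E hE => ?_, fun E hE => ?_⟩
  · rcases hE.2.lt_or_eq with h1 | rfl
    · exact hB E ⟨hE.1, h1⟩
    · exact lt_of_le_of_ne (nonneg_on_gap hlt (continuous_const.mul h.continuous_monoB)
        (fun E hE => (hB E hE).le) ⟨hlt.le, le_rfl⟩) (mul_ne_zero hs0 hBL).symm
  · rcases hE.1.lt_or_eq with h1 | rfl
    · exact hC E ⟨h1, hE.2⟩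
    · exact lt_of_le_of_ne (nonneg_on_gap hlt (continuous_const.mul h.continuous_monoC)
        (fun E hE => (hC E hE).le) ⟨le_rfl, hlt.le⟩) (mul_ne_zero hs0 hCU).symm

/-- The signs on a gap above a band whose upper edge carries an even mode. -/
theorem signs_of_even (hb : monoB ε μ (U n) ≠ 0) :
    monoC ε μ (U n) = 0 ∧ monoB ε μ (L (n + 1)) = 0 ∧
    (∀ E ∈ Ico (U n) (L (n + 1)), (-1) ^ n * monoB ε μ E < 0) ∧
    (∀ E ∈ Ioc (U n) (L (n + 1)), (-1) ^ n * monoC ε μ E < 0) := by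
  obtain ⟨hg, hsig⟩ := h.signs_in_gap hc hn
  obtain ⟨E₀, hE₀⟩ := exists_between hlt
  have hs := neg_one_pow_sign n
  have hs0 : ((-1 : ℝ)) ^ n ≠ 0 := by positivity
  have hBL : monoB ε μ (L (n + 1)) = 0 := by
    by_contra h0
    exact lt_asymm ((hsig E₀ hE₀).1.2 hb).2 ((hsig E₀ hE₀).2.2 h0).2
  have hCL := ((hsig E₀ hE₀).2.1 hBL).1
  have hB : ∀ E ∈ Ioo (U n) (L (n + 1)), (-1) ^ n * monoB ε μ E < 0 := fun E hE =>
    ((hsig E hE).1.2 hb).2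
  have hC : ∀ E ∈ Ioo (U n) (L (n + 1)), (-1) ^ n * monoC ε μ E < 0 := fun E hE =>
    (neg_iff_neg_of_mul_pos (h.sign_monoC hs (hg.one_lt E hE))).1 (hB E hE)
  refine ⟨((hsig E₀ hE₀).1.2 hb).1, hBL, fun E hE => ?_, fun E hE => ?_⟩
  · rcases hE.1.lt_or_eq with h1 | rfl
    · exact hB E ⟨h1, hE.2⟩
    · exact lt_of_le_of_ne (neg_nonneg.1 (nonneg_on_gap hlt
        (continuous_const.mul h.continuous_monoB).neg
        (fun E hE => neg_nonneg.2 (hB E hE).le) ⟨le_rfl, hlt.le⟩)) (mul_ne_zero hs0 hb)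
  · rcases hE.2.lt_or_eq with h1 | rfl
    · exact hC E ⟨hE.1, h1⟩
    · exact lt_of_le_of_ne (neg_nonneg.1 (nonneg_on_gap hlt
        (continuous_const.mul h.continuous_monoC).neg
        (fun E hE => neg_nonneg.2 (hC E hE).le) ⟨hlt.le, le_rfl⟩)) (mul_ne_zero hs0 hCL)

end Gap

end IsSymmetricMedium

variable {ε₁ μ₁ ε₂ μ₂ : ℝ → ℝ} (h₁ : IsSymmetricMedium ε₁ μ₁) (h₂ : IsSymmetricMedium ε₂ μ₂)
  {n₁ n₂ : ℕ} {L₁ U₁ L₂ U₂ : ℕ → ℝ} (hc₁ : BandChain ε₁ μ₁ (n₁ + 1) L₁ U₁)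
  (hc₂ : BandChain ε₂ μ₂ (n₂ + 1) L₂ U₂) (hn₁ : 1 ≤ n₁) (hn₂ : 1 ≤ n₂)
include h₁ h₂ hc₁ hc₂ hn₁ hn₂

/-- If the band-edge modes below two overlapping gaps have opposite parities, the impedances of the
two media are opposite somewhere. -/
theorem exists_xiR_eq_neg
    (hne : (Ioo (U₁ n₁) (L₁ (n₁ + 1)) ∩ Ioo (U₂ n₂) (L₂ (n₂ + 1))).Nonempty)
    (hb₁ : monoB ε₁ μ₁ (U₁ n₁) = 0) (hb₂ : monoB ε₂ μ₂ (U₂ n₂) ≠ 0) :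
    ∃ E ∈ Ioo (U₁ n₁) (L₁ (n₁ + 1)) ∩ Ioo (U₂ n₂) (L₂ (n₂ + 1)),
      xiR ε₁ μ₁ E = -xiR ε₂ μ₂ E := by
  obtain ⟨E₀, ⟨e1, e2⟩, e3, e4⟩ := hne
  have hlt₁ := e1.trans e2
  have hlt₂ := e3.trans e4
  have hs₁ := neg_one_pow_sign n₁
  have hs₂ := neg_one_pow_sign n₂
  obtain ⟨hCL₁, hB₁, hC₁⟩ := h₁.signs_of_odd hc₁ hn₁ hlt₁ hb₁
  obtain ⟨hCU₂, hBL₂, hB₂, hC₂⟩ := h₂.signs_of_even hc₂ hn₂ hlt₂ hb₂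
  rw [Ioo_inter_Ioo]
  set lo := max (U₁ n₁) (U₂ n₂) with hlo
  set hi := min (L₁ (n₁ + 1)) (L₂ (n₂ + 1)) with hhi
  have hlohi : lo < hi := (max_lt e1 e3).trans (lt_min e2 e4)
  have hlo₁ : U₁ n₁ ≤ lo := le_max_left _ _
  have hlo₂ : U₂ n₂ ≤ lo := le_max_right _ _
  have hhi₁ : hi ≤ L₁ (n₁ + 1) := min_le_left _ _
  have hhi₂ : hi ≤ L₂ (n₂ + 1) := min_le_right _ _
  -- A zero of G means b₁/c₁ = b₂/c₂, that is, equality of the squared impedances, without dividing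
  -- by functions that vanish at the ends. The powers of -1 normalize the signs to those known in
  -- the gaps.
  set G : ℝ → ℝ := fun E => ((-1) ^ n₁ * monoB ε₁ μ₁ E) * ((-1) ^ n₂ * monoC ε₂ μ₂ E) -
    ((-1) ^ n₂ * monoB ε₂ μ₂ E) * ((-1) ^ n₁ * monoC ε₁ μ₁ E) with hG
  have hGc : Continuous G :=
    ((continuous_const.mul h₁.continuous_monoB).mul (continuous_const.mul h₂.continuous_monoC)).sub
      ((continuous_const.mul h₂.continuous_monoB).mul (continuous_const.mul h₁.continuous_monoC))
  have hGlo : 0 < G lo := by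
    have h3 := mul_neg_of_neg_of_pos (hB₂ lo ⟨hlo₂, hlohi.trans_le hhi₂⟩)
      (hC₁ lo ⟨hlo₁, hlohi.trans_le hhi₁⟩)
    -- The left end is the lower edge of one of the gaps, and in either case the first product
    -- vanishes; the second one is negative.
    have h4 : monoB ε₁ μ₁ lo = 0 ∨ monoC ε₂ μ₂ lo = 0 := by
      rcases max_choice (U₁ n₁) (U₂ n₂) with h5 | h5
      · left; rw [hlo, h5, hb₁]
      · right; rw [hlo, h5, hCU₂]
    rcases h4 with h4 | h4 <;> simp only [hG, h4, mul_zero, zero_mul] <;> linarith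
  have hGhi : G hi < 0 := by
    have h3 := mul_neg_of_pos_of_neg (hB₁ hi ⟨hlo₁.trans_lt hlohi, hhi₁⟩)
      (hC₂ hi ⟨hlo₂.trans_lt hlohi, hhi₂⟩)
    -- The right end is the upper edge of one of the gaps, where parity has switched; now the second
    -- product vanishes and the first one is negative.
    have h4 : monoC ε₁ μ₁ hi = 0 ∨ monoB ε₂ μ₂ hi = 0 := by
      rcases min_choice (L₁ (n₁ + 1)) (L₂ (n₂ + 1)) with h5 | h5
      · left; rw [hhi, h5, hCL₁]
      · right; rw [hhi, h5, hBL₂]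
    rcases h4 with h4 | h4 <;> simp only [hG, h4, mul_zero, zero_mul] <;> linarith
  obtain ⟨E, hE, hE0⟩ := intermediate_value_Ioo' hlohi.le hGc.continuousOn
    (show (0 : ℝ) ∈ Ioo (G hi) (G lo) from ⟨hGhi, hGlo⟩)
  refine ⟨E, hE, ?_⟩
  have hE₁ : E ∈ Ioo (U₁ n₁) (L₁ (n₁ + 1)) := ⟨hlo₁.trans_lt hE.1, hE.2.trans_le hhi₁⟩
  have hE₂ : E ∈ Ioo (U₂ n₂) (L₂ (n₂ + 1)) := ⟨hlo₂.trans_lt hE.1, hE.2.trans_le hhi₂⟩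
  have ha₁ := (hc₁.gap n₁ hn₁ (by omega)).one_lt E hE₁
  have ha₂ := (hc₂.gap n₂ hn₂ (by omega)).one_lt E hE₂
  have hx₁ : xiR ε₁ μ₁ E < 0 :=
    neg_of_mul_neg_left (h₁.xiR_mul_neg hs₁ ha₁) (hB₁ E ⟨hE₁.1, hE₁.2.le⟩).le
  have hx₂ : 0 < xiR ε₂ μ₂ E := by
    have h3 := h₂.xiR_mul_neg hs₂ ha₂
    have h4 := hB₂ E ⟨hE₂.1.le, hE₂.2⟩
    by_contra! h5
    exact absurd (mul_nonneg_of_nonpos_of_nonpos h5 h4.le) (not_le.2 h3)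
  have hsq : xiR ε₁ μ₁ E ^ 2 = xiR ε₂ μ₂ E ^ 2 := by
    rw [h₁.xiR_sq hs₁ ha₁, h₂.xiR_sq hs₂ ha₂, div_eq_div_iff
      (right_ne_zero_of_mul (h₁.mul_pos_of_gap hs₁ ha₁).ne')
      (right_ne_zero_of_mul (h₂.mul_pos_of_gap hs₂ ha₂).ne')]
    have hs0 : ((-1 : ℝ)) ^ n₁ * (-1) ^ n₂ ≠ 0 := by positivity
    apply mul_left_cancel₀ hs0
    simp only [hG] at hE0
    linear_combination hE0
  -- The two impedances have opposite signs, so equal squares leave only the second alternative.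
  rcases sq_eq_sq_iff_eq_or_eq_neg.1 hsq with h3 | h3
  · linarith
  · exact h3

/-- If the bulk indices of the bands below two overlapping gaps differ, the impedances match
somewhere. -/
theorem exists_xiL_eq_xiR
    (hne : (Ioo (U₁ n₁) (L₁ (n₁ + 1)) ∩ Ioo (U₂ n₂) (L₂ (n₂ + 1))).Nonempty)
    (hγ : bulkIndex ε₁ μ₁ n₁ ≠ bulkIndex ε₂ μ₂ n₂) :
    ∃ E ∈ Ioo (U₁ n₁) (L₁ (n₁ + 1)) ∩ Ioo (U₂ n₂) (L₂ (n₂ + 1)),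
      xiL ε₁ μ₁ E - xiR ε₂ μ₂ E = 0 := by
  suffices hmain : ∃ E ∈ Ioo (U₁ n₁) (L₁ (n₁ + 1)) ∩ Ioo (U₂ n₂) (L₂ (n₂ + 1)),
      xiR ε₁ μ₁ E = -xiR ε₂ μ₂ E by
    obtain ⟨E, hE, h3⟩ := hmain
    refine ⟨E, hE, ?_⟩
    rw [h₁.xiL_eq (neg_one_pow_sign n₁) ((hc₁.gap n₁ hn₁ (by omega)).one_lt E hE.1), h3]
    ring
  rw [h₁.bulkIndex_eq hc₁ hn₁ (by omega), h₂.bulkIndex_eq hc₂ hn₂ (by omega)] at hγ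
  obtain ⟨E₀, ⟨e1, e2⟩, e3, e4⟩ := id hne
  have key₁ : monoB ε₁ μ₁ (U₁ n₁) = 0 → monoC ε₁ μ₁ (U₁ n₁) ≠ 0 := fun h0 =>
    (((h₁.signs_in_gap hc₁ hn₁).2 E₀ ⟨e1, e2⟩).1.1 h0).1
  have key₂ : monoB ε₂ μ₂ (U₂ n₂) = 0 → monoC ε₂ μ₂ (U₂ n₂) ≠ 0 := fun h0 =>
    (((h₂.signs_in_gap hc₂ hn₂).2 E₀ ⟨e3, e4⟩).1.1 h0).1
  -- Equal parities would give equal indices. In the mixed cases the equation is symmetric under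
  -- exchanging the media, so one of them suffices.
  by_cases hb₁ : monoB ε₁ μ₁ (U₁ n₁) = 0 <;> by_cases hb₂ : monoB ε₂ μ₂ (U₂ n₂) = 0
  · exact absurd (by simp [edgeSign, hb₁, hb₂, key₁ hb₁, key₂ hb₂]) hγ
  · exact exists_xiR_eq_neg h₁ h₂ hc₁ hc₂ hn₁ hn₂ hne hb₁ hb₂
  · rw [inter_comm] at hne ⊢
    obtain ⟨E, hE, h3⟩ := exists_xiR_eq_neg h₂ h₁ hc₂ hc₁ hn₂ hn₁ hne hb₂ hb₁
    exact ⟨E, hE, by rw [h3, neg_neg]⟩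
  · exact absurd (by simp [edgeSign, hb₁, hb₂]) hγ

end Photonic

end

/-! ### The interface modes of the joined structure -/

theorem mainTheorem1 (ε₁ μ₁ ε₂ μ₂ : ℝ → ℝ)
    (hε₁ : Photonic.IsSymmetricCoefficient ε₁) (hμ₁ : Photonic.IsSymmetricCoefficient μ₁)
    (hε₂ : Photonic.IsSymmetricCoefficient ε₂) (hμ₂ : Photonic.IsSymmetricCoefficient μ₂)
    (m₁ m₂ : ℕ) (hm₁ : 1 ≤ m₁) (hm₂ : 1 ≤ m₂)
    (I : Set ℝ) (hI : I = Photonic.bandGap ε₁ μ₁ m₁ ∩ Photonic.bandGap ε₂ μ₂ m₂)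
    (hne : I.Nonempty)
    (hγ : Photonic.bulkIndex ε₁ μ₁ m₁ ≠ Photonic.bulkIndex ε₂ μ₂ m₂) :
    -- an interface mode exists
    (∃ E ∈ I, ∃ u, Photonic.IsInterfaceMode ε₁ μ₁ ε₂ μ₂ E u) ∧
    -- the energies of interface modes in the gap are the roots
    (∀ E ∈ I, (∃ u, Photonic.IsInterfaceMode ε₁ μ₁ ε₂ μ₂ E u) ↔
      Photonic.xiL ε₁ μ₁ E - Photonic.xiR ε₂ μ₂ E = 0) ∧
    -- at each energy the interface mode is unique up to a factor
    (∀ E ∈ I, ∀ u v, Photonic.IsInterfaceMode ε₁ μ₁ ε₂ μ₂ E u →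
      Photonic.IsInterfaceMode ε₁ μ₁ ε₂ μ₂ E v → ∃ c : ℂ, v = c • u) ∧
    -- the number of interface modes, up to factors, is the number of roots
    {ℓ : Submodule ℂ (ℝ → ℂ) | ∃ E ∈ I, ∃ u, Photonic.IsInterfaceMode ε₁ μ₁ ε₂ μ₂ E u ∧
        ℓ = Submodule.span ℂ {u}}.encard =
      {E : ℝ | E ∈ I ∧ Photonic.xiL ε₁ μ₁ E - Photonic.xiR ε₂ μ₂ E = 0}.encard := by
  have h₁ : Photonic.IsSymmetricMedium ε₁ μ₁ := ⟨hε₁, hμ₁⟩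
  have h₂ : Photonic.IsSymmetricMedium ε₂ μ₂ := ⟨hε₂, hμ₂⟩
  subst hI
  obtain ⟨L₁, U₁, hc₁, hg₁, -⟩ := h₁.exists_chain_of_gap hm₁ (hne.mono inter_subset_left)
  obtain ⟨L₂, U₂, hc₂, hg₂, -⟩ := h₂.exists_chain_of_gap hm₂ (hne.mono inter_subset_right)
  rw [hg₁, hg₂] at hne ⊢
  set I := Ioo (U₁ m₁) (L₁ (m₁ + 1)) ∩ Ioo (U₂ m₂) (L₂ (m₂ + 1))
  have hs₁ := Photonic.neg_one_pow_sign m₁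
  have hs₂ := Photonic.neg_one_pow_sign m₂
  have ha₁ : ∀ E ∈ I, 1 < (-1) ^ m₁ * Photonic.monoA ε₁ μ₁ E := fun E hE =>
    (hc₁.gap m₁ hm₁ (by omega)).one_lt E hE.1
  have ha₂ : ∀ E ∈ I, 1 < (-1) ^ m₂ * Photonic.monoA ε₂ μ₂ E := fun E hE =>
    (hc₂.gap m₂ hm₂ (by omega)).one_lt E hE.2
  have key : ∀ E ∈ I, ∀ u, Photonic.IsInterfaceMode ε₁ μ₁ ε₂ μ₂ E u ↔ _ := fun E hE =>
    Photonic.isInterfaceMode_iff h₁ h₂ hs₁ hs₂ (ha₁ E hE) (ha₂ E hE)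
  set mode : ℝ → ℝ → ℂ := fun E =>
    Photonic.jointComb ε₁ μ₁ ε₂ μ₂ E (Photonic.xiL ε₁ μ₁ E) 1 with hmode
  have hroot : ∀ E ∈ I, Photonic.xiL ε₁ μ₁ E - Photonic.xiR ε₂ μ₂ E = 0 →
      Photonic.IsInterfaceMode ε₁ μ₁ ε₂ μ₂ E (mode E) := fun E hE h0 =>
    (key E hE _).2 ⟨h0, 1, one_ne_zero, (one_smul ℂ _).symm⟩
  have hiff : ∀ E ∈ I, (∃ u, Photonic.IsInterfaceMode ε₁ μ₁ ε₂ μ₂ E u) ↔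
      Photonic.xiL ε₁ μ₁ E - Photonic.xiR ε₂ μ₂ E = 0 := fun E hE =>
    ⟨fun ⟨u, hu⟩ => ((key E hE u).1 hu).1, fun h0 => ⟨_, hroot E hE h0⟩⟩
  refine ⟨?_, hiff, fun E hE u v hu hv => ?_, ?_⟩
  · obtain ⟨E, hE, h0⟩ := Photonic.exists_xiL_eq_xiR h₁ h₂ hc₁ hc₂ hm₁ hm₂ hne hγ
    exact ⟨E, hE, (hiff E hE).2 h0⟩
  · obtain ⟨-, c, hc, rfl⟩ := (key E hE u).1 hu
    obtain ⟨-, d, -, rfl⟩ := (key E hE v).1 hv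
    exact ⟨d / c, by rw [smul_smul, div_mul_cancel₀ _ hc]⟩
  · have himage : {ℓ : Submodule ℂ (ℝ → ℂ) | ∃ E ∈ I, ∃ u,
        Photonic.IsInterfaceMode ε₁ μ₁ ε₂ μ₂ E u ∧ ℓ = Submodule.span ℂ {u}} =
        (fun E => Submodule.span ℂ {mode E}) ''
          {E : ℝ | E ∈ I ∧ Photonic.xiL ε₁ μ₁ E - Photonic.xiR ε₂ μ₂ E = 0} := by
      ext ℓ
      constructor
      · rintro ⟨E, hE, u, hu, rfl⟩
        obtain ⟨h0, c, hc, rfl⟩ := (key E hE u).1 hu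
        exact ⟨E, ⟨hE, h0⟩, (Submodule.span_singleton_smul_eq (IsUnit.mk0 c hc) _).symm⟩
      · rintro ⟨E, ⟨hE, h0⟩, rfl⟩
        exact ⟨E, hE, mode E, hroot E hE h0, rfl⟩
    rw [himage]
    -- If two roots gave the same line, their modes would be proportional and would solve the
    -- equation for both energies.
    refine InjOn.encard_image fun E hE E' hE' heq => ?_
    have hmem : mode E ∈ Submodule.span ℂ {mode E'} :=
      (SetLike.ext_iff.1 heq _).1 (Submodule.mem_span_singleton_self _)
    obtain ⟨c, hc⟩ := Submodule.mem_span_singleton.1 hmem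
    rw [hmode] at hc
    beta_reduce at hc
    rw [← Photonic.jointComb_mul] at hc
    refine Photonic.eq_of_jointComb_eq h₁ h₂ ?_ hc.symm
    exact_mod_cast Photonic.xiL_ne_zero h₁ hs₁ (ha₁ E hE.1)
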